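/- Let $n\ge 3$ and $p>0$, and give $\mathbb{R}^n$ the density $|x|^p$. The weighted volume of a measurable set is the integral of the density over it, and its weighted perimeter is the integral of the density over its topological boundary with respect to $(n-1)$-dimensional Hausdorff measure. A measurable set of finite weighted volume is called isoperimetric if it minimizes weighted perimeter among all measurable sets of the same weighted volume. Let $E\subset\mathbb{R}^n$ be an open isoperimetric set that is spherically symmetric about the positive $e_1$-axis, i.e. for every $r>0$ the set $E\cap\{|x|=r\}$ is a (possibly empty or full) spherical cap of $\{|x|=r\}$ centered at $(r,0,\dots,0)$. Let $A=\{(a,b)\in\mathbb{R}^2 : a e_1+b e_2\in E\}$ be the planar set that generates $E$ by rotation about the $e_1$-axis, and suppose that the rightmost point of $\partial A$ is $(1,0)$. Let $\gamma=(\gamma_1,\gamma_2):[-\beta,\beta]\to\partial A$, $\beta>0$, be the closed Jordan curve obtained by following $\partial A$ from $\gamma(0)=(1,0)$ in both directions until it meets the $e_1$-axis again, parameterized counterclockwise by arclength: $\gamma(-\beta)=\gamma(\beta)$ and $\gamma_2(\beta)=0$, with $\gamma_2>0$ on $(0,\beta)$ and $\gamma_2<0$ on $(-\beta,0)$. As usual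 for the regular part of the boundary, $\gamma$ is continuous on $[-\beta,\beta]$ and smooth on $(-\beta,\beta)$, and near each point $\gamma(s)$, $s\in(-\beta,\beta)$, the set $\partial A$ consists only of points of $\gamma$. For small $s\ne 0$ let $F(s)$ be the abscissa of the center of the canonical circle at $s$, i.e. of the unique circle centered on the $e_1$-axis that passes through $\gamma(s)$ and is tangent there to $\gamma'(s)$, and let $F(0)=\lim_{s\to 0}F(s)$. If $F(0)<1/2$, then $\gamma_1(\beta)<0$, and the limit $\lim_{s\to\beta^-}\gamma'(s)$ exists, lies in the closed third quadrant $\{(x,y): x\le 0,\ y\le 0\}$, and is not equal to $(0,-1)$. -/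

import Mathlib

open Set Filter Topology MeasureTheory
open scoped ENNReal ContDiff

noncomputable section

namespace RadialPower

/-- The density `r ^ p` on `ℝⁿ`, as an extended nonnegative real. -/
def density {n : ℕ} (p : ℝ) (x : EuclideanSpace ℝ (Fin n)) : ℝ≥0∞ :=
  ENNReal.ofReal (‖x‖ ^ p)

/-- Weighted volume: the integral of the density over `E`. -/
def weightedVolume {n : ℕ} (p : ℝ) (E : Set (EuclideanSpace ℝ (Fin n))) : ℝ≥0∞ :=
  ∫⁻ x in E, density p x

/-- Weighted perimeter: the integral of the density over the topological boundary of `E`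
with respect to `(n - 1)`-dimensional Hausdorff measure. -/
def weightedPerimeter {n : ℕ} (p : ℝ) (E : Set (EuclideanSpace ℝ (Fin n))) : ℝ≥0∞ :=
  ∫⁻ x in frontier E, density p x ∂(μHE[n - 1])

/-- `E` minimizes weighted perimeter among all measurable sets of the same (finite)
weighted volume. -/
structure IsIsoperimetric {n : ℕ} (p : ℝ) (E : Set (EuclideanSpace ℝ (Fin n))) : Prop where
  measurable : MeasurableSet E
  volume_ne_top : weightedVolume p E ≠ ⊤
  minimal : ∀ E' : Set (EuclideanSpace ℝ (Fin n)), MeasurableSet E' →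
    weightedVolume p E' = weightedVolume p E → weightedPerimeter p E ≤ weightedPerimeter p E'

/-- `E` is spherically symmetric about the positive `e₁`-axis: it meets every sphere centered at
the origin in an (open or closed, possibly empty or full) spherical cap whose pole is on
that half-axis. -/
def IsSphericallySymmetric {n : ℕ} [NeZero n] (E : Set (EuclideanSpace ℝ (Fin n))) : Prop :=
  ∀ r : ℝ, 0 < r → ∃ t : ℝ,
    E ∩ Metric.sphere 0 r = {x | x ∈ Metric.sphere 0 r ∧ t < x 0} ∨
    E ∩ Metric.sphere 0 r = {x | x ∈ Metric.sphere 0 r ∧ t ≤ x 0}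

/-- The planar set `A = {(a, b) | a e₁ + b e₂ ∈ E}`. If `E` is rotationally symmetric
about the `e₁`-axis, then `E` is the rotation of `A` about that axis. -/
def crossSection {n : ℕ} [NeZero n] (E : Set (EuclideanSpace ℝ (Fin n))) :
    Set (EuclideanSpace ℝ (Fin 2)) :=
  {q | EuclideanSpace.single (0 : Fin n) (q 0) + EuclideanSpace.single (1 : Fin n) (q 1) ∈ E}

/-- `γ : [-β, β] → ℝ²` is the curve in the boundary of the planar set `A` that starts at the
rightmost boundary point `(1, 0)` and follows the boundary in both directions, counterclockwise
and parameterized by arclength, until it meets the `e₁`-axis again. The boundary of `A` is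
a smooth embedded curve near each point that is passed on the way. -/
structure IsGeneratingCurve (A : Set (EuclideanSpace ℝ (Fin 2))) (β : ℝ)
    (γ : ℝ → EuclideanSpace ℝ (Fin 2)) : Prop where
  pos : 0 < β
  start : γ 0 = !₂[1, 0]
  rightmost : ∀ q ∈ frontier A, q 0 ≤ 1
  continuousOn : ContinuousOn γ (Icc (-β) β)
  smooth : ContDiffOn ℝ ∞ γ (Ioo (-β) β)
  unit_speed : ∀ s ∈ Ioo (-β) β, ‖deriv γ s‖ = 1
  closed : γ (-β) = γ β
  injOn : InjOn γ (Ico (-β) β)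
  mem_boundary : ∀ s ∈ Icc (-β) β, γ s ∈ frontier A
  follows_boundary : ∀ s ∈ Ioo (-β) β, ∃ U : Set (EuclideanSpace ℝ (Fin 2)),
    IsOpen U ∧ γ s ∈ U ∧ frontier A ∩ U ⊆ γ '' Icc (-β) β
  above : ∀ s ∈ Ioo 0 β, 0 < γ s 1
  below : ∀ s ∈ Ioo (-β) 0, γ s 1 < 0
  end_on_axis : γ β 1 = 0

/-- `a` is the abscissa of the center of the canonical circle of `γ` at `s`, where `γ s` is off the
`e₁`-axis: the circle with center `(a, 0)` and some radius `R > 0` passes through `γ s` and is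
tangent there to `γ' s`. There is exactly one such `a` unless `γ' s` is vertical, in which
case there is none. -/
def IsCanonicalAbscissa (γ : ℝ → EuclideanSpace ℝ (Fin 2)) (s a : ℝ) : Prop :=
  ∃ R : ℝ, 0 < R ∧ γ s ∈ Metric.sphere !₂[a, 0] R ∧
    inner ℝ (γ s - !₂[a, 0]) (deriv γ s) = 0

/-- `F₀ = F(0)`: the canonical circle at `0` is the limit of the canonical circles at `s` as
`s → 0`, and `F₀` is the abscissa of its center. -/
def IsInitialAbscissa (γ : ℝ → EuclideanSpace ℝ (Fin 2)) (F₀ : ℝ) : Prop :=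
  ∃ F : ℝ → ℝ, (∀ᶠ s in 𝓝[≠] 0, IsCanonicalAbscissa γ s (F s)) ∧
    Tendsto F (𝓝[≠] 0) (𝓝 F₀)

end RadialPower

end

/-! The case `F₀ < 1/2` never occurs: the curve of an isoperimetric set always has `1/2 ≤ F₀`
(`one_half_le_initialAbscissa`), and the theorem follows by contradiction.

Notation for the upper half `(u, v)` of the curve, in arclength: `X = uu' + vv'`, `Y = uv' - vu'`,
`r² = u² + v²`; `κ = u'v'' - v'u''` is the curvature of the meridian, `λ = -u'/v` that of the
parallels, and `h = Y/r²` the angular speed. The circle through the origin tangent to the curve has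
curvature `2h`; put `D = 2h - κ`.

Geometry. Finite volume and spherical symmetry confine `E` to the closed unit ball
(`norm_le_one_of_mem_crossSection`), and symmetry gives `X ≤ 0` (`radial_deriv_nonpos`): otherwise
`∂A` would contain an arc of a circle about the origin at a point where its curve crosses that
circle. As long as `Y > 0`, the set is locally a polar subgraph. Volume-preserving radial
perturbations are then competitors, and `first_variation` and `euler_lagrange` show that `κ + (n-2)λ
+ ph` is constant. Comparing weighted areas needs an area formula for Hausdorff measure and
reduction of rotationally symmetric integrals to the half-plane.

Differential equation. `F₀ < 1/2` means `κ(0) < 2`, that is `D(0) > 0`. Moreover `h' = -(X/r²) D`,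
the momentum `(λ - κ) v^(n-1)` has derivative `p v^(n-1) h'`, and (polar angle) `+ arctan (X/Y)` has
derivative `D`. While `D > 0`, the first two do not decrease and the third increases from `0`. Thus
`λ ≥ κ`, the positive angle yields `2h > λ`, and `D = (2h - λ) + (λ - κ)` stays positive
(`IsProfile.good_of_forall_lt`). If `X` is not identically zero, the momentum exceeds some `m₀ > 0`
from some point on, so the angle plus `m₀ log v` does not decrease. The angle is bounded and `v → 0`
at the end of the curve, a contradiction. Hence the curve is the unit semicircle
(`IsProfile.normSq_eq_one`).

Balls. The boundary of `E` would then contain the unit sphere without its poles, while the ball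
about the origin with the same weighted volume has radius at most `1`. Since `p > 0`, deforming that
ball along the axis at fixed weighted volume lowers its weighted perimeter to second order
(`exists_perturbedElement_lt`), so `E` is not optimal (`IsIsoperimetric.not_sphere_subset`). -/

noncomputable section

namespace RadialPower

/-! ### Area formula for Hausdorff measure -/

section AreaFormula

open scoped NNReal

/-- If `f` is Lipschitz relative to `g` on `A`, the Hausdorff measure of `f '' A` is controlled by
that of `g '' A`. -/
theorem euclideanHausdorffMeasure_image_le_of_dist_le {α X Y : Type*}
    [MetricSpace X] [MeasurableSpace X] [BorelSpace X]
    [MetricSpace Y] [MeasurableSpace Y] [BorelSpace Y] {f : α → X} {g : α → Y} {K : ℝ≥0}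
    {A : Set α} (h : ∀ x ∈ A, ∀ y ∈ A, dist (f x) (f y) ≤ K * dist (g x) (g y)) (d : ℕ) :
    μHE[d] (f '' A) ≤ (K : ℝ≥0∞) ^ d * μHE[d] (g '' A) := by
  rcases A.eq_empty_or_nonempty with rfl | ⟨a₀, -⟩
  · simp
  have : Nonempty α := ⟨a₀⟩
  set φ : Y → X := fun z => f (Function.invFunOn g A z)
  have hinv : ∀ x ∈ A, Function.invFunOn g A (g x) ∈ A ∧ g (Function.invFunOn g A (g x)) = g x :=
    fun x hx => ⟨Function.invFunOn_mem ⟨x, hx, rfl⟩, Function.invFunOn_eq ⟨x, hx, rfl⟩⟩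
  have hφ : ∀ x ∈ A, φ (g x) = f x := by
    intro x hx
    have h1 := h _ (hinv x hx).1 x hx
    rw [(hinv x hx).2, dist_self, mul_zero] at h1
    exact dist_le_zero.1 h1
  have hlip : LipschitzOnWith K φ (g '' A) := by
    apply LipschitzOnWith.of_dist_le_mul
    rintro _ ⟨x, hx, rfl⟩ _ ⟨y, hy, rfl⟩
    rw [hφ x hx, hφ y hy]
    exact h x hx y hy
  have himg : φ '' (g '' A) = f '' A := by
    rw [image_image]
    exact image_congr hφ
  have h2 := hlip.hausdorffMeasure_image_le (d := (d : ℝ)) (Nat.cast_nonneg d)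
  rw [himg, ENNReal.rpow_natCast] at h2
  simp_rw [Measure.euclideanHausdorffMeasure_def, Measure.smul_apply,
    Measure.nnreal_smul_coe_apply]
  calc _ ≤ _ := mul_le_mul_right h2 _
    _ = _ := by ring

variable {k : ℕ} {F : Type*} [NormedAddCommGroup F] [NormedSpace ℝ F] [MeasurableSpace F]
  [BorelSpace F]

/-- Close to `y₀` distances under `T` agree with those under `L` up to the factor `K`, and `L` has
the same norms as `D`. So `T '' A` and `D '' A` are `K`-Lipschitz images of each other. Since `D`
maps `ℝᵏ` to itself, Lebesgue measure scales by its determinant. -/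
theorem exists_nhds_area_bounds {T : EuclideanSpace ℝ (Fin k) → F}
    {L : EuclideanSpace ℝ (Fin k) →L[ℝ] F}
    {D : EuclideanSpace ℝ (Fin k) →L[ℝ] EuclideanSpace ℝ (Fin k)}
    {y₀ : EuclideanSpace ℝ (Fin k)} (hT : HasStrictFDerivAt T L y₀)
    (hD : ∀ v, ‖L v‖ = ‖D v‖) (hdet : LinearMap.det (D : EuclideanSpace ℝ (Fin k) →ₗ[ℝ] _) ≠ 0)
    {K : ℝ≥0} (hK : 1 < K) :
    ∃ N ∈ 𝓝 y₀, ∀ A ⊆ N,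
      μHE[k] (T '' A) ≤ (K : ℝ≥0∞) ^ k *
        (ENNReal.ofReal |LinearMap.det (D : EuclideanSpace ℝ (Fin k) →ₗ[ℝ] _)| * volume A) ∧
      ENNReal.ofReal |LinearMap.det (D : EuclideanSpace ℝ (Fin k) →ₗ[ℝ] _)| * volume A ≤
        (K : ℝ≥0∞) ^ k * μHE[k] (T '' A) := by
  have hker : LinearMap.ker (D : EuclideanSpace ℝ (Fin k) →ₗ[ℝ] EuclideanSpace ℝ (Fin k)) = ⊥ :=
    (LinearMap.equivOfDetNeZero (D : EuclideanSpace ℝ (Fin k) →ₗ[ℝ] EuclideanSpace ℝ (Fin k))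
      hdet).ker
  obtain ⟨C, hC0, hC⟩ := LinearMap.exists_antilipschitzWith _ hker
  have hC' : ∀ v, ‖v‖ ≤ C * ‖D v‖ := fun v => by
    have := hC.le_mul_dist v 0
    simpa using this
  have hK0 : (0 : ℝ) < K := by exact_mod_cast zero_lt_one.trans hK
  have hK1 : (1 : ℝ) < K := by exact_mod_cast hK
  have hCpos : (0 : ℝ) < C := by exact_mod_cast hC0
  -- With `‖v‖ ≤ C ‖D v‖`, this makes the linearization error at most `(1 - 1/K) ‖D v‖`. The
  -- Lipschitz bounds become `2 - 1/K ≤ K` from above and `1/K` from below.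
  set δ : ℝ≥0 := (1 - K⁻¹) / C with hδ
  have hKinv : K⁻¹ < 1 := inv_lt_one_of_one_lt₀ hK
  have hδ0 : 0 < δ := div_pos (tsub_pos_of_lt hKinv) hC0
  have hδC : (δ : ℝ) * C = 1 - (K : ℝ)⁻¹ := by
    rw [hδ, NNReal.coe_div, NNReal.coe_sub hKinv.le]
    push_cast
    field_simp
  obtain ⟨N, hN, happ⟩ := hT.approximates_deriv_on_nhds (Or.inr hδ0)
  have key : ∀ x ∈ N, ∀ y ∈ N, ‖T x - T y - L (x - y)‖ ≤ (1 - (K : ℝ)⁻¹) * ‖D (x - y)‖ := by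
    intro x hx y hy
    calc _ ≤ δ * ‖x - y‖ := happ x hx y hy
      _ ≤ δ * (C * ‖D (x - y)‖) := by gcongr; exact hC' _
      _ = _ := by rw [← mul_assoc, hδC]
  have hvol : ∀ A, ENNReal.ofReal |LinearMap.det (D : EuclideanSpace ℝ (Fin k) →ₗ[ℝ] _)| * volume A
      = μHE[k] (D '' A) := fun A => by
    rw [EuclideanSpace.euclideanHausdorffMeasure_eq_volume,
      Measure.addHaar_image_continuousLinearMap]
  refine ⟨N, hN, fun A hA => ?_⟩
  rw [hvol]
  constructor
  · apply euclideanHausdorffMeasure_image_le_of_dist_le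
    intro x hx y hy
    rw [dist_eq_norm, dist_eq_norm, ← map_sub]
    have h1 := key x (hA hx) y (hA hy)
    have h2 := norm_sub_norm_le (T x - T y) (L (x - y))
    rw [hD] at h2
    have h3 : 2 - (K : ℝ)⁻¹ ≤ K := by
      have : (K : ℝ) * (K : ℝ)⁻¹ = 1 := mul_inv_cancel₀ hK0.ne'
      nlinarith [sq_nonneg ((K : ℝ) - 1), inv_pos.2 hK0]
    nlinarith [norm_nonneg (D (x - y))]
  · apply euclideanHausdorffMeasure_image_le_of_dist_le
    intro x hx y hy
    rw [dist_eq_norm, dist_eq_norm, ← map_sub]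
    have h1 := key x (hA hx) y (hA hy)
    have h2 := norm_sub_norm_le (L (x - y)) (T x - T y)
    rw [norm_sub_rev (L (x - y)), hD] at h2
    have h3 : (K : ℝ)⁻¹ * ‖D (x - y)‖ ≤ ‖T x - T y‖ := by linarith
    calc ‖D (x - y)‖ = K * ((K : ℝ)⁻¹ * ‖D (x - y)‖) := by field_simp
      _ ≤ _ := by gcongr

/-- By continuity `J` may be frozen at `y₀`, at the cost of one more factor `K`; hence the exponent
`k + 1`. -/
theorem exists_nhds_area_integral_bounds {T : EuclideanSpace ℝ (Fin k) → F}
    {L : EuclideanSpace ℝ (Fin k) → EuclideanSpace ℝ (Fin k) →L[ℝ] F}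
    {D : EuclideanSpace ℝ (Fin k) → EuclideanSpace ℝ (Fin k) →L[ℝ] EuclideanSpace ℝ (Fin k)}
    {S : Set (EuclideanSpace ℝ (Fin k))} (hS : IsOpen S)
    {J : EuclideanSpace ℝ (Fin k) → ℝ}
    (hT : ∀ y ∈ S, HasStrictFDerivAt T (L y) y)
    (hD : ∀ y ∈ S, ∀ v, ‖L y v‖ = ‖D y v‖)
    (hJ : ∀ y ∈ S, J y = |LinearMap.det (D y : EuclideanSpace ℝ (Fin k) →ₗ[ℝ] _)|)
    (hJ0 : ∀ y ∈ S, 0 < J y) (hJc : ContinuousOn J S) {K : ℝ≥0} (hK : 1 < K)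
    {y₀ : EuclideanSpace ℝ (Fin k)} (hy₀ : y₀ ∈ S) :
    ∃ N, IsOpen N ∧ y₀ ∈ N ∧ ∀ A ⊆ N ∩ S, MeasurableSet A →
      μHE[k] (T '' A) ≤ (K : ℝ≥0∞) ^ (k + 1) * ∫⁻ y in A, ENNReal.ofReal (J y) ∧
      ∫⁻ y in A, ENNReal.ofReal (J y) ≤ (K : ℝ≥0∞) ^ (k + 1) * μHE[k] (T '' A) := by
  have hK0 : (0 : ℝ) < K := by exact_mod_cast zero_lt_one.trans hK
  have hK1 : (1 : ℝ) < K := by exact_mod_cast hK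
  have hJy := hJ0 y₀ hy₀
  obtain ⟨N, hN, hA⟩ := exists_nhds_area_bounds (hT y₀ hy₀) (hD y₀ hy₀)
    (by have := hJ y₀ hy₀ ▸ hJy; exact abs_pos.1 this) hK
  have hcont : ContinuousAt J y₀ := hJc.continuousAt (hS.mem_nhds hy₀)
  have h1 : ∀ᶠ y in 𝓝 y₀, J y < K * J y₀ :=
    hcont.eventually (gt_mem_nhds (by nlinarith))
  have h2 : ∀ᶠ y in 𝓝 y₀, J y₀ / K < J y :=
    hcont.eventually (lt_mem_nhds (by rw [div_lt_iff₀ hK0]; nlinarith))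
  obtain ⟨N', hN', hN'o, hyN'⟩ := mem_nhds_iff.1 (inter_mem hN (inter_mem h1 h2))
  refine ⟨N', hN'o, hyN', fun A hAN hAm => ?_⟩
  obtain ⟨hu, hl⟩ := hA A (fun x hx => (hN' (hAN hx).1).1)
  rw [← hJ y₀ hy₀] at hu hl
  have e1 : ENNReal.ofReal (J y₀) * volume A ≤ K * ∫⁻ y in A, ENNReal.ofReal (J y) := by
    rw [← setLIntegral_const, ← lintegral_const_mul' _ _ ENNReal.coe_ne_top]
    refine setLIntegral_mono' hAm fun y hy => ?_
    have := (hN' (hAN hy).1).2.2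
    simp only [mem_ofPred_eq] at this
    rw [div_lt_iff₀ hK0] at this
    rw [← ENNReal.ofReal_coe_nnreal, ← ENNReal.ofReal_mul hK0.le]
    exact ENNReal.ofReal_le_ofReal (by linarith)
  have e2 : ∫⁻ y in A, ENNReal.ofReal (J y) ≤ K * (ENNReal.ofReal (J y₀) * volume A) := by
    rw [← mul_assoc, ← setLIntegral_const]
    refine setLIntegral_mono' hAm fun y hy => ?_
    have := (hN' (hAN hy).1).2.1
    simp only [mem_ofPred_eq] at this
    rw [← ENNReal.ofReal_coe_nnreal, ← ENNReal.ofReal_mul hK0.le]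
    exact ENNReal.ofReal_le_ofReal this.le
  constructor
  · calc _ ≤ _ := hu
      _ ≤ (K : ℝ≥0∞) ^ k * (K * ∫⁻ y in A, ENNReal.ofReal (J y)) := by gcongr
      _ = _ := by ring
  · calc _ ≤ _ := e2
      _ ≤ (K : ℝ≥0∞) * ((K : ℝ≥0∞) ^ k * μHE[k] (T '' A)) := by gcongr
      _ = _ := by ring

/-- Countably many of the local neighbourhoods cover `S`. Injectivity keeps the images of disjoint
pieces disjoint, so the local bounds add up with the same constant, which later tends to `1`. -/
theorem area_formula_bounds {T : EuclideanSpace ℝ (Fin k) → F}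
    {L : EuclideanSpace ℝ (Fin k) → EuclideanSpace ℝ (Fin k) →L[ℝ] F}
    {D : EuclideanSpace ℝ (Fin k) → EuclideanSpace ℝ (Fin k) →L[ℝ] EuclideanSpace ℝ (Fin k)}
    {S : Set (EuclideanSpace ℝ (Fin k))} (hS : IsOpen S)
    {J : EuclideanSpace ℝ (Fin k) → ℝ}
    (hT : ∀ y ∈ S, HasStrictFDerivAt T (L y) y)
    (hD : ∀ y ∈ S, ∀ v, ‖L y v‖ = ‖D y v‖)
    (hJ : ∀ y ∈ S, J y = |LinearMap.det (D y : EuclideanSpace ℝ (Fin k) →ₗ[ℝ] _)|)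
    (hJ0 : ∀ y ∈ S, 0 < J y) (hJc : ContinuousOn J S) (hinj : InjOn T S) {K : ℝ≥0} (hK : 1 < K)
    {A : Set (EuclideanSpace ℝ (Fin k))} (hAm : MeasurableSet A) (hAS : A ⊆ S) :
    μHE[k] (T '' A) ≤ (K : ℝ≥0∞) ^ (k + 1) * ∫⁻ y in A, ENNReal.ofReal (J y) ∧
      ∫⁻ y in A, ENNReal.ofReal (J y) ≤ (K : ℝ≥0∞) ^ (k + 1) * μHE[k] (T '' A) := by
  have hex := fun y₀ (hy₀ : y₀ ∈ S) =>
    exists_nhds_area_integral_bounds hS hT hD hJ hJ0 hJc hK hy₀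
  choose! N hNo hyN hN using hex
  obtain ⟨t, htS, htc, hcov⟩ := TopologicalSpace.countable_cover_nhdsWithin (f := N) (s := S)
    fun x hx => mem_nhdsWithin_of_mem_nhds ((hNo x hx).mem_nhds (hyN x hx))
  rcases t.eq_empty_or_nonempty with rfl | hne
  · have : A = ∅ := by
      rw [eq_empty_iff_forall_notMem]
      intro x hx
      simpa using hcov (hAS hx)
    simp [this]
  obtain ⟨e, he⟩ := htc.exists_eq_range hne
  have heS : ∀ i, e i ∈ S := fun i => htS (he ▸ mem_range_self i)
  set B : ℕ → Set (EuclideanSpace ℝ (Fin k)) := disjointed fun i => N (e i)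
  have hBm : ∀ i, MeasurableSet (A ∩ B i) := fun i =>
    hAm.inter (MeasurableSet.disjointed (fun i => (hNo _ (heS i)).measurableSet) i)
  have hBN : ∀ i, A ∩ B i ⊆ N (e i) ∩ S := fun i x hx =>
    ⟨disjointed_subset _ i hx.2, hAS hx.1⟩
  have hBd : Pairwise (Function.onFun Disjoint fun i => A ∩ B i) := fun i j hij =>
    (disjoint_disjointed _ hij).mono inter_subset_right inter_subset_right
  have hAU : A = ⋃ i, A ∩ B i := by
    rw [← inter_iUnion, iUnion_disjointed, eq_comm, inter_eq_left]
    intro x hx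
    have := hcov (hAS hx)
    rw [he, biUnion_range] at this
    exact this
  have hTc : ContinuousOn T S := fun y hy =>
    (hT y hy).continuousAt.continuousWithinAt
  have hH : μHE[k] (T '' A) = ∑' i, μHE[k] (T '' (A ∩ B i)) := by
    conv_lhs => rw [hAU, image_iUnion]
    refine measure_iUnion (fun i j hij => ?_) fun i => ?_
    · refine disjoint_left.2 ?_
      rintro _ ⟨x, hx, rfl⟩ ⟨y, hy, hxy⟩
      have := hinj (hAS hy.1) (hAS hx.1) hxy
      subst this
      exact disjoint_left.1 (hBd hij) hx hy
    · exact (hBm i).image_of_continuousOn_injOn (hTc.mono ((hBN i).trans inter_subset_right))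
        (hinj.mono ((hBN i).trans inter_subset_right))
  have hI : ∫⁻ y in A, ENNReal.ofReal (J y) = ∑' i, ∫⁻ y in A ∩ B i, ENNReal.ofReal (J y) := by
    conv_lhs => rw [hAU]
    exact lintegral_iUnion hBm hBd _
  rw [hH, hI, ← ENNReal.tsum_mul_left, ← ENNReal.tsum_mul_left]
  exact ⟨ENNReal.tsum_le_tsum fun i => (hN _ (heS i) _ (hBN i) (hBm i)).1,
    ENNReal.tsum_le_tsum fun i => (hN _ (heS i) _ (hBN i) (hBm i)).2⟩

theorem ENNReal_le_of_forall_one_lt_mul_pow_le {a b : ℝ≥0∞} {d : ℕ}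
    (h : ∀ K : ℝ≥0, 1 < K → a ≤ (K : ℝ≥0∞) ^ d * b) : a ≤ b := by
  have ht : Tendsto (fun K : ℝ≥0 => (K : ℝ≥0∞) ^ d * b) (𝓝[>] 1) (𝓝 (((1 : ℝ≥0) : ℝ≥0∞) ^ d * b)) := by
    refine ENNReal.Tendsto.mul_const ?_ (Or.inl (by simp))
    have : Continuous fun K : ℝ≥0 => (K : ℝ≥0∞) ^ d := by fun_prop
    exact this.continuousAt.tendsto.mono_left nhdsWithin_le_nhds
  simp only [ENNReal.coe_one, one_pow, one_mul] at ht
  exact ge_of_tendsto ht (eventually_mem_nhdsWithin.mono h)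

/-- Area formula for an injective `C¹` immersion of an open subset of `ℝᵏ`. -/
theorem euclideanHausdorffMeasure_image_eq_lintegral {T : EuclideanSpace ℝ (Fin k) → F}
    {L : EuclideanSpace ℝ (Fin k) → EuclideanSpace ℝ (Fin k) →L[ℝ] F}
    {D : EuclideanSpace ℝ (Fin k) → EuclideanSpace ℝ (Fin k) →L[ℝ] EuclideanSpace ℝ (Fin k)}
    {S : Set (EuclideanSpace ℝ (Fin k))} (hS : IsOpen S)
    {J : EuclideanSpace ℝ (Fin k) → ℝ}
    (hT : ∀ y ∈ S, HasStrictFDerivAt T (L y) y)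
    (hD : ∀ y ∈ S, ∀ v, ‖L y v‖ = ‖D y v‖)
    (hJ : ∀ y ∈ S, J y = |LinearMap.det (D y : EuclideanSpace ℝ (Fin k) →ₗ[ℝ] _)|)
    (hJ0 : ∀ y ∈ S, 0 < J y) (hJc : ContinuousOn J S) (hinj : InjOn T S)
    {A : Set (EuclideanSpace ℝ (Fin k))} (hAm : MeasurableSet A) (hAS : A ⊆ S) :
    μHE[k] (T '' A) = ∫⁻ y in A, ENNReal.ofReal (J y) :=
  le_antisymm
    (ENNReal_le_of_forall_one_lt_mul_pow_le fun _ hK =>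
      (area_formula_bounds hS hT hD hJ hJ0 hJc hinj hK hAm hAS).1)
    (ENNReal_le_of_forall_one_lt_mul_pow_le fun _ hK =>
      (area_formula_bounds hS hT hD hJ hJ0 hJc hinj hK hAm hAS).2)

/-- Change of variables for the Hausdorff measure on the image of an injective `C¹` immersion. -/
theorem lintegral_image_euclideanHausdorffMeasure {T : EuclideanSpace ℝ (Fin k) → F}
    {L : EuclideanSpace ℝ (Fin k) → EuclideanSpace ℝ (Fin k) →L[ℝ] F}
    {D : EuclideanSpace ℝ (Fin k) → EuclideanSpace ℝ (Fin k) →L[ℝ] EuclideanSpace ℝ (Fin k)}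
    {S : Set (EuclideanSpace ℝ (Fin k))} (hS : IsOpen S)
    {J : EuclideanSpace ℝ (Fin k) → ℝ}
    (hT : ∀ y ∈ S, HasStrictFDerivAt T (L y) y)
    (hD : ∀ y ∈ S, ∀ v, ‖L y v‖ = ‖D y v‖)
    (hJ : ∀ y ∈ S, J y = |LinearMap.det (D y : EuclideanSpace ℝ (Fin k) →ₗ[ℝ] _)|)
    (hJ0 : ∀ y ∈ S, 0 < J y) (hJc : ContinuousOn J S) (hinj : InjOn T S)
    {f : F → ℝ≥0∞} (hf : Measurable f) :
    ∫⁻ x in T '' S, f x ∂μHE[k] = ∫⁻ y in S, ENNReal.ofReal (J y) * f (T y) := by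
  have hTc : ContinuousOn T S := fun y hy =>
    (hT y hy).continuousAt.continuousWithinAt
  have hTm : AEMeasurable T (volume.restrict S) := hTc.aemeasurable hS.measurableSet
  have hJm : AEMeasurable (fun y => ENNReal.ofReal (J y)) (volume.restrict S) :=
    (hJc.aemeasurable hS.measurableSet).ennreal_ofReal
  set ν : Measure (EuclideanSpace ℝ (Fin k)) :=
    (volume.restrict S).withDensity fun y => ENNReal.ofReal (J y)
  have hac : ν ≪ volume.restrict S := withDensity_absolutelyContinuous _ _
  have hTν : AEMeasurable T ν := hTm.mono_ac hac
  have hTSm : MeasurableSet (T '' S) :=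
    hS.measurableSet.image_of_continuousOn_injOn hTc hinj
  -- The measure on the image is the pushforward of `J dy`. As `T` is controlled only on `S`, the
  -- preimage of `B` is replaced by a measurable `u` with the same trace on `S`.
  have hmap : (μHE[k] : Measure F).restrict (T '' S) = ν.map T := by
    ext B hB
    obtain ⟨u, hu, huT⟩ : ∃ u, MeasurableSet u ∧ T ⁻¹' B ∩ S = u ∩ S := by
      obtain ⟨g, hg, hgT⟩ := hTm
      refine ⟨((S.domRestrict T ⁻¹' B)).image (↑), ?_, ?_⟩
      · exact hS.measurableSet.subtype_image
          ((continuousOn_iff_continuous_domRestrict.1 hTc).measurable hB)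
      · ext x
        simp only [mem_inter_iff, mem_preimage, mem_image, Subtype.exists, domRestrict_apply]
        constructor
        · rintro ⟨h1, h2⟩; exact ⟨⟨x, h2, h1, rfl⟩, h2⟩
        · rintro ⟨⟨a, h2, h1, rfl⟩, h3⟩; exact ⟨h1, h3⟩
    have himg : B ∩ T '' S = T '' (u ∩ S) := by
      rw [← huT, inter_comm, ← image_inter_preimage, inter_comm]
    rw [Measure.restrict_apply hB, himg,
      euclideanHausdorffMeasure_image_eq_lintegral hS hT hD hJ hJ0 hJc hinj
        (hu.inter hS.measurableSet) inter_subset_right,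
      Measure.map_apply_of_aemeasurable hTν hB]
    have hae : ν (T ⁻¹' B) = ν u := by
      refine measure_congr (hac.ae_le ?_)
      filter_upwards [ae_restrict_mem hS.measurableSet] with x hx
      have : (x ∈ T ⁻¹' B ∩ S) = (x ∈ u ∩ S) := by rw [huT]
      simp only [mem_inter_iff, hx, and_true] at this
      exact this
    rw [hae, withDensity_apply _ hu, Measure.restrict_restrict hu]
  rw [hmap, lintegral_map' hf.aemeasurable hTν, lintegral_withDensity_eq_lintegral_mul₀' hJm]
  · rfl
  · exact (hf.comp_aemeasurable hTν)

end AreaFormula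

/-! ### Reduction of rotationally symmetric integrals to the half-plane -/

section Rotation

variable {k : ℕ}

/-- The component of `x` orthogonal to the `e₁`-axis. -/
def tail (x : EuclideanSpace ℝ (Fin (k + 1))) : EuclideanSpace ℝ (Fin k) :=
  WithLp.toLp 2 fun i => x i.succ

theorem continuous_tail : Continuous (tail (k := k)) := by
  unfold tail
  fun_prop

theorem norm_sq_eq_tail (x : EuclideanSpace ℝ (Fin (k + 1))) :
    ‖x‖ ^ 2 = x 0 ^ 2 + ‖tail x‖ ^ 2 := by
  simp [EuclideanSpace.norm_sq_eq, Fin.sum_univ_succ, tail]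

theorem norm_eq_sqrt_tail (x : EuclideanSpace ℝ (Fin (k + 1))) :
    ‖x‖ = √(x 0 ^ 2 + ‖tail x‖ ^ 2) := by
  rw [← norm_sq_eq_tail, Real.sqrt_sq (norm_nonneg _)]

/-- The vector with first coordinate `a` and remaining coordinates `y`. -/
def join (a : ℝ) (y : EuclideanSpace ℝ (Fin k)) : EuclideanSpace ℝ (Fin (k + 1)) :=
  WithLp.toLp 2 (Fin.cons a fun i => y i)

@[simp] theorem join_zero (a : ℝ) (y : EuclideanSpace ℝ (Fin k)) : join a y 0 = a := rfl

@[simp] theorem tail_join (a : ℝ) (y : EuclideanSpace ℝ (Fin k)) : tail (join a y) = y := rfl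

theorem join_tail (x : EuclideanSpace ℝ (Fin (k + 1))) : join (x 0) (tail x) = x := by
  ext i
  refine Fin.cases rfl (fun i => rfl) i

/-- `join` as a linear map. -/
def joinL : ℝ × EuclideanSpace ℝ (Fin k) →ₗ[ℝ] EuclideanSpace ℝ (Fin (k + 1)) where
  toFun q := join q.1 q.2
  map_add' q q' := by
    ext i
    refine Fin.cases rfl (fun i => rfl) i
  map_smul' c q := by
    ext i
    refine Fin.cases rfl (fun i => rfl) i

theorem norm_sq_join (a : ℝ) (y : EuclideanSpace ℝ (Fin k)) :
    ‖join a y‖ ^ 2 = a ^ 2 + ‖y‖ ^ 2 := by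
  rw [norm_sq_eq_tail, join_zero, tail_join]

/-- The total mass of the unit sphere of `ℝᵏ`. -/
def sphereMass (k : ℕ) : ℝ≥0∞ :=
  (volume : Measure (EuclideanSpace ℝ (Fin k))).toSphere univ

theorem sphereMass_ne_top : sphereMass k ≠ ⊤ := measure_ne_top _ _

theorem sphereMass_ne_zero (hk : 1 ≤ k) : sphereMass k ≠ 0 := by
  rw [sphereMass, Measure.toSphere_apply_univ]
  refine mul_ne_zero ?_ (Metric.measure_ball_pos _ _ one_pos).ne'
  simp
  omega

theorem lintegral_fun_norm (hk : 1 ≤ k) {f : ℝ → ℝ≥0∞} (hf : Measurable f) :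
    ∫⁻ y : EuclideanSpace ℝ (Fin k), f ‖y‖ =
      sphereMass k * ∫⁻ r in Ioi (0 : ℝ), ENNReal.ofReal (r ^ (k - 1)) * f r := by
  have : Nonempty (Fin k) := ⟨⟨0, hk⟩⟩
  calc ∫⁻ y : EuclideanSpace ℝ (Fin k), f ‖y‖
      = ∫⁻ x : ({(0)}ᶜ : Set (EuclideanSpace ℝ (Fin k))), f (‖x.1‖) ∂(volume.comap Subtype.val) := by
        rw [lintegral_subtype_comap (measurableSet_singleton _).compl fun x => f ‖x‖,
          restrict_compl_singleton]
    _ = ∫⁻ x, f x.2.1 ∂((volume : Measure (EuclideanSpace ℝ (Fin k))).toSphere.prod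
          (.volumeIoiPow (Module.finrank ℝ (EuclideanSpace ℝ (Fin k)) - 1))) := by
        rw [← (Measure.measurePreserving_homeomorphUnitSphereProd volume).lintegral_comp_emb
          (Homeomorph.measurableEmbedding _)]
        simp only [homeomorphUnitSphereProd_apply_snd_coe]
    _ = sphereMass k * ∫⁻ x : Ioi (0 : ℝ), f x.1 ∂(.volumeIoiPow (k - 1)) := by
        rw [lintegral_prod _ (by fun_prop)]
        simp only [lintegral_const, finrank_euclideanSpace, Fintype.card_fin]
        rw [mul_comm]
        rfl
    _ = _ := by
        rw [Measure.volumeIoiPow, lintegral_withDensity_eq_lintegral_mul _ (by fun_prop)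
          (by fun_prop)]
        congr 1
        exact lintegral_subtype_comap measurableSet_Ioi
          fun r => ENNReal.ofReal (r ^ (k - 1)) * f r

theorem measurePreserving_join_symm :
    MeasurePreserving (fun x : EuclideanSpace ℝ (Fin (k + 1)) => (x 0, tail x)) := by
  have h1 := PiLp.volume_preserving_ofLp (Fin (k + 1))
  have h2 := volume_preserving_piFinSuccAbove (fun _ : Fin (k + 1) => ℝ) 0
  have h3 : MeasurePreserving (Prod.map id (WithLp.toLp 2) : ℝ × (Fin k → ℝ) → _) :=
    (MeasurePreserving.id (volume : Measure ℝ)).prod (PiLp.volume_preserving_toLp (Fin k))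
  exact h3.comp (h2.comp h1)

/-- Planar weight generating weighted volume and perimeter of bodies of revolution. -/
def weight (k : ℕ) (p a b : ℝ) : ℝ := √(a ^ 2 + b ^ 2) ^ p * b ^ (k - 1)

theorem weight_nonneg {p a b : ℝ} (hb : 0 ≤ b) : 0 ≤ weight k p a b := by
  unfold weight; positivity

theorem weight_pos {p a b : ℝ} (hb : 0 < b) : 0 < weight k p a b := by
  unfold weight; positivity

theorem weight_smul {p a b t : ℝ} (ht : 0 < t) :
    weight k p (t * a) (t * b) = t ^ (p + (k - 1 : ℕ)) * weight k p a b := by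
  unfold weight
  have : (t * a) ^ 2 + (t * b) ^ 2 = t ^ 2 * (a ^ 2 + b ^ 2) := by ring
  rw [this, Real.sqrt_mul (by positivity), Real.sqrt_sq ht.le,
    Real.mul_rpow ht.le (Real.sqrt_nonneg _), mul_pow, Real.rpow_add ht, Real.rpow_natCast]
  ring

/-- Fubini splits off the axis, and polar coordinates in the orthogonal `ℝᵏ` produce the factor `b ^
(k - 1)` of `weight`. -/
theorem weightedVolume_preimage (hk : 1 ≤ k) (p : ℝ) {Q : Set (ℝ × ℝ)} (hQ : MeasurableSet Q) :
    weightedVolume p {x : EuclideanSpace ℝ (Fin (k + 1)) | (x 0, ‖tail x‖) ∈ Q} =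
      sphereMass k * ∫⁻ q in Q ∩ {q | 0 < q.2}, ENNReal.ofReal (weight k p q.1 q.2) := by
  set g : ℝ × ℝ → ℝ≥0∞ := Q.indicator fun q => ENNReal.ofReal (√(q.1 ^ 2 + q.2 ^ 2) ^ p) with hg
  have hgm : Measurable g := Measurable.indicator (by fun_prop) hQ
  have hred : Measurable fun x : EuclideanSpace ℝ (Fin (k + 1)) => (x 0, ‖tail x‖) := by
    have := (continuous_tail (k := k)).measurable
    fun_prop
  calc weightedVolume p {x : EuclideanSpace ℝ (Fin (k + 1)) | (x 0, ‖tail x‖) ∈ Q}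
      = ∫⁻ x : EuclideanSpace ℝ (Fin (k + 1)), g (x 0, ‖tail x‖) := by
        have hset : MeasurableSet {x : EuclideanSpace ℝ (Fin (k + 1)) | (x 0, ‖tail x‖) ∈ Q} :=
          hred hQ
        rw [weightedVolume, ← lintegral_indicator hset]
        refine lintegral_congr fun x => ?_
        simp only [hg, indicator, density, norm_eq_sqrt_tail x]
        rfl
    _ = ∫⁻ z : ℝ × EuclideanSpace ℝ (Fin k), g (z.1, ‖z.2‖) :=
        measurePreserving_join_symm.lintegral_comp (f := fun z => g (z.1, ‖z.2‖)) (by fun_prop)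
    _ = ∫⁻ a : ℝ, ∫⁻ y : EuclideanSpace ℝ (Fin k), g (a, ‖y‖) :=
        lintegral_prod _ (by fun_prop)
    _ = ∫⁻ a : ℝ, sphereMass k * ∫⁻ r in Ioi (0 : ℝ), ENNReal.ofReal (r ^ (k - 1)) * g (a, r) :=
        lintegral_congr fun a => lintegral_fun_norm hk (f := fun r => g (a, r)) (by fun_prop)
    _ = sphereMass k * ∫⁻ a : ℝ, ∫⁻ r in Ioi (0 : ℝ), ENNReal.ofReal (r ^ (k - 1)) * g (a, r) :=
        lintegral_const_mul' _ _ sphereMass_ne_top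
    _ = _ := by
        congr 1
        have : Q ∩ {q : ℝ × ℝ | 0 < q.2} = Q ∩ (univ ×ˢ Ioi (0 : ℝ)) := by
          ext q; simp
        rw [this, ← setLIntegral_indicator hQ, Measure.volume_eq_prod, ← setLIntegral_univ,
          ← setLIntegral_prod (s := univ) (t := Ioi (0 : ℝ))
            (fun q : ℝ × ℝ => ENNReal.ofReal (q.2 ^ (k - 1)) * g q) (by fun_prop)]
        refine setLIntegral_congr_fun (MeasurableSet.univ.prod measurableSet_Ioi) fun q hq => ?_
        have hq2 : 0 < q.2 := hq.2
        by_cases hqQ : q ∈ Q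
        · simp only [hg, indicator, hqQ, if_true, weight]
          rw [← ENNReal.ofReal_mul (by positivity), mul_comm]
        · simp [hg, indicator, hqQ]

end Rotation

/-! ### Weighted area of hypersurfaces of revolution -/

section Curves

variable {k : ℕ}

/-- The hypersurface obtained by rotating the curve `s ↦ (u s, v s)`, `s ∈ I`, about the axis. -/
def rotatedCurve (k : ℕ) (u v : ℝ → ℝ) (I : Set ℝ) : Set (EuclideanSpace ℝ (Fin (k + 1))) :=
  {x | ∃ s ∈ I, x 0 = u s ∧ ‖tail x‖ = v s}

/-- Parametrization of `rotatedCurve` by a punctured ball of `ℝᵏ`. -/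
def rotationMap (k : ℕ) (u v : ℝ → ℝ) (y : EuclideanSpace ℝ (Fin k)) :
    EuclideanSpace ℝ (Fin (k + 1)) :=
  join (u ‖y‖) ((v ‖y‖ / ‖y‖) • y)

theorem rotatedCurve_eq_image {u v : ℝ → ℝ} {b : ℝ} (hv : ∀ s ∈ Ioo 0 b, 0 < v s) :
    rotatedCurve k u v (Ioo 0 b) =
      rotationMap k u v '' {y : EuclideanSpace ℝ (Fin k) | ‖y‖ ∈ Ioo 0 b} := by
  ext x
  constructor
  · rintro ⟨s, hs, h0, h1⟩
    have hvs := hv s hs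
    have hn : ‖(s / v s) • tail x‖ = s := by
      rw [norm_smul, h1, Real.norm_of_nonneg (div_pos hs.1 hvs).le]
      field_simp
    refine ⟨(s / v s) • tail x, ?_, ?_⟩
    · rw [mem_ofPred_eq, hn]; exact hs
    · rw [rotationMap, hn, smul_smul]
      have : v s / s * (s / v s) = 1 := by
        have := hs.1.ne'
        have := hvs.ne'
        field_simp
      rw [this, one_smul, ← h0, join_tail]
  · rintro ⟨y, hy, rfl⟩
    refine ⟨‖y‖, hy, by simp [rotationMap], ?_⟩
    have hy0 : (0 : ℝ) < ‖y‖ := hy.1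
    rw [rotationMap, tail_join, norm_smul, Real.norm_of_nonneg (div_pos (hv _ hy) hy.1).le]
    field_simp

/-- The derivative of `rotationMap`. -/
def rotationDeriv (u' v' w ρ : ℝ) (y : EuclideanSpace ℝ (Fin k)) :
    EuclideanSpace ℝ (Fin k) →L[ℝ] EuclideanSpace ℝ (Fin (k + 1)) :=
  (LinearMap.toContinuousLinearMap joinL).comp
    (((u' / ρ) • innerSL ℝ y).prod
      ((w / ρ) • ContinuousLinearMap.id ℝ _ +
        (((v' - w / ρ) / ρ ^ 2) • innerSL ℝ y).smulRight y))

theorem continuous_join : Continuous fun q : ℝ × EuclideanSpace ℝ (Fin k) => join q.1 q.2 :=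
  (LinearMap.toContinuousLinearMap (joinL (k := k))).continuous

theorem hasStrictFDerivAt_norm {y : EuclideanSpace ℝ (Fin k)} (hy : y ≠ 0) :
    HasStrictFDerivAt (fun y : EuclideanSpace ℝ (Fin k) => ‖y‖) ((1 / ‖y‖) • innerSL ℝ y) y := by
  have hn : ‖y‖ ≠ 0 := norm_ne_zero_iff.2 hy
  have h := (hasStrictFDerivAt_norm_sq y).sqrt (pow_ne_zero 2 hn)
  simp only [Real.sqrt_sq (norm_nonneg _)] at h
  refine h.congr_fderiv ?_
  ext v
  simp
  field_simp

theorem hasStrictFDerivAt_rotationMap {u v : ℝ → ℝ} {u' v' : ℝ} {y : EuclideanSpace ℝ (Fin k)}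
    (hy : y ≠ 0) (hu : HasStrictDerivAt u u' ‖y‖) (hv : HasStrictDerivAt v v' ‖y‖) :
    HasStrictFDerivAt (rotationMap k u v) (rotationDeriv u' v' (v ‖y‖) ‖y‖ y) y := by
  have hn : ‖y‖ ≠ 0 := norm_ne_zero_iff.2 hy
  have hN := hasStrictFDerivAt_norm hy
  have h1 := hu.comp_hasStrictFDerivAt y hN
  have hq : HasStrictDerivAt (fun t => v t / t) ((v' * ‖y‖ - v ‖y‖ * 1) / ‖y‖ ^ 2) ‖y‖ :=
    hv.div (hasStrictDerivAt_id _) hn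
  have h2 := (hq.comp_hasStrictFDerivAt y hN).smul (hasStrictFDerivAt_id y)
  have h3 := ((LinearMap.toContinuousLinearMap (joinL (k := k))).hasStrictFDerivAt
    (x := (u ‖y‖, (v ‖y‖ / ‖y‖) • y))).comp y (h1.prodMk h2)
  refine h3.congr_fderiv ?_
  ext w i
  refine Fin.cases ?_ (fun i => ?_) i
  · simp [rotationDeriv, joinL, join]
    field_simp
  · simp [rotationDeriv, joinL, join]
    field_simp
    ring_nf
    simp

theorem inner_add_sq_aux (c e : ℝ) (y w : EuclideanSpace ℝ (Fin k)) :
    ‖c • w + (e * inner ℝ y w) • y‖ ^ 2 =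
      c ^ 2 * ‖w‖ ^ 2 + inner ℝ y w ^ 2 * (2 * c * e + e ^ 2 * ‖y‖ ^ 2) := by
  rw [norm_add_sq_real, norm_smul, norm_smul, inner_smul_left, inner_smul_right,
    real_inner_comm, mul_pow, mul_pow, Real.norm_eq_abs, Real.norm_eq_abs, sq_abs, sq_abs]
  simp
  ring

/-- A self-map of `ℝᵏ` with the same Gram matrix as `rotationDeriv`. -/
def rotationGram (q w ρ : ℝ) (y : EuclideanSpace ℝ (Fin k)) :
    EuclideanSpace ℝ (Fin k) →L[ℝ] EuclideanSpace ℝ (Fin k) :=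
  (w / ρ) • ContinuousLinearMap.id ℝ _ + (((q - w / ρ) / ρ ^ 2) • innerSL ℝ y).smulRight y

/-- The direction of `y` is stretched by the speed `√(u'² + v'²)` and the directions orthogonal to
it by `w / ‖y‖`. Only these factors matter for lengths, so a self-map of `ℝᵏ` with the same factors
can replace the derivative in the area formula. -/
theorem norm_rotationDeriv {u' v' w : ℝ} {y : EuclideanSpace ℝ (Fin k)} (hy : y ≠ 0)
    (z : EuclideanSpace ℝ (Fin k)) :
    ‖rotationDeriv u' v' w ‖y‖ y z‖ = ‖rotationGram √(u' ^ 2 + v' ^ 2) w ‖y‖ y z‖ := by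
  have hn : ‖y‖ ≠ 0 := norm_ne_zero_iff.2 hy
  rw [← sq_eq_sq₀ (norm_nonneg _) (norm_nonneg _)]
  have e1 : rotationDeriv u' v' w ‖y‖ y z = join (u' / ‖y‖ * inner ℝ y z)
      ((w / ‖y‖) • z + (((v' - w / ‖y‖) / ‖y‖ ^ 2) * inner ℝ y z) • y) := by
    simp [rotationDeriv, joinL]
  have e2 : rotationGram √(u' ^ 2 + v' ^ 2) w ‖y‖ y z =
      (w / ‖y‖) • z + (((√(u' ^ 2 + v' ^ 2) - w / ‖y‖) / ‖y‖ ^ 2) * inner ℝ y z) • y := by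
    simp [rotationGram]
  rw [e1, e2, norm_sq_join, inner_add_sq_aux, inner_add_sq_aux]
  have hs : √(u' ^ 2 + v' ^ 2) ^ 2 = u' ^ 2 + v' ^ 2 := Real.sq_sqrt (by positivity)
  set q := √(u' ^ 2 + v' ^ 2)
  field_simp
  linear_combination (-(inner ℝ y z) ^ 2 * ‖y‖ ^ 2) * hs

/-- After extracting the scalar `w / ‖y‖`, what remains is the identity plus a rank-one map, with
determinant one plus the value of its functional at `y`. -/
theorem det_rotationGram (hk : 1 ≤ k) {q w : ℝ} (hw : w ≠ 0) {y : EuclideanSpace ℝ (Fin k)}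
    (hy : y ≠ 0) :
    LinearMap.det (rotationGram q w ‖y‖ y : EuclideanSpace ℝ (Fin k) →ₗ[ℝ] _) =
      q * (w / ‖y‖) ^ (k - 1) := by
  have hn : ‖y‖ ≠ 0 := norm_ne_zero_iff.2 hy
  have e : (rotationGram q w ‖y‖ y : EuclideanSpace ℝ (Fin k) →ₗ[ℝ] EuclideanSpace ℝ (Fin k)) =
      (w / ‖y‖) • LinearMap.transvection
        (((q * ‖y‖ / w - 1) / ‖y‖ ^ 2) • (innerSL ℝ y : EuclideanSpace ℝ (Fin k) →ₗ[ℝ] ℝ)) y := by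
    ext z i
    simp [rotationGram, LinearMap.transvection.apply]
    field_simp
  rw [e, LinearMap.det_smul, LinearMap.transvection.det, finrank_euclideanSpace, Fintype.card_fin]
  obtain ⟨j, rfl⟩ : ∃ j, k = j + 1 := ⟨k - 1, by omega⟩
  simp only [Nat.add_sub_cancel, pow_succ (w / ‖y‖) j]
  simp
  field_simp
  ring

/-- Weighted perimeter of a hypersurface of revolution. -/
theorem lintegral_rotatedCurve (hk : 1 ≤ k) (p : ℝ) {u v u' v' : ℝ → ℝ} {b : ℝ}
    (hu : ∀ s ∈ Ioo 0 b, HasStrictDerivAt u (u' s) s)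
    (hv : ∀ s ∈ Ioo 0 b, HasStrictDerivAt v (v' s) s)
    (hu'c : ContinuousOn u' (Ioo 0 b)) (hv'c : ContinuousOn v' (Ioo 0 b))
    (hreg : ∀ s ∈ Ioo 0 b, 0 < u' s ^ 2 + v' s ^ 2) (hv0 : ∀ s ∈ Ioo 0 b, 0 < v s)
    (hinj : InjOn (fun s => (u s, v s)) (Ioo 0 b)) :
    MeasurableSet (rotatedCurve k u v (Ioo 0 b)) ∧
    ∫⁻ x in rotatedCurve k u v (Ioo 0 b), density p x ∂(μHE[k]) =
      sphereMass k * ∫⁻ s in Ioo 0 b,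
        ENNReal.ofReal (weight k p (u s) (v s) * √(u' s ^ 2 + v' s ^ 2)) := by
  set S : Set (EuclideanSpace ℝ (Fin k)) := {y | ‖y‖ ∈ Ioo 0 b} with hSdef
  have hSo : IsOpen S := isOpen_Ioo.preimage continuous_norm
  have hS0 : ∀ y ∈ S, y ≠ 0 := fun y hy => norm_pos_iff.1 hy.1
  have hvc : ContinuousOn v (Ioo 0 b) := fun s hs => (hv s hs).hasDerivAt.continuousAt.continuousWithinAt
  have hT : ∀ y ∈ S, HasStrictFDerivAt (rotationMap k u v)
      (rotationDeriv (u' ‖y‖) (v' ‖y‖) (v ‖y‖) ‖y‖ y) y := fun y hy =>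
    hasStrictFDerivAt_rotationMap (hS0 y hy) (hu _ hy) (hv _ hy)
  have hD : ∀ y ∈ S, ∀ z, ‖rotationDeriv (u' ‖y‖) (v' ‖y‖) (v ‖y‖) ‖y‖ y z‖ =
      ‖rotationGram √(u' ‖y‖ ^ 2 + v' ‖y‖ ^ 2) (v ‖y‖) ‖y‖ y z‖ := fun y hy z =>
    norm_rotationDeriv (hS0 y hy) z
  set j : ℝ → ℝ := fun s => √(u' s ^ 2 + v' s ^ 2) * (v s / s) ^ (k - 1) with hj
  have hj0 : ∀ s ∈ Ioo 0 b, 0 < j s := fun s hs =>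
    mul_pos (Real.sqrt_pos.2 (hreg s hs)) (pow_pos (div_pos (hv0 s hs) hs.1) _)
  have hjc : ContinuousOn j (Ioo 0 b) := by
    have : ContinuousOn (fun s => v s / s) (Ioo 0 b) :=
      hvc.div continuousOn_id fun s hs => hs.1.ne'
    exact ((hu'c.pow 2).add (hv'c.pow 2)).sqrt.mul (this.pow _)
  have hJ : ∀ y ∈ S, j ‖y‖ = |LinearMap.det
      (rotationGram √(u' ‖y‖ ^ 2 + v' ‖y‖ ^ 2) (v ‖y‖) ‖y‖ y :
        EuclideanSpace ℝ (Fin k) →ₗ[ℝ] _)| := by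
    intro y hy
    rw [det_rotationGram hk (hv0 _ hy).ne' (hS0 y hy)]
    exact (abs_of_pos (hj0 _ hy)).symm
  have hJc : ContinuousOn (fun y : EuclideanSpace ℝ (Fin k) => j ‖y‖) S :=
    hjc.comp continuous_norm.continuousOn fun y hy => hy
  have hinjT : InjOn (rotationMap k u v) S := by
    intro y hy z hz hyz
    have h0 : u ‖y‖ = u ‖z‖ := congrArg (fun x => x 0) hyz
    have h1 : (v ‖y‖ / ‖y‖) • y = (v ‖z‖ / ‖z‖) • z := congrArg tail hyz
    have hvy := hv0 _ hy
    have hvz := hv0 _ hz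
    have hny : (0 : ℝ) < ‖y‖ := hy.1
    have hnz : (0 : ℝ) < ‖z‖ := hz.1
    have h2 : v ‖y‖ = v ‖z‖ := by
      have := congrArg norm h1
      rw [norm_smul, norm_smul, Real.norm_of_nonneg (by positivity),
        Real.norm_of_nonneg (by positivity)] at this
      field_simp at this
      exact this
    have h3 : ‖y‖ = ‖z‖ := hinj hy hz (Prod.ext h0 h2)
    rw [h3] at h1
    exact smul_right_injective _ (div_pos hvz hnz).ne' h1
  have hTc : ContinuousOn (rotationMap k u v) S := fun y hy =>
    (hT y hy).continuousAt.continuousWithinAt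
  rw [rotatedCurve_eq_image hv0]
  refine ⟨hSo.measurableSet.image_of_continuousOn_injOn hTc hinjT, ?_⟩
  have hdm : Measurable (density p : EuclideanSpace ℝ (Fin (k + 1)) → ℝ≥0∞) := by
    unfold density; fun_prop
  rw [lintegral_image_euclideanHausdorffMeasure hSo hT hD hJ (fun y hy => hj0 _ hy) hJc hinjT hdm]
  have huc : ContinuousOn u (Ioo 0 b) := fun s hs => (hu s hs).hasDerivAt.continuousAt.continuousWithinAt
  set f : ℝ → ℝ≥0∞ := fun s => ENNReal.ofReal (j s * √(u s ^ 2 + v s ^ 2) ^ p) with hf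
  have hfm : Measurable ((Ioo 0 b).indicator f) := by
    refine measurable_of_restrict_of_restrict_compl (s := Ioo 0 b) measurableSet_Ioo ?_ ?_
    · have : (Ioo 0 b).domRestrict ((Ioo 0 b).indicator f) = (Ioo 0 b).domRestrict f := by
        ext s; simp
      rw [this]
      refine ENNReal.measurable_ofReal.comp (?_ : Measurable fun s : Ioo 0 b => _)
      have h1 := (continuousOn_iff_continuous_domRestrict.1 hjc).measurable
      have h2 := (continuousOn_iff_continuous_domRestrict.1 ((huc.pow 2).add (hvc.pow 2)).sqrt).measurable
      exact h1.mul (h2.pow_const p)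
    · have : (Ioo 0 b)ᶜ.domRestrict ((Ioo 0 b).indicator f) = fun _ => 0 := by
        ext s; exact indicator_of_notMem s.2 f
      rw [this]
      exact measurable_const
  calc ∫⁻ y in S, ENNReal.ofReal (j ‖y‖) * density p (rotationMap k u v y)
      = ∫⁻ y in S, f ‖y‖ := by
        refine setLIntegral_congr_fun hSo.measurableSet fun y hy => ?_
        have hny : (0 : ℝ) < ‖y‖ := hy.1
        have : ‖rotationMap k u v y‖ = √(u ‖y‖ ^ 2 + v ‖y‖ ^ 2) := by
          rw [← Real.sqrt_sq (norm_nonneg (rotationMap k u v y)), rotationMap, norm_sq_join,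
            norm_smul, Real.norm_of_nonneg (div_pos (hv0 _ hy) hny).le,
            div_mul_cancel₀ _ hny.ne']
        simp only [density, this, hf]
        rw [ENNReal.ofReal_mul (hj0 _ hy).le]
    _ = ∫⁻ y : EuclideanSpace ℝ (Fin k), (Ioo 0 b).indicator f ‖y‖ := by
        rw [← lintegral_indicator hSo.measurableSet]
        rfl
    _ = sphereMass k * ∫⁻ r in Ioi (0 : ℝ), ENNReal.ofReal (r ^ (k - 1)) * (Ioo 0 b).indicator f r :=
        lintegral_fun_norm hk hfm
    _ = _ := by
        congr 1
        have : ∀ r, ENNReal.ofReal (r ^ (k - 1)) * (Ioo 0 b).indicator f r =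
            (Ioo 0 b).indicator (fun r => ENNReal.ofReal (r ^ (k - 1)) * f r) r := by
          intro r; simp only [indicator]; split_ifs <;> simp
        simp only [this]
        rw [setLIntegral_indicator measurableSet_Ioo, inter_eq_left.2 Ioo_subset_Ioi_self]
        refine setLIntegral_congr_fun measurableSet_Ioo fun s hs => ?_
        have hs0 : 0 < s := hs.1
        simp only [hf]
        rw [← ENNReal.ofReal_mul (by positivity)]
        congr 1
        simp only [hj, weight, div_pow]
        field_simp

end Curves

/-! ### Weighted volume in cone coordinates along a curve -/

section Cones

variable {k : ℕ}

/-- Planar cone coordinates `(s, t) ↦ t (u s, v s)` along a curve. -/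
def coneMap (u v : ℝ → ℝ) (q : ℝ × ℝ) : ℝ × ℝ := (q.2 * u q.1, q.2 * v q.1)

/-- The derivative of `coneMap`. -/
def coneDeriv (u v u' v' t : ℝ) : ℝ × ℝ →L[ℝ] ℝ × ℝ :=
  LinearMap.toContinuousLinearMap (Matrix.toLin (Module.Basis.finTwoProd ℝ)
    (Module.Basis.finTwoProd ℝ) !![t * u', u; t * v', v])

theorem det_coneDeriv (u v u' v' t : ℝ) :
    (coneDeriv u v u' v' t).det = -(t * (u * v' - v * u')) := by
  conv_lhs => rw [coneDeriv, LinearMap.det_toContinuousLinearMap, LinearMap.det_toLin,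
    Matrix.det_fin_two_of]
  ring

theorem hasFDerivAt_coneMap {u v : ℝ → ℝ} {u' v' : ℝ} {q : ℝ × ℝ}
    (hu : HasDerivAt u u' q.1) (hv : HasDerivAt v v' q.1) :
    HasFDerivAt (coneMap u v) (coneDeriv (u q.1) (v q.1) u' v' q.2) q := by
  unfold coneDeriv
  rw [Matrix.toLin_finTwoProd_toContinuousLinearMap]
  have h1 : HasFDerivAt (fun q : ℝ × ℝ => q.1) (ContinuousLinearMap.fst ℝ ℝ ℝ) q := hasFDerivAt_fst
  have h2 : HasFDerivAt (fun q : ℝ × ℝ => q.2) (ContinuousLinearMap.snd ℝ ℝ ℝ) q := hasFDerivAt_snd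
  have a := h2.mul (hu.comp_hasFDerivAt q h1)
  have b := h2.mul (hv.comp_hasFDerivAt q h1)
  refine (a.prodMk b).congr_fderiv ?_
  ext <;> simp

theorem hasStrictFDerivAt_coneMap {u v : ℝ → ℝ} {u' v' : ℝ} {q : ℝ × ℝ}
    (hu : HasStrictDerivAt u u' q.1) (hv : HasStrictDerivAt v v' q.1) :
    HasStrictFDerivAt (coneMap u v) (coneDeriv (u q.1) (v q.1) u' v' q.2) q := by
  unfold coneDeriv
  rw [Matrix.toLin_finTwoProd_toContinuousLinearMap]
  have h1 : HasStrictFDerivAt (fun q : ℝ × ℝ => q.1) (ContinuousLinearMap.fst ℝ ℝ ℝ) q :=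
    hasStrictFDerivAt_fst
  have h2 : HasStrictFDerivAt (fun q : ℝ × ℝ => q.2) (ContinuousLinearMap.snd ℝ ℝ ℝ) q :=
    hasStrictFDerivAt_snd
  have a := h2.mul (hu.comp_hasStrictFDerivAt q h1)
  have b := h2.mul (hv.comp_hasStrictFDerivAt q h1)
  refine (a.prodMk b).congr_fderiv ?_
  ext <;> simp

theorem injOn_coneMap {u v : ℝ → ℝ} {b : ℝ} (hv0 : ∀ s ∈ Ioo 0 b, 0 < v s)
    (hinj : InjOn (fun s => u s / v s) (Ioo 0 b)) :
    InjOn (coneMap u v) (Ioo 0 b ×ˢ Ioi 0) := by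
  rintro ⟨s, t⟩ ⟨hs, ht⟩ ⟨s', t'⟩ ⟨hs', ht'⟩ h
  simp only [mem_Ioi] at hs ht hs' ht'
  simp only [coneMap, Prod.mk.injEq] at h
  have h1 := hv0 s hs
  have h2 := hv0 s' hs'
  have hq : u s / v s = u s' / v s' := by
    have e1 : u s / v s = (t * u s) / (t * v s) := by field_simp
    have e2 : u s' / v s' = (t' * u s') / (t' * v s') := by field_simp
    rw [e1, e2, h.1, h.2]
  have hss : s = s' := hinj hs hs' hq
  subst hss
  have : t = t' := mul_right_cancel₀ h1.ne' h.2
  rw [this]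

/-- The Jacobian `-t (u v' - v u')` does not vanish, so the strict derivative is onto and the map is
open at every point. -/
theorem isOpen_image_coneMap {u v u' v' : ℝ → ℝ} {b : ℝ}
    (hu : ∀ s ∈ Ioo 0 b, HasStrictDerivAt u (u' s) s)
    (hv : ∀ s ∈ Ioo 0 b, HasStrictDerivAt v (v' s) s)
    (hY : ∀ s ∈ Ioo 0 b, 0 < u s * v' s - v s * u' s)
    {Ω : Set (ℝ × ℝ)} (hΩ : IsOpen Ω) (hΩs : Ω ⊆ Ioo 0 b ×ˢ Ioi 0) :
    IsOpen (coneMap u v '' Ω) := by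
  rw [isOpen_iff_mem_nhds]
  rintro _ ⟨q, hq, rfl⟩
  obtain ⟨hq1, hq2⟩ := hΩs hq
  have hd := hasStrictFDerivAt_coneMap (q := q) (hu _ hq1) (hv _ hq1)
  have hdet : (coneDeriv (u q.1) (v q.1) (u' q.1) (v' q.1) q.2).det ≠ 0 := by
    rw [det_coneDeriv]
    exact neg_ne_zero.2 (mul_pos hq2 (hY _ hq1)).ne'
  have hmap := hd.map_nhds_eq_of_surj (LinearMap.range_eq_top.2
    (LinearMap.equivOfDetNeZero _ hdet).surjective)
  rw [← hmap]
  exact image_mem_map (hΩ.mem_nhds hq)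

/-- The body swept out by rotating the planar region `coneMap u v '' Ω` about the axis. -/
def coneBody (k : ℕ) (u v : ℝ → ℝ) (Ω : Set (ℝ × ℝ)) : Set (EuclideanSpace ℝ (Fin (k + 1))) :=
  {x | (x 0, ‖tail x‖) ∈ coneMap u v '' Ω}

theorem continuous_reduction :
    Continuous fun x : EuclideanSpace ℝ (Fin (k + 1)) => (x 0, ‖tail x‖) := by
  have := continuous_tail (k := k)
  fun_prop

/-- Weighted volume in cone coordinates. -/
theorem weightedVolume_coneBody (hk : 1 ≤ k) {p : ℝ} (hp : 0 < p) {u v u' v' : ℝ → ℝ} {b : ℝ}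
    (hu : ∀ s ∈ Ioo 0 b, HasDerivAt u (u' s) s)
    (hv : ∀ s ∈ Ioo 0 b, HasDerivAt v (v' s) s)
    (hv0 : ∀ s ∈ Ioo 0 b, 0 < v s)
    (hY : ∀ s ∈ Ioo 0 b, 0 < u s * v' s - v s * u' s)
    (hinj : InjOn (fun s => u s / v s) (Ioo 0 b))
    {Ω : Set (ℝ × ℝ)} (hΩ : MeasurableSet Ω) (hΩs : Ω ⊆ Ioo 0 b ×ˢ Ioi 0) :
    weightedVolume p (coneBody k u v Ω) = sphereMass k * ∫⁻ q in Ω, ENNReal.ofReal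
      (weight k p (u q.1) (v q.1) * (u q.1 * v' q.1 - v q.1 * u' q.1) * q.2 ^ (p + k)) := by
  have hder : ∀ q ∈ Ω, HasFDerivWithinAt (coneMap u v)
      (coneDeriv (u q.1) (v q.1) (u' q.1) (v' q.1) q.2) Ω q := fun q hq =>
    (hasFDerivAt_coneMap (hu _ (hΩs hq).1) (hv _ (hΩs hq).1)).hasFDerivWithinAt
  have hinj' := (injOn_coneMap hv0 hinj).mono hΩs
  have hQ : MeasurableSet (coneMap u v '' Ω) :=
    hΩ.image_of_continuousOn_injOn (fun q hq => (hder q hq).continuousWithinAt) hinj'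
  have hpos : coneMap u v '' Ω ∩ {q | 0 < q.2} = coneMap u v '' Ω := by
    rw [inter_eq_left]
    rintro _ ⟨q, hq, rfl⟩
    exact mul_pos (hΩs hq).2 (hv0 _ (hΩs hq).1)
  rw [coneBody, weightedVolume_preimage hk p hQ, hpos,
    lintegral_image_eq_lintegral_abs_det_fderiv_mul volume hΩ hder hinj']
  congr 1
  refine setLIntegral_congr_fun hΩ fun q hq => ?_
  have hq2 : 0 < q.2 := (hΩs hq).2
  have hYq := hY _ (hΩs hq).1
  simp only [det_coneDeriv, abs_neg, coneMap]
  rw [abs_of_pos (by positivity), ← ENNReal.ofReal_mul (by positivity), weight_smul hq2]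
  congr 1
  -- One factor `t` comes from the Jacobian; the others come from the homogeneity of `weight`.
  have : q.2 ^ (p + k) = q.2 * q.2 ^ (p + (k - 1 : ℕ)) := by
    rw [← Real.rpow_one_add' hq2.le (by positivity)]
    congr 1
    rw [Nat.cast_sub hk]
    push_cast
    ring
  rw [this]
  ring

/-- This is the integral of `t ^ (p + k)` over `(l, κ s)` for each `s`. It serves collars of the
curve with `l = 1 - τ` and whole starshaped bodies with `l = 0`. -/
theorem weightedVolume_coneBody_between (hk : 1 ≤ k) {p : ℝ} (hp : 0 < p) {u v u' v' : ℝ → ℝ}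
    {b : ℝ} (hu : ∀ s ∈ Ioo 0 b, HasDerivAt u (u' s) s)
    (hv : ∀ s ∈ Ioo 0 b, HasDerivAt v (v' s) s)
    (hu'c : ContinuousOn u' (Ioo 0 b)) (hv'c : ContinuousOn v' (Ioo 0 b))
    (hv0 : ∀ s ∈ Ioo 0 b, 0 < v s)
    (hY : ∀ s ∈ Ioo 0 b, 0 < u s * v' s - v s * u' s)
    (hinj : InjOn (fun s => u s / v s) (Ioo 0 b)) {l : ℝ} (hl : 0 ≤ l) {κ : ℝ → ℝ}
    (hκ : Continuous κ) (hlκ : ∀ s ∈ Ioo 0 b, l ≤ κ s) :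
    weightedVolume p (coneBody k u v {q | q.1 ∈ Ioo 0 b ∧ l < q.2 ∧ q.2 < κ q.1}) =
      sphereMass k * ∫⁻ s in Ioo 0 b, ENNReal.ofReal
        (weight k p (u s) (v s) * (u s * v' s - v s * u' s) *
          ((κ s ^ (p + k + 1) - l ^ (p + k + 1)) / (p + k + 1))) := by
  set Ω : Set (ℝ × ℝ) := {q | q.1 ∈ Ioo 0 b ∧ l < q.2 ∧ q.2 < κ q.1} with hΩdef
  have hΩ : MeasurableSet Ω := by
    have h1 : MeasurableSet {q : ℝ × ℝ | q.1 ∈ Ioo 0 b} := measurable_fst measurableSet_Ioo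
    have h2 : MeasurableSet {q : ℝ × ℝ | l < q.2} := measurableSet_lt measurable_const measurable_snd
    have h3 : MeasurableSet {q : ℝ × ℝ | q.2 < κ q.1} :=
      measurableSet_lt measurable_snd (hκ.measurable.comp measurable_fst)
    exact h1.inter (h2.inter h3)
  rw [weightedVolume_coneBody hk hp hu hv hv0 hY hinj hΩ
    (fun q hq => ⟨hq.1, lt_of_le_of_lt hl hq.2.1⟩)]
  congr 1
  set c : ℝ → ℝ := fun s => weight k p (u s) (v s) * (u s * v' s - v s * u' s) with hc
  have huc : ContinuousOn u (Ioo 0 b) := fun s hs => (hu s hs).continuousAt.continuousWithinAt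
  have hvc : ContinuousOn v (Ioo 0 b) := fun s hs => (hv s hs).continuousAt.continuousWithinAt
  have hcc : ContinuousOn c (Ioo 0 b) := by
    refine ContinuousOn.mul (ContinuousOn.mul (ContinuousOn.rpow_const
      ((huc.pow 2).add (hvc.pow 2)).sqrt fun s hs => Or.inr hp.le) (hvc.pow _))
      ((huc.mul hv'c).sub (hvc.mul hu'c))
  have hc0 : ∀ s ∈ Ioo 0 b, 0 ≤ c s := fun s hs =>
    (mul_pos (weight_pos (hv0 s hs)) (hY s hs)).le
  set f : ℝ × ℝ → ℝ≥0∞ := fun q => ENNReal.ofReal (c q.1 * q.2 ^ (p + k)) with hf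
  have hfm : AEMeasurable (Ω.indicator f) ((volume.prod volume).restrict (Ioo 0 b ×ˢ univ)) := by
    refine AEMeasurable.indicator ?_ hΩ
    refine ENNReal.measurable_ofReal.comp_aemeasurable ?_
    refine ContinuousOn.aemeasurable ?_ (measurableSet_Ioo.prod MeasurableSet.univ)
    exact (hcc.comp continuous_fst.continuousOn fun q hq => hq.1).mul
      (continuous_snd.rpow_const fun _ => Or.inr (by positivity)).continuousOn
  have hΩI : Ω = Ω ∩ (Ioo 0 b ×ˢ univ) := by
    rw [eq_comm, inter_eq_left]
    intro q hq
    exact ⟨hq.1, mem_univ _⟩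
  change ∫⁻ q in Ω, f q = _
  rw [hΩI, ← setLIntegral_indicator hΩ, Measure.volume_eq_prod, setLIntegral_prod _ hfm]
  refine setLIntegral_congr_fun measurableSet_Ioo fun s hs => ?_
  have hin : ∀ t, Ω.indicator f (s, t) =
      (Ioo l (κ s)).indicator (fun t => ENNReal.ofReal (c s * t ^ (p + k))) t := by
    intro t
    by_cases ht : t ∈ Ioo l (κ s)
    · rw [indicator_of_mem ht, indicator_of_mem (show (s, t) ∈ Ω from ⟨hs, ht⟩)]
    · rw [indicator_of_notMem ht, indicator_of_notMem fun h : (s, t) ∈ Ω => ht h.2]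
  simp only [hin, Measure.restrict_univ]
  rw [lintegral_indicator measurableSet_Ioo, restrict_Ioo_eq_restrict_Ioc]
  have hint : IntegrableOn (fun t => c s * t ^ (p + k)) (Ioc l (κ s)) := by
    rw [← intervalIntegrable_iff_integrableOn_Ioc_of_le (hlκ s hs)]
    exact (intervalIntegral.intervalIntegrable_rpow' (by
      have : (0 : ℝ) ≤ k := k.cast_nonneg
      linarith)).const_mul _
  rw [← ofReal_integral_eq_lintegral_ofReal hint, ← intervalIntegral.integral_of_le (hlκ s hs),
    intervalIntegral.integral_const_mul, integral_rpow]
  · left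
    have : (0 : ℝ) ≤ k := k.cast_nonneg
    linarith
  · filter_upwards [ae_restrict_mem measurableSet_Ioc] with t ht
    exact mul_nonneg (hc0 s hs) (Real.rpow_nonneg (hl.trans ht.1.le) _)

end Cones

/-! ### Spherical symmetry and the planar cross-section -/

section Symmetry

variable {k : ℕ}

theorem norm_sq_plane (q : EuclideanSpace ℝ (Fin 2)) : ‖q‖ ^ 2 = q 0 ^ 2 + q 1 ^ 2 := by
  simp [EuclideanSpace.norm_sq_eq]

/-- The embedding of the plane used by `crossSection`. -/
def planePoint (k : ℕ) (q : EuclideanSpace ℝ (Fin 2)) : EuclideanSpace ℝ (Fin (k + 2)) :=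
  EuclideanSpace.single (0 : Fin (k + 2)) (q 0) + EuclideanSpace.single (1 : Fin (k + 2)) (q 1)

theorem continuous_planePoint : Continuous (planePoint k) := by
  have : planePoint k = fun q => (q 0) • EuclideanSpace.single (0 : Fin (k + 2)) (1 : ℝ) +
      (q 1) • EuclideanSpace.single (1 : Fin (k + 2)) (1 : ℝ) := by
    funext q; ext i; simp [planePoint]
  rw [this]
  fun_prop

@[simp] theorem planePoint_zero (q : EuclideanSpace ℝ (Fin 2)) : planePoint k q 0 = q 0 := by
  simp [planePoint]

theorem norm_planePoint (q : EuclideanSpace ℝ (Fin 2)) : ‖planePoint k q‖ = ‖q‖ := by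
  rw [← sq_eq_sq₀ (norm_nonneg _) (norm_nonneg _), norm_sq_plane]
  have h1 : ∀ i : Fin k, i.succ.succ ≠ (1 : Fin (k + 2)) := fun i h =>
    Fin.succ_ne_zero i (Fin.succ_injective _ h)
  simp [planePoint, EuclideanSpace.norm_sq_eq, Fin.sum_univ_succ, h1]

variable {E : Set (EuclideanSpace ℝ (Fin (k + 2)))}

/-- This monotonicity is the form in which spherical symmetry enters all later arguments; open and
closed caps give the same result, and the sphere of radius zero is a single point. -/
theorem mem_of_norm_eq_of_le (hE : IsSphericallySymmetric E)
    {x y : EuclideanSpace ℝ (Fin (k + 2))} (hx : x ∈ E) (hn : ‖x‖ = ‖y‖) (h0 : x 0 ≤ y 0) :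
    y ∈ E := by
  rcases (norm_nonneg x).eq_or_lt with h | h
  · have e1 : x = 0 := norm_eq_zero.1 h.symm
    have e2 : y = 0 := norm_eq_zero.1 (hn ▸ h.symm)
    rw [e2, ← e1]; exact hx
  · obtain ⟨t, ht | ht⟩ := hE ‖x‖ h
    · have h1 : x ∈ E ∩ Metric.sphere 0 ‖x‖ := ⟨hx, by simp⟩
      rw [ht] at h1
      have h2 : y ∈ {z | z ∈ Metric.sphere (0 : EuclideanSpace ℝ (Fin (k + 2))) ‖x‖ ∧ t < z 0} :=
        ⟨by simp [hn], lt_of_lt_of_le h1.2 h0⟩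
      rw [← ht] at h2
      exact h2.1
    · have h1 : x ∈ E ∩ Metric.sphere 0 ‖x‖ := ⟨hx, by simp⟩
      rw [ht] at h1
      have h2 : y ∈ {z | z ∈ Metric.sphere (0 : EuclideanSpace ℝ (Fin (k + 2))) ‖x‖ ∧ t ≤ z 0} :=
        ⟨by simp [hn], le_trans h1.2 h0⟩
      rw [← ht] at h2
      exact h2.1

theorem mem_crossSection_iff (q : EuclideanSpace ℝ (Fin 2)) :
    q ∈ crossSection E ↔ planePoint k q ∈ E := Iff.rfl

theorem mem_iff_mem_crossSection (hE : IsSphericallySymmetric E)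
    {x : EuclideanSpace ℝ (Fin (k + 2))} {q : EuclideanSpace ℝ (Fin 2)} (hn : ‖x‖ = ‖q‖)
    (h0 : x 0 = q 0) : x ∈ E ↔ q ∈ crossSection E := by
  rw [mem_crossSection_iff]
  constructor
  · exact fun h => mem_of_norm_eq_of_le hE h (by rw [norm_planePoint, hn]) (by simp [h0])
  · exact fun h => mem_of_norm_eq_of_le hE h (by rw [norm_planePoint, hn]) (by simp [h0])

theorem mem_crossSection_of_le (hE : IsSphericallySymmetric E) {q q' : EuclideanSpace ℝ (Fin 2)}
    (hq : q ∈ crossSection E) (hn : ‖q‖ = ‖q'‖) (h0 : q 0 ≤ q' 0) : q' ∈ crossSection E :=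
  mem_of_norm_eq_of_le hE (x := planePoint k q) (y := planePoint k q') hq
    (by rw [norm_planePoint, norm_planePoint, hn]) (by simpa using h0)

theorem isOpen_crossSection (hE : IsOpen E) : IsOpen (crossSection E) :=
  hE.preimage continuous_planePoint

theorem notMem_of_mem_frontier {X : Type*} [TopologicalSpace X] {A : Set X} (hA : IsOpen A) {q : X}
    (hq : q ∈ frontier A) : q ∉ A := by
  rw [hA.frontier_eq] at hq
  exact hq.2

theorem subset_of_disjoint_frontier {X : Type*} [TopologicalSpace X] {A H : Set X} (hA : IsOpen A)
    (hH : IsPreconnected H) (hd : Disjoint H (frontier A)) (hne : (H ∩ A).Nonempty) : H ⊆ A := by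
  refine hH.subset_left_of_subset_union hA isClosed_closure.isOpen_compl
    (disjoint_compl_right_iff_subset.2 subset_closure) (fun x hx => ?_) hne
  by_cases hxA : x ∈ A
  · exact Or.inl hxA
  · refine Or.inr fun hc => disjoint_left.1 hd hx ?_
    rw [hA.frontier_eq]
    exact ⟨hc, hxA⟩

/-- Two boundary points at the same distance from the origin span a circular arc of boundary
points. -/
theorem mem_frontier_crossSection_of_between (hEo : IsOpen E) (hE : IsSphericallySymmetric E)
    {q₁ q₂ q : EuclideanSpace ℝ (Fin 2)} (h₁ : q₁ ∈ frontier (crossSection E))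
    (h₂ : q₂ ∈ frontier (crossSection E)) (hn₁ : ‖q‖ = ‖q₁‖) (hn₂ : ‖q‖ = ‖q₂‖) (hq : q ≠ 0)
    (hlt : q₂ 0 < q 0) (hle : q 0 ≤ q₁ 0) : q ∈ frontier (crossSection E) := by
  have hA := isOpen_crossSection hEo
  rw [hA.frontier_eq]
  refine ⟨?_, fun h => notMem_of_mem_frontier hA h₁ (mem_crossSection_of_le hE h hn₁ hle)⟩
  have hq0 : ‖q‖ ≠ 0 := norm_ne_zero_iff.2 hq
  -- `φ z` is the point on the ray of `q` at the distance of `z`. For `z` near `q₂` it has the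
  -- larger abscissa, so points of the set near `q₂` yield points of the set near `q`.
  set φ : EuclideanSpace ℝ (Fin 2) → EuclideanSpace ℝ (Fin 2) := fun z => (‖z‖ / ‖q‖) • q with hφ
  have hφc : Continuous φ := by fun_prop
  have hφ2 : φ q₂ = q := by simp [hφ, ← hn₂, div_self hq0]
  have hφ0 : Continuous fun z => φ z 0 := by fun_prop
  have hev : ∀ᶠ z in 𝓝 q₂, z 0 < φ z 0 := by
    have hc : Continuous fun z : EuclideanSpace ℝ (Fin 2) => z 0 := by fun_prop
    exact hc.continuousAt.eventually_lt hφ0.continuousAt (by rw [hφ2]; exact hlt)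
  have hfr : ∃ᶠ z in 𝓝 q₂, z ∈ crossSection E :=
    mem_closure_iff_frequently.1 (frontier_subset_closure h₂)
  have hfr2 : ∃ᶠ z in 𝓝 q₂, φ z ∈ crossSection E := by
    refine (hfr.and_eventually hev).mono ?_
    rintro z ⟨hz, hz0⟩
    refine mem_crossSection_of_le hE hz ?_ hz0.le
    rw [hφ, norm_smul, Real.norm_of_nonneg (by positivity), div_mul_cancel₀ _ hq0]
  have ht : Tendsto φ (𝓝 q₂) (𝓝 q) := by
    have := hφc.tendsto q₂
    rwa [hφ2] at this
  exact mem_closure_iff_frequently.2 (ht.frequently hfr2)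

theorem volume_halfSpace_eq_top :
    volume {x : EuclideanSpace ℝ (Fin (k + 2)) | 1 < x 0} = ⊤ := by
  have h := (measurePreserving_join_symm (k := k + 1)).measure_preimage
    (s := Ioi 1 ×ˢ univ) (measurableSet_Ioi.prod MeasurableSet.univ).nullMeasurableSet
  have e : (fun x : EuclideanSpace ℝ (Fin (k + 2)) => (x 0, tail x)) ⁻¹' (Ioi 1 ×ˢ univ) =
      {x | 1 < x 0} := by
    ext x; simp
  rw [e] at h
  rw [h, Measure.volume_eq_prod, Measure.prod_prod, Real.volume_Ioi,
    ENNReal.top_mul]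
  exact (isOpen_univ.measure_pos _ univ_nonempty).ne'

/-- A point farther than `1` from the origin can be rotated onto the positive axis, into the
half-plane of abscissas greater than `1`. No boundary point lies there, so the half-plane lies in
the cross-section and the corresponding half-space in `E`. Its weighted volume is infinite. -/
theorem norm_le_one_of_mem_crossSection {p : ℝ} (hp : 0 < p) (hEo : IsOpen E)
    (hE : IsSphericallySymmetric E) (hvol : weightedVolume p E ≠ ⊤)
    (hr : ∀ q ∈ frontier (crossSection E), q 0 ≤ 1) {q : EuclideanSpace ℝ (Fin 2)}
    (hq : q ∈ crossSection E) : ‖q‖ ≤ 1 := by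
  by_contra! hlt
  set H : Set (EuclideanSpace ℝ (Fin 2)) := {z | 1 < z 0} with hH
  have hHc : IsPreconnected H := by
    have : Convex ℝ H := by
      intro x hx y hy a b ha hb hab
      simp only [hH, mem_ofPred_eq, PiLp.add_apply, PiLp.smul_apply, smul_eq_mul] at hx hy ⊢
      rcases ha.eq_or_lt with rfl | ha
      · rw [zero_add] at hab; subst hab; simpa using hy
      · nlinarith
    exact this.isPreconnected
  have hq' : (!₂[‖q‖, 0] : EuclideanSpace ℝ (Fin 2)) ∈ crossSection E := by
    refine mem_crossSection_of_le hE hq ?_ ?_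
    · rw [← sq_eq_sq₀ (norm_nonneg _) (norm_nonneg _), norm_sq_plane !₂[‖q‖, 0]]
      simp
    · have := norm_sq_plane q
      change q 0 ≤ ‖q‖
      exact le_of_sq_le_sq (by nlinarith [sq_nonneg (q 1)]) (norm_nonneg _)
  have hHA : H ⊆ crossSection E := by
    refine subset_of_disjoint_frontier (isOpen_crossSection hEo) hHc ?_
      ⟨_, (show (1 : ℝ) < ‖q‖ from hlt), hq'⟩
    exact disjoint_left.2 fun w hwH hwf => absurd (hr w hwf) (not_le.2 hwH)
  apply hvol
  rw [eq_top_iff, ← volume_halfSpace_eq_top (k := k), ← setLIntegral_one]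
  have hm : MeasurableSet {x : EuclideanSpace ℝ (Fin (k + 2)) | 1 < x 0} :=
    measurableSet_lt measurable_const (by fun_prop)
  calc ∫⁻ _ in {x : EuclideanSpace ℝ (Fin (k + 2)) | 1 < x 0}, 1
      ≤ ∫⁻ x in {x : EuclideanSpace ℝ (Fin (k + 2)) | 1 < x 0}, density p x := by
        refine setLIntegral_mono' hm fun x hx => ?_
        have : 1 ≤ ‖x‖ := by
          have h1 : 1 < x 0 := hx
          nlinarith [norm_sq_eq_tail x, sq_nonneg ‖tail x‖, norm_nonneg x]
        rw [density, ← ENNReal.ofReal_one]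
        exact ENNReal.ofReal_le_ofReal (Real.one_le_rpow this hp.le)
    _ ≤ weightedVolume p E := by
        refine lintegral_mono_set fun x hx => ?_
        refine (mem_iff_mem_crossSection hE (q := !₂[x 0, ‖tail x‖]) ?_ rfl).2 (hHA hx)
        rw [← sq_eq_sq₀ (norm_nonneg _) (norm_nonneg _), norm_sq_plane, norm_sq_eq_tail]
        simp

/-- The map `φ` below carries the plane isometrically onto the plane through the axis and `x`, which
transports approximating points of the cross-section to points of `E`. -/
theorem mem_frontier_of_mem_frontier_crossSection (hEo : IsOpen E) (hE : IsSphericallySymmetric E)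
    {q : EuclideanSpace ℝ (Fin 2)} (hq : q ∈ frontier (crossSection E)) (hq1 : 0 < q 1)
    {x : EuclideanSpace ℝ (Fin (k + 2))} (h0 : x 0 = q 0) (h1 : ‖tail x‖ = q 1) :
    x ∈ frontier E := by
  have hn : ‖x‖ = ‖q‖ := by
    rw [← sq_eq_sq₀ (norm_nonneg _) (norm_nonneg _), norm_sq_plane, norm_sq_eq_tail, h0, h1]
  rw [hEo.frontier_eq]
  refine ⟨?_, fun h => notMem_of_mem_frontier (isOpen_crossSection hEo) hq
    ((mem_iff_mem_crossSection hE hn h0).1 h)⟩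
  set φ : EuclideanSpace ℝ (Fin 2) → EuclideanSpace ℝ (Fin (k + 2)) :=
    fun z => join (z 0) ((z 1 / q 1) • tail x) with hφ
  have hφc : Continuous φ := by
    have h1 : Continuous fun z : EuclideanSpace ℝ (Fin 2) => (z 0, (z 1 / q 1) • tail x) := by
      fun_prop
    exact continuous_join.comp h1
  have hφq : φ q = x := by
    simp only [hφ, div_self hq1.ne', one_smul, ← h0]
    exact join_tail x
  rw [← hφq]
  refine closure_mono ?_ (image_closure_subset_closure_image hφc
    (mem_image_of_mem φ (frontier_subset_closure hq)))
  rintro _ ⟨z, hz, rfl⟩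
  refine (mem_iff_mem_crossSection hE (q := z) ?_ rfl).2 hz
  rw [← sq_eq_sq₀ (norm_nonneg _) (norm_nonneg _), norm_sq_plane]
  change ‖join (z 0) ((z 1 / q 1) • tail x)‖ ^ 2 = _
  rw [norm_sq_join, norm_smul, h1, Real.norm_eq_abs, mul_pow, sq_abs]
  field_simp

end Symmetry

/-! ### Local structure of the planar set along its generating curve -/

section GeneratingCurve

variable {A : Set (EuclideanSpace ℝ (Fin 2))} {β : ℝ} {γ : ℝ → EuclideanSpace ℝ (Fin 2)}

theorem plane_ext {q q' : EuclideanSpace ℝ (Fin 2)} (h0 : q 0 = q' 0) (h1 : q 1 = q' 1) :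
    q = q' := by
  ext i
  fin_cases i
  · exact h0
  · exact h1

namespace IsGeneratingCurve

theorem eq_of_apply_eq (hγ : IsGeneratingCurve A β γ) {σ s : ℝ} (hσ : σ ∈ Icc (-β) β)
    (hs : s ∈ Ioo (-β) β) (h : γ σ = γ s) : σ = s := by
  rcases hσ.2.eq_or_lt with rfl | hlt
  · rw [← hγ.closed] at h
    have := hγ.injOn ⟨le_rfl, by linarith [hγ.pos]⟩ ⟨hs.1.le, hs.2⟩ h
    linarith [hs.1]
  · exact hγ.injOn ⟨hσ.1, hlt⟩ ⟨hs.1.le, hs.2⟩ h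

theorem continuousAt (hγ : IsGeneratingCurve A β γ) {s : ℝ} (hs : s ∈ Ioo (-β) β) :
    ContinuousAt γ s :=
  hγ.continuousOn.continuousAt (Icc_mem_nhds hs.1 hs.2)

/-- Near an interior point of the curve, boundary points lie on a short arc of the curve. -/
theorem eventually_mem_image (hγ : IsGeneratingCurve A β γ) {s : ℝ} (hs : s ∈ Ioo (-β) β)
    {N : Set ℝ} (hN : N ∈ 𝓝 s) :
    ∀ᶠ q in 𝓝 (γ s), q ∈ frontier A → ∃ σ ∈ N, σ ∈ Icc (-β) β ∧ γ σ = q := by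
  obtain ⟨U, hU, hsU, hUf⟩ := hγ.follows_boundary s hs
  have hC : IsCompact (Icc (-β) β \ interior N) := isCompact_Icc.diff isOpen_interior
  have hCc : IsCompact (γ '' (Icc (-β) β \ interior N)) :=
    hC.image_of_continuousOn (hγ.continuousOn.mono sdiff_subset)
  have hnot : γ s ∉ γ '' (Icc (-β) β \ interior N) := by
    rintro ⟨σ, hσ, hσs⟩
    have := hγ.eq_of_apply_eq hσ.1 hs hσs
    exact hσ.2 (this ▸ mem_interior_iff_mem_nhds.2 hN)
  filter_upwards [hU.mem_nhds hsU, hCc.isClosed.isOpen_compl.mem_nhds hnot] with q hqU hqC hqf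
  obtain ⟨σ, hσ, rfl⟩ := hUf ⟨hqf, hqU⟩
  refine ⟨σ, ?_, hσ, rfl⟩
  by_contra hσN
  exact hqC ⟨σ, ⟨hσ, fun h => hσN (interior_subset h)⟩, rfl⟩

theorem contDiffOn_coord (hγ : IsGeneratingCurve A β γ) (i : Fin 2) :
    ContDiffOn ℝ ∞ (fun s => γ s i) (Ioo (-β) β) := by
  have h := hγ.smooth
  rw [contDiffOn_piLp] at h
  exact h i

theorem differentiableAt (hγ : IsGeneratingCurve A β γ) {s : ℝ} (hs : s ∈ Ioo (-β) β) :
    DifferentiableAt ℝ γ s :=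
  (hγ.smooth.differentiableOn (by simp)).differentiableAt (isOpen_Ioo.mem_nhds hs)

theorem deriv_apply (hγ : IsGeneratingCurve A β γ) {s : ℝ} (hs : s ∈ Ioo (-β) β) (i : Fin 2) :
    deriv γ s i = deriv (fun s => γ s i) s := by
  have h := (hγ.differentiableAt hs).hasDerivAt
  have h2 : HasDerivAt (fun s => γ s i) (deriv γ s i) s :=
    (EuclideanSpace.proj (𝕜 := ℝ) i).hasFDerivAt.comp_hasDerivAt s h
  exact h2.deriv.symm

theorem hasDerivAt_coord (hγ : IsGeneratingCurve A β γ) {s : ℝ} (hs : s ∈ Ioo (-β) β) (i : Fin 2) :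
    HasDerivAt (fun s => γ s i) (deriv (fun s => γ s i) s) s := by
  rw [← hγ.deriv_apply hs]
  exact (EuclideanSpace.proj (𝕜 := ℝ) i).hasFDerivAt.comp_hasDerivAt s
    (hγ.differentiableAt hs).hasDerivAt

theorem unit_speed_sq (hγ : IsGeneratingCurve A β γ) {s : ℝ} (hs : s ∈ Ioo (-β) β) :
    deriv (fun s => γ s 0) s ^ 2 + deriv (fun s => γ s 1) s ^ 2 = 1 := by
  rw [← hγ.deriv_apply hs, ← hγ.deriv_apply hs, ← norm_sq_plane, hγ.unit_speed s hs, one_pow]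

theorem apply_zero_zero (hγ : IsGeneratingCurve A β γ) : γ 0 0 = 1 := by rw [hγ.start]; rfl

theorem apply_zero_one (hγ : IsGeneratingCurve A β γ) : γ 0 1 = 0 := by rw [hγ.start]; rfl

theorem nonpos_of_nonpos (hγ : IsGeneratingCurve A β γ) {s : ℝ} (hs : s ∈ Icc (-β) β)
    (hs0 : s ≤ 0) : γ s 1 ≤ 0 := by
  rcases hs.1.eq_or_lt with rfl | h
  · rw [hγ.closed, hγ.end_on_axis]
  · rcases hs0.eq_or_lt with rfl | h0
    · exact hγ.apply_zero_one.le
    · exact (hγ.below s ⟨h, h0⟩).le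

theorem zero_mem (hγ : IsGeneratingCurve A β γ) : (0 : ℝ) ∈ Ioo (-β) β :=
  ⟨by linarith [hγ.pos], hγ.pos⟩

theorem deriv_zero (hγ : IsGeneratingCurve A β γ) :
    deriv (fun s => γ s 0) 0 = 0 ∧ deriv (fun s => γ s 1) 0 = 1 := by
  have h0 : deriv (fun s => γ s 0) 0 = 0 := by
    refine IsLocalMax.deriv_eq_zero ?_
    filter_upwards [Icc_mem_nhds hγ.zero_mem.1 hγ.zero_mem.2] with s hs
    rw [hγ.apply_zero_zero]
    exact hγ.rightmost _ (hγ.mem_boundary s hs)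
  refine ⟨h0, ?_⟩
  have hu := hγ.unit_speed_sq hγ.zero_mem
  rw [h0] at hu
  have hnn : 0 ≤ deriv (fun s => γ s 1) 0 := by
    have hd := (hγ.hasDerivAt_coord hγ.zero_mem 1).hasDerivWithinAt (s := Ioi 0)
    rw [hasDerivWithinAt_iff_tendsto_slope' (by simp)] at hd
    refine ge_of_tendsto hd ?_
    filter_upwards [Ioo_mem_nhdsGT hγ.pos] with s hs
    rw [slope_def_field, hγ.apply_zero_one, sub_zero, sub_zero]
    exact (div_pos (hγ.above s hs) hs.1).le
  nlinarith

/-- A boundary point near `γ y` lies on the curve at a nearby parameter, and the ratio of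
coordinates, which scaling preserves, identifies this parameter. The margin `b < b'` keeps it where
the ratio is injective. Compactness of `[0, b]` makes the range of `t` uniform down to `s = 0`. -/
theorem eventually_smul_mem_frontier (hγ : IsGeneratingCurve A β γ) {b b' : ℝ} (hbb : b < b')
    (hb' : b' ≤ β)
    (hinj : InjOn (fun s => γ s 0 / γ s 1) (Ioo 0 b')) :
    ∀ᶠ t in 𝓝 (1 : ℝ), ∀ s ∈ Icc 0 b, s ∈ Ioo 0 b → t • γ s ∈ frontier A → t = 1 := by
  refine IsCompact.eventually_forall_of_forall_eventually isCompact_Icc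
    (P := fun t s => s ∈ Ioo 0 b → t • γ s ∈ frontier A → t = 1) fun y hy => ?_
  have hyβ : y ∈ Ioo (-β) β := ⟨by linarith [hγ.pos, hy.1], by linarith [hy.2]⟩
  have ht : Tendsto (fun z : ℝ × ℝ => z.1 • γ z.2) (𝓝 (1, y)) (𝓝 (γ y)) := by
    have h1 : ContinuousAt (fun z : ℝ × ℝ => z.1 • γ z.2) (1, y) :=
      continuousAt_fst.smul ((hγ.continuousAt hyβ).comp' continuousAt_snd)
    have h2 : Tendsto (fun z : ℝ × ℝ => z.1 • γ z.2) (𝓝 (1, y)) (𝓝 ((1 : ℝ) • γ y)) := h1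
    rwa [one_smul] at h2
  have hpos : ∀ᶠ z : ℝ × ℝ in 𝓝 (1, y), 0 < z.1 :=
    continuousAt_fst.eventually (lt_mem_nhds one_pos)
  filter_upwards [ht.eventually (hγ.eventually_mem_image hyβ
    (Iio_mem_nhds (show y < b' by linarith [hy.2]))), hpos] with z hz hz1 hs hfr
  obtain ⟨σ, hσb, hσ, hσz⟩ := hz hfr
  have hsβ : z.2 ∈ Ioo 0 β := ⟨hs.1, by linarith [hs.2]⟩
  have hv : 0 < γ z.2 1 := hγ.above _ hsβ
  have e0 : γ σ 0 = z.1 * γ z.2 0 := by rw [hσz]; rfl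
  have e1 : γ σ 1 = z.1 * γ z.2 1 := by rw [hσz]; rfl
  have hσ0 : 0 < σ := by
    by_contra! h
    have := hγ.nonpos_of_nonpos hσ h
    rw [e1] at this
    exact absurd (mul_pos hz1 hv) (not_lt.2 this)
  have : σ = z.2 := by
    refine hinj ⟨hσ0, hσb⟩ ⟨hs.1, hs.2.trans hbb⟩ ?_
    simp only [e0, e1]
    field_simp
  rw [this] at e1
  have : (z.1 - 1) * γ z.2 1 = 0 := by linarith
  rcases mul_eq_zero.1 this with h | h
  · linarith
  · exact absurd h hv.ne'

/-- Near a polar graph piece of the curve, the planar set is exactly the subgraph. -/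
theorem exists_subgraph (hγ : IsGeneratingCurve A β γ) (hA : IsOpen A)
    (hball : ∀ q ∈ A, ‖q‖ ≤ 1) {b b' : ℝ} (hb : 0 < b) (hbb : b < b')
    (hb' : b' ≤ β) (hinj : InjOn (fun s => γ s 0 / γ s 1) (Ioo 0 b'))
    (hopen : ∀ Ω : Set (ℝ × ℝ), IsOpen Ω → Ω ⊆ Ioo 0 b ×ˢ Ioi 0 →
      IsOpen ((fun z : ℝ × ℝ => z.2 • γ z.1) '' Ω)) :
    ∃ τ ∈ Ioo (0 : ℝ) 1, ∀ s ∈ Ioo 0 b, ∀ t ∈ Ioo (1 - τ) (1 + τ), t • γ s ∈ A ↔ t < 1 := by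
  obtain ⟨τ₀, hτ₀, hτ⟩ := Metric.eventually_nhds_iff.1
    (hγ.eventually_smul_mem_frontier hbb hb' hinj)
  set τ := min τ₀ (1 / 2) with hτdef
  have hτ0 : 0 < τ := lt_min hτ₀ (by norm_num)
  have hτ1 : τ < 1 := lt_of_le_of_lt (min_le_right _ _) (by norm_num)
  have hfr : ∀ s ∈ Ioo 0 b, ∀ t ∈ Ioo (1 - τ) (1 + τ), t • γ s ∈ frontier A → t = 1 := by
    intro s hs t ht
    refine hτ ?_ s ⟨hs.1.le, hs.2.le⟩ hs
    rw [Real.dist_eq, abs_lt]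
    have := min_le_left τ₀ (1 / 2)
    constructor <;> linarith [ht.1, ht.2]
  have hsub : Ioo 0 b ⊆ Ioo (-β) β := fun s hs => ⟨by linarith [hs.1, hγ.pos], by linarith [hs.2]⟩
  have hcont : ContinuousOn (fun z : ℝ × ℝ => z.2 • γ z.1) (Ioo 0 b ×ˢ univ) := by
    intro z hz
    exact (continuousAt_snd.smul ((hγ.continuousAt (hsub hz.1)).comp'
      continuousAt_fst)).continuousWithinAt
  have hfront : ∀ s ∈ Ioo 0 b, γ s ∈ frontier A := fun s hs =>
    hγ.mem_boundary s ⟨(hsub hs).1.le, (hsub hs).2.le⟩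
  have hconn : ∀ a c, IsPreconnected ((fun z : ℝ × ℝ => z.2 • γ z.1) '' (Ioo 0 b ×ˢ Ioo a c)) :=
    fun a c => (isPreconnected_Ioo.prod isPreconnected_Ioo).image _
      (hcont.mono (prod_mono_right (subset_univ _)))
  -- The outer collar is connected and free of boundary points. If it met `A` it would lie in `A`;
  -- but letting `s → 0` it contains points with norm near `1 + τ / 2`, outside the unit disc.
  have hout : ∀ s ∈ Ioo 0 b, ∀ t ∈ Ioo 1 (1 + τ), t • γ s ∉ A := by
    intro s hs t ht hmem
    have hsubA := subset_of_disjoint_frontier hA (hconn 1 (1 + τ)) (disjoint_left.2 (by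
      rintro _ ⟨z, hz, rfl⟩ hf
      exact hz.2.1.ne' (hfr z.1 hz.1 z.2 ⟨by linarith [hz.2.1], hz.2.2⟩ hf)))
      ⟨t • γ s, ⟨(s, t), ⟨hs, ht⟩, rfl⟩, hmem⟩
    have hlim : Tendsto (fun s => ‖(1 + τ / 2) • γ s‖) (𝓝[>] 0) (𝓝 ‖(1 + τ / 2) • γ 0‖) :=
      (((hγ.continuousAt hγ.zero_mem).const_smul (1 + τ / 2)).norm).mono_left nhdsWithin_le_nhds
    have hle : ‖(1 + τ / 2) • γ 0‖ ≤ 1 := by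
      refine le_of_tendsto hlim ?_
      filter_upwards [Ioo_mem_nhdsGT hb] with s hs
      exact hball _ (hsubA ⟨(s, 1 + τ / 2), ⟨hs, by constructor <;> linarith⟩, rfl⟩)
    have h1 : ‖γ 0‖ = 1 := by
      rw [← sq_eq_sq₀ (norm_nonneg _) zero_le_one, norm_sq_plane, hγ.apply_zero_zero,
        hγ.apply_zero_one]
      norm_num
    rw [norm_smul, h1, Real.norm_of_nonneg (by linarith)] at hle
    linarith
  -- Points of `A` accumulate at `γ (b / 2)`. They lie neither on the curve nor in the outer collar,
  -- so the inner collar meets `A`, and by connectedness it is contained in `A`.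
  have hin : ∀ s ∈ Ioo 0 b, ∀ t ∈ Ioo (1 - τ) 1, t • γ s ∈ A := by
    have hne : ((fun z : ℝ × ℝ => z.2 • γ z.1) '' (Ioo 0 b ×ˢ Ioo (1 - τ) 1) ∩ A).Nonempty := by
      have hm : b / 2 ∈ Ioo 0 b := ⟨by linarith, by linarith⟩
      have hO := hopen (Ioo 0 b ×ˢ Ioo (1 - τ) (1 + τ)) (isOpen_Ioo.prod isOpen_Ioo)
        (prod_mono_right fun t ht => by
          have := ht.1
          simp only [mem_Ioi]; linarith)
      have hmem : γ (b / 2) ∈ (fun z : ℝ × ℝ => z.2 • γ z.1) '' (Ioo 0 b ×ˢ Ioo (1 - τ) (1 + τ)) :=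
        ⟨(b / 2, 1), ⟨hm, by constructor <;> linarith⟩, by simp⟩
      obtain ⟨_, ⟨z, hz, rfl⟩, hzA⟩ := mem_closure_iff.1
        (frontier_subset_closure (hfront _ hm)) _ hO hmem
      refine ⟨_, ⟨z, ⟨hz.1, hz.2.1, ?_⟩, rfl⟩, hzA⟩
      by_contra! h
      rcases h.eq_or_lt with h | h
      · simp only [← h, one_smul] at hzA
        exact notMem_of_mem_frontier hA (hfront _ hz.1) hzA
      · exact hout _ hz.1 _ ⟨h, hz.2.2⟩ hzA
    have hsubA := subset_of_disjoint_frontier hA (hconn (1 - τ) 1) (disjoint_left.2 (by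
      rintro _ ⟨z, hz, rfl⟩ hf
      exact hz.2.2.ne (hfr z.1 hz.1 z.2 ⟨hz.2.1, by linarith [hz.2.2]⟩ hf))) hne
    intro s hs t ht
    exact hsubA ⟨(s, t), ⟨hs, ht⟩, rfl⟩
  refine ⟨τ, ⟨hτ0, hτ1⟩, fun s hs t ht => ⟨fun h => ?_, fun h => hin s hs t ⟨ht.1, h⟩⟩⟩
  by_contra! hge
  rcases hge.eq_or_lt with he | hlt
  · rw [← he, one_smul] at h
    exact notMem_of_mem_frontier hA (hfront s hs) h
  · exact hout s hs t ⟨hlt, ht.2⟩ h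

theorem hasDerivAt_normSq (hγ : IsGeneratingCurve A β γ) {s : ℝ} (hs : s ∈ Ioo (-β) β) :
    HasDerivAt (fun s => γ s 0 ^ 2 + γ s 1 ^ 2)
      (2 * (γ s 0 * deriv (fun s => γ s 0) s + γ s 1 * deriv (fun s => γ s 1) s)) s := by
  have h := ((hγ.hasDerivAt_coord hs 0).fun_pow 2).add ((hγ.hasDerivAt_coord hs 1).fun_pow 2)
  refine h.congr_deriv ?_
  push_cast
  ring

end IsGeneratingCurve

/-- The distance from the origin does not increase along the upper half of the curve. -/
theorem radial_deriv_nonpos {k : ℕ} {E : Set (EuclideanSpace ℝ (Fin (k + 2)))}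
    (hEo : IsOpen E) (hE : IsSphericallySymmetric E)
    (hγ : IsGeneratingCurve (crossSection E) β γ)
    (hball : ∀ q ∈ crossSection E, ‖q‖ ≤ 1) {s₀ : ℝ} (hs₀ : s₀ ∈ Ioo 0 β) :
    γ s₀ 0 * deriv (fun s => γ s 0) s₀ + γ s₀ 1 * deriv (fun s => γ s 1) s₀ ≤ 0 := by
  by_contra! hX
  have hsβ : s₀ ∈ Ioo (-β) β := ⟨by linarith [hs₀.1, hγ.pos], hs₀.2⟩
  set R : ℝ → ℝ := fun s => γ s 0 ^ 2 + γ s 1 ^ 2 with hR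
  have hRn : ∀ s, R s = ‖γ s‖ ^ 2 := fun s => (norm_sq_plane _).symm
  have hd : HasDerivAt R _ s₀ := hγ.hasDerivAt_normSq hsβ
  have hv₀ : 0 < γ s₀ 1 := hγ.above s₀ hs₀
  have hclosure : ∀ q ∈ closure (crossSection E), ‖q‖ ≤ 1 := by
    have : closure (crossSection E) ⊆ {q | ‖q‖ ≤ 1} :=
      closure_minimal hball (isClosed_le continuous_norm continuous_const)
    exact this
  have hfront : ∀ s ∈ Icc (-β) β, γ s ∈ frontier (crossSection E) := hγ.mem_boundary
  -- If the distance increased at `s₀`, it would be smaller just before. As it is maximal at `0`,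
  -- the value at `s₀` was already attained at an earlier `s'`.
  obtain ⟨s₁, hs₁, hRs₁⟩ : ∃ s₁ ∈ Ioo 0 s₀, R s₁ < R s₀ := by
    have h1 : Tendsto (slope R s₀) (𝓝[<] s₀) (𝓝 _) :=
      (hasDerivWithinAt_iff_tendsto_slope' (s := Iio s₀) (by simp)).1 hd.hasDerivWithinAt
    have h2 := h1.eventually (lt_mem_nhds (mul_pos two_pos hX))
    obtain ⟨s₁, h3, h4⟩ := (h2.and (Ioo_mem_nhdsLT hs₀.1)).exists
    refine ⟨s₁, h4, ?_⟩
    rw [slope_def_field] at h3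
    have : s₁ - s₀ < 0 := by linarith [h4.2]
    by_contra! hge
    exact absurd h3 (not_lt.2 (div_nonpos_of_nonneg_of_nonpos (by linarith) this.le))
  have hR0 : R s₀ ≤ R 0 := by
    rw [hRn, hRn 0, norm_sq_plane (γ 0), hγ.apply_zero_zero, hγ.apply_zero_one]
    have := hclosure _ (frontier_subset_closure (hfront s₀ ⟨hsβ.1.le, hsβ.2.le⟩))
    nlinarith [norm_nonneg (γ s₀)]
  have hRc : ContinuousOn R (Icc 0 s₁) := by
    intro s hs
    exact (hγ.hasDerivAt_normSq ⟨by linarith [hs.1, hγ.pos],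
      by linarith [hs.2, hs₁.2, hs₀.2]⟩).continuousAt.continuousWithinAt
  obtain ⟨s', hs', hRs'⟩ := intermediate_value_Icc' hs₁.1.le hRc ⟨hRs₁.le, hR0⟩
  have hs'β : s' ∈ Icc (-β) β := ⟨by linarith [hs'.1, hγ.pos], by linarith [hs'.2, hs₁.2, hs₀.2]⟩
  have hne : γ s' ≠ γ s₀ := by
    intro h
    have := hγ.eq_of_apply_eq hs'β hsβ h
    linarith [hs'.2, hs₁.2]
  have hv' : 0 ≤ γ s' 1 := by
    rcases hs'.1.eq_or_lt with h | h
    · rw [← h, hγ.apply_zero_one]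
    · exact (hγ.above s' ⟨h, by linarith [hs'.2, hs₁.2, hs₀.2]⟩).le
  have hu : γ s' 0 ≠ γ s₀ 0 := by
    intro h
    refine hne (plane_ext h ?_)
    have : γ s' 1 ^ 2 = γ s₀ 1 ^ 2 := by
      have : γ s' 0 ^ 2 + γ s' 1 ^ 2 = γ s₀ 0 ^ 2 + γ s₀ 1 ^ 2 := hRs'
      rw [h] at this
      linarith
    exact (sq_eq_sq₀ hv' hv₀.le).1 this
  set ρ := R s₀ with hρ
  have hρeq : ρ = γ s₀ 0 ^ 2 + γ s₀ 1 ^ 2 := rfl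
  -- The upper half of the circle about the origin through `γ s₀` and `γ s'`, parametrized by
  -- abscissa.
  set Q : ℝ → EuclideanSpace ℝ (Fin 2) := fun a => !₂[a, √(ρ - a ^ 2)] with hQ
  have hQc : Continuous Q := by
    have : Continuous fun a : ℝ => ![a, √(ρ - a ^ 2)] := by
      refine continuous_pi fun i => ?_
      fin_cases i
      · exact continuous_id
      · simp; fun_prop
    exact (PiLp.continuous_toLp 2 _).comp this
  have hQ0 : Q (γ s₀ 0) = γ s₀ := by
    refine plane_ext rfl ?_
    change √(ρ - γ s₀ 0 ^ 2) = γ s₀ 1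
    rw [hρeq, add_sub_cancel_left, Real.sqrt_sq hv₀.le]
  have hQn : ∀ᶠ a in 𝓝 (γ s₀ 0), ‖Q a‖ ^ 2 = ρ := by
    have : ∀ᶠ a in 𝓝 (γ s₀ 0), 0 < ρ - a ^ 2 := by
      have hc : Continuous fun a : ℝ => ρ - a ^ 2 := by fun_prop
      exact hc.continuousAt.eventually (lt_mem_nhds (by rw [hρeq]; nlinarith))
    filter_upwards [this] with a ha
    rw [norm_sq_plane]
    change a ^ 2 + √(ρ - a ^ 2) ^ 2 = ρ
    rw [Real.sq_sqrt ha.le]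
    ring
  have hdne : ∀ᶠ σ in 𝓝[≠] s₀, R σ ≠ ρ := hd.eventually_ne (mul_pos two_pos hX).ne'
  have hN : {σ | σ ≠ s₀ → R σ ≠ ρ} ∈ 𝓝 s₀ := eventually_nhdsWithin_iff.1 hdne
  have himg : ∀ᶠ a in 𝓝 (γ s₀ 0), Q a ∈ frontier (crossSection E) →
      ∃ σ ∈ {σ | σ ≠ s₀ → R σ ≠ ρ}, σ ∈ Icc (-β) β ∧ γ σ = Q a := by
    have ht : Tendsto Q (𝓝 (γ s₀ 0)) (𝓝 (γ s₀)) := by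
      have := hQc.tendsto (γ s₀ 0)
      rwa [hQ0] at this
    exact ht.eventually (hγ.eventually_mem_image hsβ hN)
  -- Near `γ s₀` the boundary is the curve, which meets this circle only at `γ s₀` because its
  -- radial derivative there is nonzero.
  have hnofr : ∀ᶠ a in 𝓝[≠] (γ s₀ 0), Q a ∉ frontier (crossSection E) := by
    filter_upwards [nhdsWithin_le_nhds hQn, nhdsWithin_le_nhds himg, self_mem_nhdsWithin]
      with a ha1 ha2 ha3 hfr
    obtain ⟨σ, hσ, -, hσQ⟩ := ha2 hfr
    by_cases hσs : σ = s₀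
    · subst hσs
      exact ha3 (by rw [hσQ]; rfl)
    · exact hσ hσs (by rw [hRn, hσQ, ha1])
  have hρ0 : 0 < ρ := by rw [hρeq]; nlinarith [sq_nonneg (γ s₀ 0)]
  have hnorm : ∀ a, ‖Q a‖ ^ 2 = ρ → ‖Q a‖ = ‖γ s₀‖ ∧ ‖Q a‖ = ‖γ s'‖ ∧ Q a ≠ 0 := by
    intro a ha
    refine ⟨?_, ?_, ?_⟩
    · rw [← sq_eq_sq₀ (norm_nonneg _) (norm_nonneg _), ha, ← hRn]
    · rw [← sq_eq_sq₀ (norm_nonneg _) (norm_nonneg _), ha, ← hRn, hRs']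
    · intro h
      rw [h] at ha
      simp at ha
      linarith
  -- Spherical symmetry places the circular arc between the two points in the boundary. It leaves `γ
  -- s₀` on the side of `γ s'`, contradicting `hnofr`.
  rcases lt_or_gt_of_ne hu with hlt | hlt
  · have hev : ∀ᶠ a in 𝓝[<] (γ s₀ 0), Q a ∈ frontier (crossSection E) := by
      filter_upwards [nhdsWithin_le_nhds hQn, Ioo_mem_nhdsLT hlt] with a ha1 ha2
      obtain ⟨n1, n2, n3⟩ := hnorm a ha1
      exact mem_frontier_crossSection_of_between hEo hE (hfront s₀ ⟨hsβ.1.le, hsβ.2.le⟩)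
        (hfront s' hs'β) n1 n2 n3 ha2.1 ha2.2.le
    obtain ⟨a, h1, h2⟩ := (hev.and (hnofr.filter_mono
      (nhdsWithin_mono _ fun x hx => ne_of_lt hx))).exists
    exact h2 h1
  · have hev : ∀ᶠ a in 𝓝[>] (γ s₀ 0), Q a ∈ frontier (crossSection E) := by
      filter_upwards [nhdsWithin_le_nhds hQn, Ioo_mem_nhdsGT hlt] with a ha1 ha2
      obtain ⟨n1, n2, n3⟩ := hnorm a ha1
      exact mem_frontier_crossSection_of_between hEo hE (hfront s' hs'β)
        (hfront s₀ ⟨hsβ.1.le, hsβ.2.le⟩) n2 n1 n3 ha2.1 ha2.2.le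
    obtain ⟨a, h1, h2⟩ := (hev.and (hnofr.filter_mono
      (nhdsWithin_mono _ fun x hx => ne_of_gt hx))).exists
    exact h2 h1

end GeneratingCurve

/-! ### Radial perturbations of an arc as competitors -/

section Competitor

/-- Both perimeters are compared through the unchanged part `frontier E \ S`, whose weighted area is
finite and can be cancelled. -/
theorem lintegral_le_of_modification {n : ℕ} {p : ℝ} {E E' S S' : Set (EuclideanSpace ℝ (Fin n))}
    (hE : IsIsoperimetric p E) (hfin : weightedPerimeter p E ≠ ⊤) (hE' : MeasurableSet E')
    (hvol : weightedVolume p E' = weightedVolume p E) (hS : MeasurableSet S)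
    (hSE : S ⊆ frontier E) (hfr : frontier E' ⊆ (frontier E \ S) ∪ S') :
    ∫⁻ x in S, density p x ∂(μHE[n - 1]) ≤ ∫⁻ x in S', density p x ∂(μHE[n - 1]) := by
  have hsplit : weightedPerimeter p E = ∫⁻ x in S, density p x ∂(μHE[n - 1]) +
      ∫⁻ x in frontier E \ S, density p x ∂(μHE[n - 1]) := by
    rw [weightedPerimeter, ← lintegral_inter_add_sdiff _ (frontier E) hS,
      inter_eq_self_of_subset_right hSE]
  have hle := (hE.minimal E' hE' hvol).trans ((lintegral_mono_set hfr).trans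
    (lintegral_union_le _ _ _))
  rw [hsplit, add_comm] at hle
  exact (ENNReal.add_le_add_iff_left
    (ne_top_of_le_ne_top hfin (by rw [hsplit]; exact le_add_self))).1 hle

theorem mem_frontier_congr {X : Type*} [TopologicalSpace X] {A B : Set X} {x : X}
    (h : ∀ᶠ y in 𝓝 x, y ∈ A ↔ y ∈ B) : x ∈ frontier A ↔ x ∈ frontier B := by
  have h' := h.mono fun y hy => not_congr hy
  simp only [← mem_compl_iff] at h'
  rw [frontier_eq_closure_inter_closure, frontier_eq_closure_inter_closure, mem_inter_iff,
    mem_inter_iff, mem_closure_iff_frequently, mem_closure_iff_frequently,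
    mem_closure_iff_frequently, mem_closure_iff_frequently, frequently_congr h,
    frequently_congr h']

/-- A planar curve in the upper half of the unit disc, parametrized by arclength, along which
the polar angle strictly increases. -/
structure IsPolarArc (u v u' v' : ℝ → ℝ) (b : ℝ) : Prop where
  pos : 0 < b
  hu : ∀ s ∈ Ioo 0 b, HasStrictDerivAt u (u' s) s
  hv : ∀ s ∈ Ioo 0 b, HasStrictDerivAt v (v' s) s
  hu'c : ContinuousOn u' (Ioo 0 b)
  hv'c : ContinuousOn v' (Ioo 0 b)
  v_pos : ∀ s ∈ Ioo 0 b, 0 < v s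
  cross_pos : ∀ s ∈ Ioo 0 b, 0 < u s * v' s - v s * u' s
  inj : InjOn (fun s => u s / v s) (Ioo 0 b)
  speed : ∀ s ∈ Ioo 0 b, u' s ^ 2 + v' s ^ 2 = 1
  norm_le : ∀ s ∈ Ioo 0 b, u s ^ 2 + v s ^ 2 ≤ 1

/-- `E` coincides near the rotated arc with the region inside it. -/
structure IsInsideArc {k : ℕ} (E : Set (EuclideanSpace ℝ (Fin (k + 1)))) (u v : ℝ → ℝ)
    (b τ : ℝ) : Prop where
  τ_mem : τ ∈ Ioo (0 : ℝ) 1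
  mem_iff : ∀ s ∈ Ioo 0 b, ∀ t ∈ Ioo (1 - τ) (1 + τ), ∀ x : EuclideanSpace ℝ (Fin (k + 1)),
    x 0 = t * u s → ‖tail x‖ = t * v s → (x ∈ E ↔ t < 1)
  subset_frontier : rotatedCurve k u v (Ioo 0 b) ⊆ frontier E

variable {k : ℕ} {p : ℝ} {E : Set (EuclideanSpace ℝ (Fin (k + 1)))} {u v u' v' : ℝ → ℝ} {b τ : ℝ}

theorem weight_mul_cross_bounded (hp : 0 < p) (h : IsPolarArc u v u' v' b) {s : ℝ}
    (hs : s ∈ Ioo 0 b) :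
    0 < weight k p (u s) (v s) ∧ weight k p (u s) (v s) ≤ 1 ∧
      |u s * u' s + v s * v' s| ≤ 1 ∧ u s * v' s - v s * u' s ≤ 1 := by
  have hv := h.v_pos s hs
  have hn := h.norm_le s hs
  have hsp := h.speed s hs
  refine ⟨weight_pos hv, ?_, ?_, ?_⟩
  · have h1 : √(u s ^ 2 + v s ^ 2) ≤ 1 := Real.sqrt_le_one.2 hn
    exact mul_le_one₀ (Real.rpow_le_one (Real.sqrt_nonneg _) h1 hp.le) (by positivity)
      (pow_le_one₀ hv.le (by nlinarith [sq_nonneg (u s)]))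
  · rw [abs_le]
    constructor <;> nlinarith [sq_nonneg (u s - u' s), sq_nonneg (v s - v' s),
      sq_nonneg (u s + u' s), sq_nonneg (v s + v' s)]
  · nlinarith [sq_nonneg (u s - v' s), sq_nonneg (v s + u' s)]

theorem continuousOn_weight (hp : 0 < p) (h : IsPolarArc u v u' v' b) :
    ContinuousOn (fun s => weight k p (u s) (v s)) (Ioo 0 b) := by
  have huc : ContinuousOn u (Ioo 0 b) := fun s hs =>
    (h.hu s hs).hasDerivAt.continuousAt.continuousWithinAt
  have hvc : ContinuousOn v (Ioo 0 b) := fun s hs =>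
    (h.hv s hs).hasDerivAt.continuousAt.continuousWithinAt
  exact ContinuousOn.mul (ContinuousOn.rpow_const
      ((huc.pow 2).add (hvc.pow 2)).sqrt fun s hs => Or.inr hp.le) (hvc.pow _)

theorem continuousOn_cross (h : IsPolarArc u v u' v' b) :
    ContinuousOn (fun s => u s * v' s - v s * u' s) (Ioo 0 b) := by
  have huc : ContinuousOn u (Ioo 0 b) := fun s hs =>
    (h.hu s hs).hasDerivAt.continuousAt.continuousWithinAt
  have hvc : ContinuousOn v (Ioo 0 b) := fun s hs =>
    (h.hv s hs).hasDerivAt.continuousAt.continuousWithinAt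
  exact (huc.mul h.hv'c).sub (hvc.mul h.hu'c)

theorem continuousOn_radial (h : IsPolarArc u v u' v' b) :
    ContinuousOn (fun s => u s * u' s + v s * v' s) (Ioo 0 b) := by
  have huc : ContinuousOn u (Ioo 0 b) := fun s hs =>
    (h.hu s hs).hasDerivAt.continuousAt.continuousWithinAt
  have hvc : ContinuousOn v (Ioo 0 b) := fun s hs =>
    (h.hv s hs).hasDerivAt.continuousAt.continuousWithinAt
  exact (huc.mul h.hu'c).add (hvc.mul h.hv'c)

theorem integrableOn_of_bounded {f : ℝ → ℝ} {b C : ℝ} (hf : ContinuousOn f (Ioo 0 b))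
    (hC : ∀ s ∈ Ioo 0 b, |f s| ≤ C) : IntegrableOn f (Ioo 0 b) := by
  refine IntegrableOn.of_bound (by simp) (hf.aestronglyMeasurable measurableSet_Ioo) C ?_
  filter_upwards [ae_restrict_mem measurableSet_Ioo] with s hs
  exact hC s hs

/-- Integration in `t` makes the difference of the two volumes a multiple of the integral that
vanishes by assumption. The bound on `κ - 1` makes the integrands nonnegative and bounded, so the
lower integrals become ordinary ones. -/
theorem weightedVolume_below_eq (hk : 1 ≤ k) (hp : 0 < p) (h : IsPolarArc u v u' v' b)
    (hτ : τ ∈ Ioo (0 : ℝ) 1) {κ : ℝ → ℝ} (hκ : Continuous κ)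
    (hκτ : ∀ s, |κ s - 1| ≤ τ / 2)
    (hvol : ∫ s in Ioo 0 b, weight k p (u s) (v s) * (u s * v' s - v s * u' s) *
      (κ s ^ (p + k + 1) - 1) = 0) :
    weightedVolume p (coneBody k u v {q | q.1 ∈ Ioo 0 b ∧ 1 - τ < q.2 ∧ q.2 < κ q.1}) =
      weightedVolume p (coneBody k u v {q | q.1 ∈ Ioo 0 b ∧ 1 - τ < q.2 ∧ q.2 < 1}) := by
  have hlo : ∀ s, 1 - τ ≤ κ s := fun s => by
    have := (abs_le.1 (hκτ s)).1; linarith [hτ.1]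
  have hk0 : (0 : ℝ) ≤ k := k.cast_nonneg
  have hder := fun s hs => (h.hu s hs).hasDerivAt
  have hder' := fun s hs => (h.hv s hs).hasDerivAt
  rw [weightedVolume_coneBody_between hk hp hder hder' h.hu'c h.hv'c h.v_pos h.cross_pos h.inj
      (by linarith [hτ.2]) hκ fun s _ => hlo s,
    weightedVolume_coneBody_between hk hp hder hder' h.hu'c h.hv'c h.v_pos h.cross_pos h.inj
      (κ := fun _ => 1) (by linarith [hτ.2]) continuous_const fun s _ => by linarith [hτ.1]]
  congr 1
  set c : ℝ → ℝ := fun s => weight k p (u s) (v s) * (u s * v' s - v s * u' s) with hc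
  have hcc : ContinuousOn c (Ioo 0 b) := (continuousOn_weight hp h).mul (continuousOn_cross h)
  have hc0 : ∀ s ∈ Ioo 0 b, 0 < c s := fun s hs =>
    mul_pos (weight_mul_cross_bounded (k := k) hp h hs).1 (h.cross_pos s hs)
  have hc1 : ∀ s ∈ Ioo 0 b, c s ≤ 1 := fun s hs => by
    obtain ⟨h1, h2, -, h4⟩ := weight_mul_cross_bounded (k := k) hp h hs
    exact mul_le_one₀ h2 (h.cross_pos s hs).le h4
  set m : ℝ := p + k + 1 with hm
  have hm0 : 0 < m := by positivity
  have hgen : ∀ κ : ℝ → ℝ, Continuous κ → (∀ s, |κ s - 1| ≤ τ / 2) →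
      IntegrableOn (fun s => c s * ((κ s ^ m - (1 - τ) ^ m) / m)) (Ioo 0 b) ∧
      ∫⁻ s in Ioo 0 b, ENNReal.ofReal (c s * ((κ s ^ m - (1 - τ) ^ m) / m)) =
        ENNReal.ofReal (∫ s in Ioo 0 b, c s * ((κ s ^ m - (1 - τ) ^ m) / m)) := by
    intro κ hκ hκτ
    have hlo : ∀ s, 1 - τ ≤ κ s := fun s => by
      have := (abs_le.1 (hκτ s)).1; linarith [hτ.1]
    have hup : ∀ s, κ s ≤ 2 := fun s => by
      have := (abs_le.1 (hκτ s)).2; linarith [hτ.2]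
    have hnn : ∀ s, 0 ≤ (κ s ^ m - (1 - τ) ^ m) / m := fun s =>
      div_nonneg (sub_nonneg.2 (Real.rpow_le_rpow (by linarith [hτ.2]) (hlo s) hm0.le)) hm0.le
    have hub : ∀ s, (κ s ^ m - (1 - τ) ^ m) / m ≤ 2 ^ m / m := fun s => by
      have h1 : κ s ^ m ≤ 2 ^ m :=
        Real.rpow_le_rpow (by linarith [hlo s, hτ.2]) (hup s) hm0.le
      have h2 : 0 ≤ (1 - τ) ^ m := Real.rpow_nonneg (by linarith [hτ.2]) _
      gcongr
      linarith
    have hint : IntegrableOn (fun s => c s * ((κ s ^ m - (1 - τ) ^ m) / m)) (Ioo 0 b) := by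
      refine integrableOn_of_bounded (C := 2 ^ m / m) (hcc.mul ?_) fun s hs => ?_
      · exact (((hκ.rpow_const fun s => Or.inr hm0.le).sub continuous_const).div_const m).continuousOn
      · rw [abs_of_nonneg (mul_nonneg (hc0 s hs).le (hnn s))]
        calc _ ≤ 1 * (2 ^ m / m) := mul_le_mul (hc1 s hs) (hub s) (hnn s) zero_le_one
          _ = _ := one_mul _
    refine ⟨hint, (ofReal_integral_eq_lintegral_ofReal hint ?_).symm⟩
    filter_upwards [ae_restrict_mem measurableSet_Ioo] with s hs
    exact mul_nonneg (hc0 s hs).le (hnn s)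
  have h1 := hgen κ hκ hκτ
  have h2 := hgen (fun _ => 1) continuous_const fun s => by simp; linarith [hτ.1]
  rw [h1.2, h2.2]
  congr 1
  rw [← sub_eq_zero, ← integral_sub h1.1 h2.1]
  have : ∀ s, c s * ((κ s ^ m - (1 - τ) ^ m) / m) - c s * (((1 : ℝ) ^ m - (1 - τ) ^ m) / m) =
      m⁻¹ * (c s * (κ s ^ m - 1)) := fun s => by
    rw [Real.one_rpow]; field_simp; ring
  simp only [this]
  rw [integral_const_mul, hvol, mul_zero]

/-- Pushing the rotated arc radially without changing the enclosed weighted volume does not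
decrease its weighted area. -/
theorem lintegral_arc_le (hk : 1 ≤ k) (hp : 0 < p) (hE : IsIsoperimetric p E)
    (hfin : weightedPerimeter p E ≠ ⊤) (h : IsPolarArc u v u' v' b)
    (hin : IsInsideArc E u v b τ) {κ κ' : ℝ → ℝ}
    (hκ : ∀ s, HasStrictDerivAt κ (κ' s) s) (hκ'c : Continuous κ')
    (hκτ : ∀ s, |κ s - 1| ≤ τ / 2) {C : Set ℝ} (hC : IsCompact C) (hCb : C ⊆ Ioo 0 b)
    (hκC : ∀ s, s ∉ C → κ s = 1)
    (hvol : ∫ s in Ioo 0 b, weight k p (u s) (v s) * (u s * v' s - v s * u' s) *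
      (κ s ^ (p + k + 1) - 1) = 0) :
    ∫⁻ s in Ioo 0 b, ENNReal.ofReal (weight k p (u s) (v s) * √(u' s ^ 2 + v' s ^ 2)) ≤
      ∫⁻ s in Ioo 0 b, ENNReal.ofReal (weight k p (κ s * u s) (κ s * v s) *
        √((κ' s * u s + κ s * u' s) ^ 2 + (κ' s * v s + κ s * v' s) ^ 2)) := by
  obtain ⟨hτ0, hτ1⟩ := hin.τ_mem
  have hκc : Continuous κ := continuous_iff_continuousAt.2 fun s => (hκ s).hasDerivAt.continuousAt
  have hlo : ∀ s, 1 - τ / 2 ≤ κ s := fun s => by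
    have := (abs_le.1 (hκτ s)).1; linarith
  have hup : ∀ s, κ s ≤ 1 + τ / 2 := fun s => by
    have := (abs_le.1 (hκτ s)).2; linarith
  have hκ0 : ∀ s, 0 < κ s := fun s => by linarith [hlo s]
  have huc : ContinuousOn u (Ioo 0 b) := fun s hs =>
    (h.hu s hs).hasDerivAt.continuousAt.continuousWithinAt
  have hvc : ContinuousOn v (Ioo 0 b) := fun s hs =>
    (h.hv s hs).hasDerivAt.continuousAt.continuousWithinAt
  have hinjc := injOn_coneMap h.v_pos h.inj
  -- the two surfaces
  have hS := lintegral_rotatedCurve hk p h.hu h.hv h.hu'c h.hv'c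
    (fun s hs => by rw [h.speed s hs]; exact one_pos) h.v_pos
    (fun s hs t ht hst => h.inj hs ht (by
      simp only [Prod.mk.injEq] at hst; simp only [hst.1, hst.2]))
  have hS' := lintegral_rotatedCurve (u := fun s => κ s * u s) (v := fun s => κ s * v s)
    (u' := fun s => κ' s * u s + κ s * u' s) (v' := fun s => κ' s * v s + κ s * v' s) hk p
    (fun s hs => (hκ s).mul (h.hu s hs)) (fun s hs => (hκ s).mul (h.hv s hs))
    ((hκ'c.continuousOn.mul huc).add (hκc.continuousOn.mul h.hu'c))
    ((hκ'c.continuousOn.mul hvc).add (hκc.continuousOn.mul h.hv'c))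
    (fun s hs => by
      have hYs := h.cross_pos s hs
      -- The cross product of the perturbed curve's velocity with `(u, v)` does not involve `κ'`. By
      -- Cauchy–Schwarz its positivity shows that the perturbed curve is regular.
      have hid : (κ s * (u s * v' s - v s * u' s)) ^ 2 ≤
          ((κ' s * u s + κ s * u' s) ^ 2 + (κ' s * v s + κ s * v' s) ^ 2) *
            (u s ^ 2 + v s ^ 2) := by
        nlinarith [sq_nonneg ((κ' s * u s + κ s * u' s) * u s + (κ' s * v s + κ s * v' s) * v s)]
      have hpos : 0 < (κ s * (u s * v' s - v s * u' s)) ^ 2 := by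
        have := hκ0 s; positivity
      have hr : 0 < u s ^ 2 + v s ^ 2 := by
        have := h.v_pos s hs; positivity
      exact pos_of_mul_pos_left (lt_of_lt_of_le hpos hid) hr.le)
    (fun s hs => mul_pos (hκ0 s) (h.v_pos s hs))
    (fun s hs t ht hst => h.inj hs ht (by
      simp only [Prod.mk.injEq] at hst
      have e1 : u s / v s = (κ s * u s) / (κ s * v s) := by
        have := (hκ0 s).ne'; field_simp
      have e2 : u t / v t = (κ t * u t) / (κ t * v t) := by
        have := (hκ0 t).ne'; field_simp
      simp only [e1, e2, hst.1, hst.2]))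
  set S := rotatedCurve k u v (Ioo 0 b) with hSdef
  set S' := rotatedCurve k (fun s => κ s * u s) (fun s => κ s * v s) (Ioo 0 b) with hS'def
  -- the box and the competitor
  have hopen : ∀ l κ₁ : ℝ → ℝ, Continuous l → Continuous κ₁ → (∀ s, 0 ≤ l s) →
      IsOpen (coneBody k u v {q | q.1 ∈ Ioo 0 b ∧ l q.1 < q.2 ∧ q.2 < κ₁ q.1}) := by
    intro l κ₁ hl hκ₁ hl0
    refine IsOpen.preimage continuous_reduction
      (isOpen_image_coneMap h.hu h.hv h.cross_pos ?_ fun q hq => ⟨hq.1, (hl0 _).trans_lt hq.2.1⟩)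
    exact (isOpen_Ioo.preimage continuous_fst).inter
      ((isOpen_lt (hl.comp continuous_fst) continuous_snd).inter
        (isOpen_lt continuous_snd (hκ₁.comp continuous_fst)))
  set O := coneBody k u v {q | q.1 ∈ Ioo 0 b ∧ 1 - τ < q.2 ∧ q.2 < 1 + τ} with hO
  set O₁ := coneBody k u v {q | q.1 ∈ Ioo 0 b ∧ 1 - τ < q.2 ∧ q.2 < 1} with hO₁
  set O₂ := coneBody k u v {q | q.1 ∈ Ioo 0 b ∧ 1 - τ < q.2 ∧ q.2 < κ q.1} with hO₂
  have hOo : IsOpen O := hopen (fun _ => 1 - τ) (fun _ => 1 + τ) continuous_const continuous_const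
    fun _ => by linarith
  have hO₂o : IsOpen O₂ := hopen (fun _ => 1 - τ) κ continuous_const hκc fun _ => by linarith
  have hO₂O : O₂ ⊆ O := by
    rintro x ⟨q, hq, hqx⟩
    exact ⟨q, ⟨hq.1, hq.2.1, by linarith [hq.2.2, hup q.1]⟩, hqx⟩
  have hEO : E ∩ O = O₁ := by
    ext x
    constructor
    · rintro ⟨hxE, q, hq, hqx⟩
      have h0 : x 0 = q.2 * u q.1 := (congrArg Prod.fst hqx).symm
      have h1 : ‖tail x‖ = q.2 * v q.1 := (congrArg Prod.snd hqx).symm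
      exact ⟨q, ⟨hq.1, hq.2.1, (hin.mem_iff _ hq.1 _ hq.2 x h0 h1).1 hxE⟩, hqx⟩
    · rintro ⟨q, hq, hqx⟩
      have h0 : x 0 = q.2 * u q.1 := (congrArg Prod.fst hqx).symm
      have h1 : ‖tail x‖ = q.2 * v q.1 := (congrArg Prod.snd hqx).symm
      have hq2 : q.2 < 1 + τ := by linarith [hq.2.2]
      exact ⟨(hin.mem_iff _ hq.1 _ ⟨hq.2.1, hq2⟩ x h0 h1).2 hq.2.2, q, ⟨hq.1, hq.2.1, hq2⟩, hqx⟩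
  set E' := (E \ O) ∪ O₂ with hE'def
  have hE'm : MeasurableSet E' := (hE.measurable.diff hOo.measurableSet).union hO₂o.measurableSet
  have hvolE : weightedVolume p E' = weightedVolume p E := by
    have e1 : weightedVolume p E = weightedVolume p O₁ + weightedVolume p (E \ O) := by
      rw [weightedVolume, ← lintegral_inter_add_sdiff _ E hOo.measurableSet, hEO]
      rfl
    have e2 : weightedVolume p E' = weightedVolume p O₂ + weightedVolume p (E \ O) := by
      rw [weightedVolume, hE'def, lintegral_union hO₂o.measurableSet
        (disjoint_left.2 fun x hx hx2 => hx.2 (hO₂O hx2)), add_comm]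
      rfl
    rw [e1, e2, hO₁, hO₂, weightedVolume_below_eq hk hp h hin.τ_mem hκc hκτ hvol]
  have hSO : S ⊆ O := by
    rintro x ⟨s, hs, h0, h1⟩
    exact ⟨(s, 1), ⟨hs, by linarith, by linarith⟩, by simp [coneMap, h0, h1]⟩
  -- agreement off a compact set
  set K : Set (EuclideanSpace ℝ (Fin (k + 1))) :=
    {x | (x 0, ‖tail x‖) ∈ coneMap u v '' (C ×ˢ Icc (1 - τ / 2) (1 + τ / 2))} with hK
  have hKc : IsClosed K := by
    refine IsClosed.preimage continuous_reduction (IsCompact.isClosed ?_)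
    refine (hC.prod isCompact_Icc).image_of_continuousOn ?_
    intro q hq
    have h1 := hasStrictFDerivAt_coneMap (q := q) (h.hu _ (hCb hq.1)) (h.hv _ (hCb hq.1))
    exact h1.hasFDerivAt.continuousAt.continuousWithinAt
  have hKO : K ⊆ O := by
    rintro x ⟨q, hq, hqx⟩
    exact ⟨q, ⟨hCb hq.1, by linarith [hq.2.1], by linarith [hq.2.2]⟩, hqx⟩
  have hagree : ∀ y, y ∉ K → (y ∈ E' ↔ y ∈ E) := by
    intro y hyK
    by_cases hyO : y ∈ O
    · obtain ⟨q, hq, hqy⟩ := hyO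
      have h0 : y 0 = q.2 * u q.1 := (congrArg Prod.fst hqy).symm
      have h1 : ‖tail y‖ = q.2 * v q.1 := (congrArg Prod.snd hqy).symm
      rw [hin.mem_iff _ hq.1 _ hq.2 y h0 h1]
      have hyE' : y ∈ E' ↔ q.2 < κ q.1 := by
        constructor
        · rintro (hy | ⟨q', hq', hqy'⟩)
          · exact absurd ⟨q, hq, hqy⟩ hy.2
          · have : q' = q := hinjc ⟨hq'.1, by have := hq'.2.1; simp only [mem_Ioi]; linarith⟩
              ⟨hq.1, by have := hq.2.1; simp only [mem_Ioi]; linarith⟩ (hqy'.trans hqy.symm)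
            rw [← this]; exact hq'.2.2
        · exact fun hlt => Or.inr ⟨q, ⟨hq.1, hq.2.1, hlt⟩, hqy⟩
      rw [hyE']
      by_cases hqC : q.1 ∈ C
      · have hq2 : q.2 ∉ Icc (1 - τ / 2) (1 + τ / 2) := fun hmem =>
          hyK ⟨q, ⟨hqC, hmem⟩, hqy⟩
        rcases lt_or_ge q.2 (1 - τ / 2) with hlt | hge
        · exact ⟨fun _ => by linarith, fun _ => by linarith [hlo q.1]⟩
        · have hgt : 1 + τ / 2 < q.2 := by
            by_contra! hle
            exact hq2 ⟨hge, hle⟩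
          exact ⟨fun hh => by linarith [hup q.1], fun hh => by linarith⟩
      · rw [hκC _ hqC]
    · constructor
      · rintro (hy | hy)
        · exact hy.1
        · exact absurd (hO₂O hy) hyO
      · exact fun hy => Or.inl ⟨hy, hyO⟩
  -- In the box `O`, points below the new graph are interior to `E'` and points above it have a
  -- neighbourhood missing `E'`. Off `O`, the sets `E` and `E'` agree locally because they differ
  -- only inside the closed set `K ⊆ O`.
  have hfr : frontier E' ⊆ (frontier E \ S) ∪ S' := by
    intro x hx
    by_cases hxO : x ∈ O
    · right
      obtain ⟨q, hq, hqx⟩ := hxO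
      have h0 : x 0 = q.2 * u q.1 := (congrArg Prod.fst hqx).symm
      have h1 : ‖tail x‖ = q.2 * v q.1 := (congrArg Prod.snd hqx).symm
      suffices q.2 = κ q.1 from ⟨q.1, hq.1, by rw [h0, this], by rw [h1, this]⟩
      rcases lt_trichotomy q.2 (κ q.1) with hlt | heq | hgt
      · exfalso
        have hxi : x ∈ interior E' :=
          mem_interior.2 ⟨O₂, subset_union_right, hO₂o, q, ⟨hq.1, hq.2.1, hlt⟩, hqx⟩
        exact hx.2 hxi
      · exact heq
      · exfalso
        have hUo := hopen κ (fun _ => 1 + τ) hκc continuous_const fun s => (hκ0 s).le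
        have hxU : x ∈ coneBody k u v {q | q.1 ∈ Ioo 0 b ∧ κ q.1 < q.2 ∧ q.2 < 1 + τ} :=
          ⟨q, ⟨hq.1, hgt, hq.2.2⟩, hqx⟩
        obtain ⟨y, ⟨q₁, hq₁, hqy₁⟩, hyE'⟩ := mem_closure_iff.1 hx.1 _ hUo hxU
        rcases hyE' with hy | ⟨q₂, hq₂, hqy₂⟩
        · exact hy.2 ⟨q₁, ⟨hq₁.1, by linarith [hq₁.2.1, hlo q₁.1], hq₁.2.2⟩, hqy₁⟩
        · have : q₁ = q₂ := hinjc ⟨hq₁.1, (hκ0 _).trans hq₁.2.1⟩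
            ⟨hq₂.1, by have := hq₂.2.1; simp only [mem_Ioi]; linarith⟩ (hqy₁.trans hqy₂.symm)
          rw [this] at hq₁
          linarith [hq₁.2.1, hq₂.2.2]
    · left
      refine ⟨(mem_frontier_congr ?_).1 hx, fun hxS => hxO (hSO hxS)⟩
      filter_upwards [hKc.isOpen_compl.mem_nhds fun hxK => hxO (hKO hxK)] with y hy
      exact hagree y hy
  have hmain := lintegral_le_of_modification hE hfin hE'm hvolE hS.1 hin.subset_frontier hfr
  rw [Nat.add_sub_cancel, hS.2, hS'.2] at hmain
  refine (ENNReal.mul_le_mul_iff_right (sphereMass_ne_zero hk) sphereMass_ne_top).1 hmain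

end Competitor

/-! ### The first variation -/

/-- A second order upper bound for the weighted length element of a radial perturbation. -/
theorem length_element_le {q e f X R : ℝ} (hq0 : 0 ≤ q) (hq1 : q ≤ 1) (he : |e| ≤ 1 / 2)
    (hX : |X| ≤ 1) (hR : R ≤ 1) :
    (1 + e) ^ q * √(1 + 2 * (f / (1 + e)) * X + (f / (1 + e)) ^ 2 * R) ≤
      1 + q * e + f * X + 3 * (|e| + |f|) ^ 2 := by
  obtain ⟨he1, he2⟩ := abs_le.1 he
  have h1e : 0 < 1 + e := by linarith
  set ζ := f / (1 + e) with hζ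
  have hζe : ζ * (1 + e) = f := by rw [hζ]; field_simp
  have hζf : |ζ| ≤ 2 * |f| := by
    rw [hζ, abs_div, abs_of_pos h1e, div_le_iff₀ h1e]
    nlinarith [abs_nonneg f]
  have hP : (1 + e) ^ q ≤ 1 + q * e :=
    rpow_one_add_le_one_add_mul_self (by linarith) hq0 hq1
  have hP0 : 0 ≤ 1 + q * e := (Real.rpow_nonneg h1e.le _).trans hP
  have hQ : √(1 + 2 * ζ * X + ζ ^ 2 * R) ≤ 1 + ζ * X + ζ ^ 2 / 2 := by
    have h2 := (abs_le.1 hX)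
    have hX2 : X ^ 2 ≤ 1 := by nlinarith
    have h0 : 0 ≤ 1 + ζ * X + ζ ^ 2 / 2 := by nlinarith [sq_nonneg (ζ * X + 1), sq_nonneg ζ]
    refine Real.sqrt_le_iff.2 ⟨h0, ?_⟩
    nlinarith [sq_nonneg (ζ * X + ζ ^ 2 / 2), sq_nonneg ζ]
  calc (1 + e) ^ q * √(1 + 2 * ζ * X + ζ ^ 2 * R)
      ≤ (1 + q * e) * (1 + ζ * X + ζ ^ 2 / 2) :=
        mul_le_mul hP hQ (Real.sqrt_nonneg _) hP0
    _ = 1 + q * e + f * X + (q - 1) * e * ζ * X + (1 + q * e) * (ζ ^ 2 / 2) := by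
        rw [← hζe]; ring
    _ ≤ 1 + q * e + f * X + 3 * (|e| + |f|) ^ 2 := by
        have h3 : (q - 1) * e * ζ * X ≤ |e| * (2 * |f|) := by
          refine (le_abs_self _).trans ?_
          rw [abs_mul, abs_mul, abs_mul]
          have : |q - 1| ≤ 1 := by rw [abs_le]; constructor <;> linarith
          calc |q - 1| * |e| * |ζ| * |X| ≤ 1 * |e| * (2 * |f|) * 1 := by gcongr
            _ = |e| * (2 * |f|) := by ring
        have h4 : (1 + q * e) * (ζ ^ 2 / 2) ≤ 3 * |f| ^ 2 := by
          have h5 : ζ ^ 2 ≤ (2 * |f|) ^ 2 := by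
            rw [← sq_abs]; gcongr
          have h6 : 1 + q * e ≤ 3 / 2 := by nlinarith
          calc (1 + q * e) * (ζ ^ 2 / 2) ≤ (3 / 2) * ((2 * |f|) ^ 2 / 2) := by gcongr
            _ = 3 * |f| ^ 2 := by ring
        nlinarith [mul_nonneg (abs_nonneg e) (abs_nonneg f), sq_nonneg (|e|)]

/-- A linear function that is bounded below by a quadratic one near the origin vanishes. -/
theorem eq_zero_of_forall_small {L K ε₀ : ℝ} (hε₀ : 0 < ε₀)
    (h : ∀ ε, |ε| ≤ ε₀ → 0 ≤ ε * L + ε ^ 2 * K) : L = 0 := by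
  have hd : HasDerivAt (fun ε : ℝ => ε * L + ε ^ 2 * K) L 0 := by
    refine (((hasDerivAt_id (0 : ℝ)).mul_const L).add
      (((hasDerivAt_id (0 : ℝ)).pow 2).mul_const K)).congr_deriv ?_
    simp
  refine IsLocalMin.hasDerivAt_eq_zero (f := fun ε : ℝ => ε * L + ε ^ 2 * K) ?_ hd
  filter_upwards [Metric.closedBall_mem_nhds (0 : ℝ) hε₀] with ε hε
  have := h ε (by simpa using hε)
  simpa using this

section FirstVariation

variable {k : ℕ} {p : ℝ} {E : Set (EuclideanSpace ℝ (Fin (k + 1)))} {u v u' v' : ℝ → ℝ} {b τ : ℝ}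

/-- The perturbation `κ = (1 + ε η)^(1/m)` with `m = p + k + 1` satisfies `κ^m - 1 = ε η`, so the
volume constraint holds exactly, without a correction term. Minimality then gives an inequality
whose linear part in `ε` must vanish. -/
theorem first_variation (hk : 1 ≤ k) (hp : 0 < p) (hE : IsIsoperimetric p E)
    (hfin : weightedPerimeter p E ≠ ⊤) (h : IsPolarArc u v u' v' b)
    (hin : IsInsideArc E u v b τ) {η : ℝ → ℝ} (hη : ContDiff ℝ ∞ η) (hηc : HasCompactSupport η)
    (hηb : tsupport η ⊆ Ioo 0 b)
    (hvol : ∫ s in Ioo 0 b, weight k p (u s) (v s) * (u s * v' s - v s * u' s) * η s = 0) :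
    ∫ s in Ioo 0 b, weight k p (u s) (v s) *
      ((p + k) * η s + deriv η s * (u s * u' s + v s * v' s)) = 0 := by
  obtain ⟨hτ0, hτ1⟩ := hin.τ_mem
  have hη' : ∀ s, HasStrictDerivAt η (deriv η s) s := fun s =>
    (hη.contDiffAt).hasStrictDerivAt (by simp)
  have hη'c : Continuous (deriv η) := hη.continuous_deriv (by simp)
  obtain ⟨B₁, hB₁⟩ := hηc.exists_bound_of_continuous hη.continuous
  obtain ⟨B₂, hB₂⟩ := hηc.deriv.exists_bound_of_continuous hη'c
  set B := max 1 (max B₁ B₂) with hB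
  have hB1 : 1 ≤ B := le_max_left _ _
  have hηB : ∀ s, |η s| ≤ B := fun s => (hB₁ s).trans ((le_max_left _ _).trans (le_max_right _ _))
  have hηB' : ∀ s, |deriv η s| ≤ B := fun s =>
    (hB₂ s).trans ((le_max_right _ _).trans (le_max_right _ _))
  set m : ℝ := p + k + 1 with hm
  have hm1 : 1 < m := by rw [hm]; have : (0 : ℝ) ≤ k := Nat.cast_nonneg k; linarith
  have hm0 : 0 < m := by linarith
  set W : ℝ → ℝ := fun s => weight k p (u s) (v s) with hW
  set X : ℝ → ℝ := fun s => u s * u' s + v s * v' s with hX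
  have hWc : ContinuousOn W (Ioo 0 b) := continuousOn_weight hp h
  have hXc : ContinuousOn X (Ioo 0 b) := continuousOn_radial h
  have hW0 : ∀ s ∈ Ioo 0 b, 0 < W s := fun s hs => (weight_mul_cross_bounded hp h hs).1
  have hW1 : ∀ s ∈ Ioo 0 b, |W s| ≤ 1 := fun s hs => by
    rw [abs_of_pos (hW0 s hs)]; exact (weight_mul_cross_bounded hp h hs).2.1
  have hX1 : ∀ s ∈ Ioo 0 b, |X s| ≤ 1 := fun s hs =>
    (weight_mul_cross_bounded (k := k) hp h hs).2.2.1
  have hWi : IntegrableOn W (Ioo 0 b) := integrableOn_of_bounded hWc hW1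
  have hWf : ∀ f : ℝ → ℝ, ContinuousOn f (Ioo 0 b) → ∀ C, (∀ s ∈ Ioo 0 b, |f s| ≤ C) →
      IntegrableOn (fun s => W s * f s) (Ioo 0 b) := fun f hf C hC => by
    refine integrableOn_of_bounded (C := 1 * C) (hWc.mul hf) fun s hs => ?_
    rw [abs_mul]
    exact mul_le_mul (hW1 s hs) (hC s hs) (abs_nonneg _) zero_le_one
  have hi1 := hWf (fun s => (p + k) * η s + deriv η s * X s)
    ((continuousOn_const.mul hη.continuous.continuousOn).add (hη'c.continuousOn.mul hXc))
    ((p + k) * B + B * 1) fun s hs => by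
      refine (abs_add_le _ _).trans ?_
      rw [abs_mul, abs_mul, abs_of_nonneg (show (0 : ℝ) ≤ p + k by linarith)]
      gcongr
      · exact hηB s
      · exact hηB' s
      · exact hX1 s hs
  have hi2 := hWf (fun s => (|η s| + |deriv η s / m|) ^ 2)
    (by have := hη.continuous; fun_prop) ((B + B) ^ 2) fun s hs => by
      rw [abs_of_nonneg (by positivity)]
      gcongr
      · exact hηB s
      · rw [abs_div, abs_of_pos hm0]
        exact (div_le_self (abs_nonneg _) hm1.le).trans (hηB' s)
  set L := ∫ s in Ioo 0 b, W s * ((p + k) * η s + deriv η s * X s) with hL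
  set K := ∫ s in Ioo 0 b, W s * (|η s| + |deriv η s / m|) ^ 2 with hK
  change L = 0
  suffices hs : m⁻¹ * L = 0 by
    rcases mul_eq_zero.1 hs with h0 | h0
    · exact absurd h0 (inv_pos.2 hm0).ne'
    · exact h0
  -- Both signs of `ε` are admissible. The bound on `ε` keeps `|ε η| ≤ τ / 2`, so the perturbed arc
  -- stays in the collar.
  refine eq_zero_of_forall_small (K := 3 * K) (ε₀ := τ / 2 / B) (by positivity) fun ε hε => ?_
  have hεη : ∀ s, |ε * η s| ≤ τ / 2 := fun s => by
    rw [abs_mul]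
    calc |ε| * |η s| ≤ τ / 2 / B * B := by gcongr; exact hηB s
      _ = τ / 2 := by field_simp
  have hpos : ∀ s, 0 < 1 + ε * η s := fun s => by
    have := (abs_le.1 (hεη s)).1; linarith
  set κ : ℝ → ℝ := fun s => (1 + ε * η s) ^ m⁻¹ with hκ
  set κ' : ℝ → ℝ := fun s => ε * deriv η s * m⁻¹ * (1 + ε * η s) ^ (m⁻¹ - 1) with hκ'
  have hκ0 : ∀ s, 0 < κ s := fun s => Real.rpow_pos_of_pos (hpos s) _
  have hκm : ∀ s, κ s ^ m = 1 + ε * η s := fun s => by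
    rw [hκ]; exact Real.rpow_inv_rpow (hpos s).le hm0.ne'
  have hκd : ∀ s, HasStrictDerivAt κ (κ' s) s := fun s =>
    (HasStrictDerivAt.comp (h₂ := fun x : ℝ => x ^ m⁻¹) (h := fun s => 1 + ε * η s) s
      (Real.hasStrictDerivAt_rpow_const_of_ne (hpos s).ne' m⁻¹)
      (((hη' s).const_mul ε).const_add 1)).congr_deriv (by simp only [hκ']; ring)
  have hκ'c : Continuous κ' := by
    refine ((continuous_const.mul hη'c).mul continuous_const).mul ?_
    exact Continuous.rpow_const (by have := hη.continuous; fun_prop) fun s => Or.inl (hpos s).ne'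
  have hκτ : ∀ s, |κ s - 1| ≤ τ / 2 := fun s => by
    refine le_trans ?_ (hεη s)
    have hm' : m⁻¹ ≤ 1 := inv_le_one_of_one_le₀ hm1.le
    have hm0' : 0 ≤ m⁻¹ := (inv_pos.2 hm0).le
    rcases le_total 0 (ε * η s) with h0 | h0
    · have h1 : 1 ≤ κ s := Real.one_le_rpow (by linarith) hm0'
      have h2 : κ s ≤ 1 + ε * η s := by
        calc κ s ≤ (1 + ε * η s) ^ (1 : ℝ) :=
              Real.rpow_le_rpow_of_exponent_le (by linarith) hm'
          _ = _ := Real.rpow_one _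
      rw [abs_of_nonneg (by linarith), abs_of_nonneg h0]; linarith
    · have h1 : κ s ≤ 1 := Real.rpow_le_one (hpos s).le (by linarith) hm0'
      have h2 : 1 + ε * η s ≤ κ s := by
        calc 1 + ε * η s = (1 + ε * η s) ^ (1 : ℝ) := (Real.rpow_one _).symm
          _ ≤ κ s := Real.rpow_le_rpow_of_exponent_ge (hpos s) (by linarith) hm'
      rw [abs_of_nonpos (by linarith), abs_of_nonpos h0]; linarith
  have harc := lintegral_arc_le hk hp hE hfin h hin hκd hκ'c hκτ (C := tsupport η) hηc hηb
    (fun s hs => by simp [hκ, image_eq_zero_of_notMem_tsupport hs])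
    (by
      have : ∀ s, weight k p (u s) (v s) * (u s * v' s - v s * u' s) * (κ s ^ (p + k + 1) - 1) =
          ε * (weight k p (u s) (v s) * (u s * v' s - v s * u' s) * η s) := fun s => by
        rw [← hm, hκm]; ring
      simp only [this]
      rw [integral_const_mul, hvol, mul_zero])
  -- The length element scales by `κ^(p+k) = (1 + ε η)^q`. Since `0 ≤ q ≤ 1`, Bernoulli's inequality
  -- bounds this power above by its linear part.
  set q : ℝ := (p + k) / m with hq
  have hq0 : 0 ≤ q := by positivity
  have hq1 : q ≤ 1 := by rw [hq, div_le_one hm0]; linarith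
  have hbd : ∀ s ∈ Ioo 0 b, weight k p (κ s * u s) (κ s * v s) *
      √((κ' s * u s + κ s * u' s) ^ 2 + (κ' s * v s + κ s * v' s) ^ 2) ≤
      W s + ε * (m⁻¹ * (W s * ((p + k) * η s + deriv η s * X s))) +
        ε ^ 2 * (3 * (W s * (|η s| + |deriv η s / m|) ^ 2)) := fun s hs => by
    have hsp := h.speed s hs
    set f := ε * (deriv η s / m) with hf
    have hκ'f : κ' s = κ s * (f / (1 + ε * η s)) := by
      simp only [hκ', hκ]
      rw [Real.rpow_sub_one (hpos s).ne', hf]; ring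
    have hsq : (κ' s * u s + κ s * u' s) ^ 2 + (κ' s * v s + κ s * v' s) ^ 2 =
        κ s ^ 2 * (1 + 2 * (f / (1 + ε * η s)) * X s +
          (f / (1 + ε * η s)) ^ 2 * (u s ^ 2 + v s ^ 2)) := by
      rw [hκ'f, hX]; simp only; linear_combination (κ s ^ 2) * hsp
    have hκq : κ s ^ (p + k - 1) * κ s = (1 + ε * η s) ^ q := by
      rw [← Real.rpow_add_one (hκ0 s).ne', hκ]; simp only
      rw [← Real.rpow_mul (hpos s).le]; congr 1; rw [hq]; ring
    have hle := length_element_le (q := q) (e := ε * η s) (f := f) (X := X s) hq0 hq1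
      ((hεη s).trans (by linarith)) (hX1 s hs) (h.norm_le s hs)
    rw [hsq, Real.sqrt_mul (sq_nonneg _), Real.sqrt_sq (hκ0 s).le, weight_smul (hκ0 s),
      Nat.cast_sub hk, Nat.cast_one, ← add_sub_assoc]
    calc _ = W s * ((1 + ε * η s) ^ q * √(1 + 2 * (f / (1 + ε * η s)) * X s +
          (f / (1 + ε * η s)) ^ 2 * (u s ^ 2 + v s ^ 2))) := by rw [← hκq]; simp only [hW]; ring
      _ ≤ W s * (1 + q * (ε * η s) + f * X s + 3 * (|ε * η s| + |f|) ^ 2) := by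
          gcongr; exact (hW0 s hs).le
      _ = _ := by
          rw [hf, abs_mul, abs_mul ε, ← mul_add, mul_pow, sq_abs, hq]; ring
  have hint : IntegrableOn (fun s => W s + ε * (m⁻¹ * (W s * ((p + k) * η s + deriv η s * X s))) +
        ε ^ 2 * (3 * (W s * (|η s| + |deriv η s / m|) ^ 2))) (Ioo 0 b) :=
    (hWi.add ((hi1.const_mul _).const_mul _)).add ((hi2.const_mul _).const_mul _)
  have h1 : ∫ s in Ioo 0 b, W s ≤ ∫ s in Ioo 0 b,
      (W s + ε * (m⁻¹ * (W s * ((p + k) * η s + deriv η s * X s))) +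
        ε ^ 2 * (3 * (W s * (|η s| + |deriv η s / m|) ^ 2))) := by
    have hnn : 0 ≤ᵐ[volume.restrict (Ioo 0 b)] fun s =>
      (W s + ε * (m⁻¹ * (W s * ((p + k) * η s + deriv η s * X s))) +
        ε ^ 2 * (3 * (W s * (|η s| + |deriv η s / m|) ^ 2))) := by
      filter_upwards [ae_restrict_mem measurableSet_Ioo] with s hs
      refine le_trans ?_ (hbd s hs)
      exact mul_nonneg (weight_nonneg (mul_pos (hκ0 s) (h.v_pos s hs)).le) (Real.sqrt_nonneg _)
    rw [← ENNReal.ofReal_le_ofReal_iff (integral_nonneg_of_ae hnn),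
      ofReal_integral_eq_lintegral_ofReal hWi (by
        filter_upwards [ae_restrict_mem measurableSet_Ioo] with s hs using (hW0 s hs).le),
      ofReal_integral_eq_lintegral_ofReal hint hnn]
    calc _ = ∫⁻ s in Ioo 0 b, ENNReal.ofReal (weight k p (u s) (v s) *
          √(u' s ^ 2 + v' s ^ 2)) := setLIntegral_congr_fun measurableSet_Ioo fun s hs => by
            simp only [h.speed s hs, Real.sqrt_one, mul_one, hW]
      _ ≤ _ := harc
      _ ≤ _ := setLIntegral_mono' measurableSet_Ioo fun s hs => ENNReal.ofReal_le_ofReal (hbd s hs)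
  have hj1 : IntegrableOn (fun s => ε * (m⁻¹ * (W s * ((p + k) * η s + deriv η s * X s))))
    (Ioo 0 b) := (hi1.const_mul _).const_mul _
  have hj2 : IntegrableOn (fun s => ε ^ 2 * (3 * (W s * (|η s| + |deriv η s / m|) ^ 2)))
    (Ioo 0 b) := (hi2.const_mul _).const_mul _
  have hj3 : IntegrableOn (fun s => W s + ε * (m⁻¹ * (W s * ((p + k) * η s + deriv η s * X s))))
    (Ioo 0 b) := hWi.add hj1
  rw [integral_add hj3 hj2, integral_add hWi hj1, integral_const_mul, integral_const_mul,
    integral_const_mul, integral_const_mul] at h1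
  linarith

end FirstVariation

/-! ### The Euler–Lagrange equation -/

theorem continuous_mul_of_tsupport_subset {U : Set ℝ} (hU : IsOpen U) {η f : ℝ → ℝ}
    (hη : Continuous η) (hηU : tsupport η ⊆ U) (hf : ContinuousOn f U) :
    Continuous fun s => η s * f s := by
  refine continuous_iff_continuousAt.2 fun s => ?_
  by_cases hs : s ∈ tsupport η
  · exact hη.continuousAt.mul (hf.continuousAt (hU.mem_nhds (hηU hs)))
  · refine ContinuousAt.congr (f := fun _ => (0 : ℝ)) continuousAt_const ?_
    filter_upwards [(isClosed_tsupport η).isOpen_compl.mem_nhds hs] with t ht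
    rw [image_eq_zero_of_notMem_tsupport ht, zero_mul]

theorem integrable_mul_of_tsupport_subset {U : Set ℝ} (hU : IsOpen U) {η f : ℝ → ℝ}
    (hη : Continuous η) (hηc : HasCompactSupport η) (hηU : tsupport η ⊆ U)
    (hf : ContinuousOn f U) : Integrable fun s => η s * f s :=
  (continuous_mul_of_tsupport_subset hU hη hηU hf).integrable_of_hasCompactSupport hηc.mul_right

theorem setIntegral_mul_of_tsupport_subset {U : Set ℝ} {η f : ℝ → ℝ} (hηU : tsupport η ⊆ U) :
    ∫ s in U, η s * f s = ∫ s, η s * f s :=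
  setIntegral_eq_integral_of_forall_compl_eq_zero fun s hs => by
    rw [image_eq_zero_of_notMem_tsupport fun h => hs (hηU h), zero_mul]

/-- Integration by parts against a compactly supported test function. -/
theorem integral_deriv_mul_of_tsupport_subset {U : Set ℝ} (hU : IsOpen U) {η P P' : ℝ → ℝ}
    (hη : ContDiff ℝ ∞ η) (hηc : HasCompactSupport η) (hηU : tsupport η ⊆ U)
    (hP : ∀ s ∈ U, HasDerivAt P (P' s) s) (hP' : ContinuousOn P' U) :
    ∫ s, deriv η s * P s = - ∫ s, η s * P' s := by
  have hPc : ContinuousOn P U := fun s hs => (hP s hs).continuousAt.continuousWithinAt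
  have hη'U : tsupport (deriv η) ⊆ U := (tsupport_deriv_subset (𝕜 := ℝ)).trans hηU
  have hη'c : Continuous (deriv η) := hη.continuous_deriv (by simp)
  have hi1 := integrable_mul_of_tsupport_subset hU hη'c hηc.deriv hη'U hPc
  have hi2 := integrable_mul_of_tsupport_subset hU hη.continuous hηc hηU hP'
  have hi3 := integrable_mul_of_tsupport_subset hU hη.continuous hηc hηU hPc
  have h0 := integral_eq_zero_of_hasDerivAt_of_integrable (f := fun s => η s * P s)
    (f' := fun s => deriv η s * P s + η s * P' s) (fun s => ?_) (hi1.add hi2) hi3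
  · rw [integral_add hi1 hi2] at h0; linarith
  · by_cases hs : s ∈ tsupport η
    · exact ((hη.differentiable (by simp)).differentiableAt.hasDerivAt).mul (hP s (hηU hs))
    · have hz : (fun t => η t * P t) =ᶠ[𝓝 s] fun _ => 0 := by
        filter_upwards [(isClosed_tsupport η).isOpen_compl.mem_nhds hs] with t ht
        rw [image_eq_zero_of_notMem_tsupport ht, zero_mul]
      have hs' : s ∉ tsupport (deriv η) := fun h => hs (tsupport_deriv_subset (𝕜 := ℝ) h)
      rw [image_eq_zero_of_notMem_tsupport hs, image_eq_zero_of_notMem_tsupport hs']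
      simpa using (hasDerivAt_const s (0 : ℝ)).congr_of_eventuallyEq hz

/-- The Lagrange multiplier rule for two continuous functions, tested against smooth functions of
compact support. -/
theorem exists_multiplier {U : Set ℝ} (hU : IsOpen U) {f g : ℝ → ℝ} (hf : ContinuousOn f U)
    (hg : ContinuousOn g U)
    (h : ∀ η : ℝ → ℝ, ContDiff ℝ ∞ η → HasCompactSupport η → tsupport η ⊆ U →
      ∫ s, η s * f s = 0 → ∫ s, η s * g s = 0) (hf0 : ∃ s ∈ U, f s ≠ 0) :
    ∃ H : ℝ, ∀ s ∈ U, g s = H * f s := by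
  have key : ∀ F : ℝ → ℝ, ContinuousOn F U → (∀ η : ℝ → ℝ, ContDiff ℝ ∞ η →
      HasCompactSupport η → tsupport η ⊆ U → ∫ s, η s * F s = 0) → ∀ s ∈ U, F s = 0 := by
    intro F hF hη
    have hae := hU.ae_eq_zero_of_integral_contDiff_smul_eq_zero (μ := volume)
      (hF.locallyIntegrableOn hU.measurableSet) hη
    exact Measure.eqOn_open_of_ae_eq (μ := volume) (f := F) (g := fun _ => 0)
      ((ae_restrict_iff' hU.measurableSet).2 hae) hU hF continuousOn_const
  obtain ⟨η₀, h1, h2, h3, h4⟩ : ∃ η : ℝ → ℝ, ContDiff ℝ ∞ η ∧ HasCompactSupport η ∧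
      tsupport η ⊆ U ∧ ∫ s, η s * f s ≠ 0 := by
    by_contra! hcon
    obtain ⟨s, hs, hfs⟩ := hf0
    exact hfs (key f hf hcon s hs)
  refine ⟨(∫ s, η₀ s * g s) / ∫ s, η₀ s * f s, fun s hs => ?_⟩
  rw [← sub_eq_zero]
  refine key (fun s => g s - (∫ s, η₀ s * g s) / (∫ s, η₀ s * f s) * f s)
    (hg.sub (continuousOn_const.mul hf)) (fun η e1 e2 e3 => ?_) s hs
  -- Subtracting `c η₀` makes an arbitrary test function satisfy the constraint.
  set c := (∫ s, η s * f s) / ∫ s, η₀ s * f s with hc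
  have i1 := integrable_mul_of_tsupport_subset hU e1.continuous e2 e3 hf
  have i2 := integrable_mul_of_tsupport_subset hU e1.continuous e2 e3 hg
  have i3 := integrable_mul_of_tsupport_subset hU h1.continuous h2 h3 hf
  have i4 := integrable_mul_of_tsupport_subset hU h1.continuous h2 h3 hg
  have hsub : tsupport (fun s => η s - c * η₀ s) ⊆ U := by
    refine (tsupport_sub η fun s => c * η₀ s).trans (union_subset e3 ?_)
    exact (tsupport_mul_subset_right (f := fun _ => c) (g := η₀)).trans h3
  have := h (fun s => η s - c * η₀ s) (e1.sub (contDiff_const.mul h1))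
    (e2.sub (HasCompactSupport.mul_left (f := fun _ => c) h2)) hsub (by
      simp only [sub_mul, mul_assoc]
      rw [integral_sub i1 (i3.const_mul c), integral_const_mul, hc]
      field_simp; ring)
  simp only [sub_mul, mul_assoc] at this
  rw [integral_sub i2 (i4.const_mul c), integral_const_mul, hc] at this
  simp only [mul_sub, mul_left_comm (η _)]
  rw [integral_sub i2 (i1.const_mul _), integral_const_mul]
  rw [← this]; ring

section EulerLagrange

variable {k : ℕ} {p : ℝ} {E : Set (EuclideanSpace ℝ (Fin (k + 1)))} {u v u' v' u'' v'' : ℝ → ℝ}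
  {b τ : ℝ}

/-- The derivatives of a curve parametrized by arclength are orthogonal. -/
theorem IsPolarArc.accel (h : IsPolarArc u v u' v' b)
    (hu'' : ∀ s ∈ Ioo 0 b, HasDerivAt u' (u'' s) s) (hv'' : ∀ s ∈ Ioo 0 b, HasDerivAt v' (v'' s) s)
    {s : ℝ} (hs : s ∈ Ioo 0 b) : u' s * u'' s + v' s * v'' s = 0 := by
  have h1 : HasDerivAt (fun s => u' s ^ 2 + v' s ^ 2) (2 * (u' s * u'' s + v' s * v'' s)) s := by
    refine (((hu'' s hs).pow 2).add ((hv'' s hs).pow 2)).congr_deriv ?_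
    simp; ring
  have h2 : HasDerivAt (fun s => u' s ^ 2 + v' s ^ 2) 0 s := by
    refine (hasDerivAt_const s (1 : ℝ)).congr_of_eventuallyEq ?_
    filter_upwards [isOpen_Ioo.mem_nhds hs] with t ht using h.speed t ht
  linarith [h1.unique h2]

theorem hasDerivAt_weight (hk : 1 ≤ k) {s U' V' : ℝ} (hu : HasDerivAt u U' s)
    (hv : HasDerivAt v V' s) (hv0 : 0 < v s) :
    HasDerivAt (fun s => weight k p (u s) (v s)) (weight k p (u s) (v s) *
      (p * ((u s * U' + v s * V') / (u s ^ 2 + v s ^ 2)) + (k - 1) * (V' / v s))) s := by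
  have hr : 0 < u s ^ 2 + v s ^ 2 := by positivity
  have h1 : HasDerivAt (fun s => √(u s ^ 2 + v s ^ 2))
      ((u s * U' + v s * V') / √(u s ^ 2 + v s ^ 2)) s := by
    refine (((hu.pow 2).add (hv.pow 2)).sqrt hr.ne').congr_deriv ?_
    simp only [Pi.add_apply, Pi.pow_apply]
    field_simp; simp; ring
  have hs0 : 0 < √(u s ^ 2 + v s ^ 2) := Real.sqrt_pos.2 hr
  refine ((h1.rpow_const (p := p) (Or.inl hs0.ne')).mul (hv.pow (k - 1))).congr_deriv ?_
  have h2 : √(u s ^ 2 + v s ^ 2) ^ 2 = u s ^ 2 + v s ^ 2 := Real.sq_sqrt hr.le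
  have h3 : ((k - 1 : ℕ) : ℝ) * v s ^ (k - 1 - 1) = v s ^ (k - 1) * ((k - 1) / v s) := by
    obtain ⟨j, rfl⟩ := Nat.exists_eq_add_of_le' hk
    rcases j with _ | j
    · simp
    · simp [pow_succ]; field_simp
  unfold weight
  rw [Real.rpow_sub_one hs0.ne', h3, Pi.pow_apply]
  generalize √(u s ^ 2 + v s ^ 2) = r at *
  rw [← h2]
  field_simp

/-- The multiplier rule applies after an integration by parts. The expression is the meridian
curvature, plus `k - 1` times the curvature of the parallels, plus the normal derivative of the
logarithm of the density. Unit speed makes the variation divisible by the cross product, which is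
positive. -/
theorem euler_lagrange (hk : 1 ≤ k) (hp : 0 < p) (hE : IsIsoperimetric p E)
    (hfin : weightedPerimeter p E ≠ ⊤) (h : IsPolarArc u v u' v' b)
    (hin : IsInsideArc E u v b τ)
    (hu'' : ∀ s ∈ Ioo 0 b, HasDerivAt u' (u'' s) s) (hv'' : ∀ s ∈ Ioo 0 b, HasDerivAt v' (v'' s) s)
    (hu''c : ContinuousOn u'' (Ioo 0 b)) (hv''c : ContinuousOn v'' (Ioo 0 b)) :
    ∃ H : ℝ, ∀ s ∈ Ioo 0 b, u' s * v'' s - v' s * u'' s + (k - 1) * (-u' s / v s) +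
      p * ((u s * v' s - v s * u' s) / (u s ^ 2 + v s ^ 2)) = H := by
  set W : ℝ → ℝ := fun s => weight k p (u s) (v s) with hW
  set X : ℝ → ℝ := fun s => u s * u' s + v s * v' s with hX
  set Y : ℝ → ℝ := fun s => u s * v' s - v s * u' s with hY
  have hu := fun s hs => (h.hu s hs).hasDerivAt
  have hv := fun s hs => (h.hv s hs).hasDerivAt
  have huc : ContinuousOn u (Ioo 0 b) := fun s hs => (hu s hs).continuousAt.continuousWithinAt
  have hvc : ContinuousOn v (Ioo 0 b) := fun s hs => (hv s hs).continuousAt.continuousWithinAt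
  have hWc : ContinuousOn W (Ioo 0 b) := continuousOn_weight hp h
  have hXc : ContinuousOn X (Ioo 0 b) := continuousOn_radial h
  have hYc : ContinuousOn Y (Ioo 0 b) := continuousOn_cross h
  have hr : ∀ s ∈ Ioo 0 b, 0 < u s ^ 2 + v s ^ 2 := fun s hs => by
    have := h.v_pos s hs; positivity
  have hW0 : ∀ s ∈ Ioo 0 b, 0 < W s := fun s hs => (weight_mul_cross_bounded hp h hs).1
  set P' : ℝ → ℝ := fun s => W s * (p * (X s / (u s ^ 2 + v s ^ 2)) + (k - 1) * (v' s / v s)) * X s +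
    W s * (u' s ^ 2 + v' s ^ 2 + u s * u'' s + v s * v'' s) with hP'
  have hP : ∀ s ∈ Ioo 0 b, HasDerivAt (fun s => W s * X s) (P' s) s := fun s hs => by
    refine ((hasDerivAt_weight hk (hu s hs) (hv s hs) (h.v_pos s hs)).mul
      (((hu s hs).mul (hu'' s hs)).add ((hv s hs).mul (hv'' s hs)))).congr_deriv ?_
    simp only [hP', hW, hX, Pi.add_apply, Pi.mul_apply]; ring
  have hP'c : ContinuousOn P' (Ioo 0 b) := by
    have h1 := h.hu'c
    have h2 := h.hv'c
    have h3 : ContinuousOn (fun s => X s / (u s ^ 2 + v s ^ 2)) (Ioo 0 b) :=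
      hXc.div (by fun_prop) fun s hs => (hr s hs).ne'
    have h4 : ContinuousOn (fun s => v' s / v s) (Ioo 0 b) :=
      h2.div hvc fun s hs => (h.v_pos s hs).ne'
    fun_prop
  have hfg : ∀ η : ℝ → ℝ, ContDiff ℝ ∞ η → HasCompactSupport η → tsupport η ⊆ Ioo 0 b →
      ∫ s, η s * (W s * Y s) = 0 → ∫ s, η s * ((p + k) * W s - P' s) = 0 := by
    intro η h1 h2 h3 h4
    have h5 := first_variation hk hp hE hfin h hin h1 h2 h3 (by
      rw [← setIntegral_mul_of_tsupport_subset h3] at h4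
      refine Eq.trans ?_ h4
      exact integral_congr_ae (Eventually.of_forall fun s => mul_comm _ _))
    have h3' : tsupport (deriv η) ⊆ Ioo 0 b := (tsupport_deriv_subset (𝕜 := ℝ)).trans h3
    have i1 := integrable_mul_of_tsupport_subset isOpen_Ioo h1.continuous h2 h3
      (f := fun s => (p + k) * W s) (continuousOn_const.mul hWc)
    have i2 := integrable_mul_of_tsupport_subset isOpen_Ioo (h1.continuous_deriv (by simp)) h2.deriv
      h3' (f := fun s => W s * X s) (hWc.mul hXc)
    have i3 := integrable_mul_of_tsupport_subset isOpen_Ioo h1.continuous h2 h3 hP'c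
    have h6 : (fun s => weight k p (u s) (v s) *
        ((p + k) * η s + deriv η s * (u s * u' s + v s * v' s))) =
        fun s => η s * ((p + k) * W s) + deriv η s * (W s * X s) := by
      funext s; simp only [hW, hX]; ring
    rw [h6, integral_add i1.integrableOn i2.integrableOn, setIntegral_mul_of_tsupport_subset h3,
      setIntegral_mul_of_tsupport_subset h3',
      integral_deriv_mul_of_tsupport_subset isOpen_Ioo h1 h2 h3 hP hP'c] at h5
    simp only [mul_sub]
    rw [integral_sub i1 i3]; linarith
  obtain ⟨H, hH⟩ := exists_multiplier isOpen_Ioo (hWc.mul hYc)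
    ((continuousOn_const.mul hWc).sub hP'c) hfg
    ⟨b / 2, ⟨by linarith [h.pos], by linarith [h.pos]⟩, by
      have hb : b / 2 ∈ Ioo 0 b := ⟨by linarith [h.pos], by linarith [h.pos]⟩
      exact (mul_pos (hW0 _ hb) (h.cross_pos _ hb)).ne'⟩
  refine ⟨H, fun s hs => ?_⟩
  have e := hH s hs
  have hac := h.accel hu'' hv'' hs
  have hsp := h.speed s hs
  have hv0 := (h.v_pos s hs).ne'
  have hr0 := (hr s hs).ne'
  have hw0 := (hW0 s hs).ne'
  have hy0 := (h.cross_pos s hs).ne'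
  -- Together with `hκY` and `hlam` this rewrites each term of the variation as a constant plus a
  -- multiple of `Y`; the constants cancel.
  have hXY : X s ^ 2 = (u s ^ 2 + v s ^ 2) - Y s ^ 2 := by
    simp only [hX, hY]; linear_combination (u s ^ 2 + v s ^ 2) * hsp
  have hκY : u s * u'' s + v s * v'' s = -((u' s * v'' s - v' s * u'' s) * Y s) := by
    simp only [hY]
    linear_combination -(u s * u'' s + v s * v'' s) * hsp + (u s * u' s + v s * v' s) * hac
  have hlam : 1 - v' s / v s * X s = -u' s / v s * Y s := by
    field_simp; simp only [hX, hY]; linear_combination (-v s) * hsp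
  have e2 : (p + k) - (p * (X s ^ 2 / (u s ^ 2 + v s ^ 2)) + (k - 1) * (v' s / v s * X s) +
      (1 + (u s * u'' s + v s * v'' s))) = H * Y s := by
    refine mul_left_cancel₀ hw0 ?_
    simp only [hP', Pi.mul_apply, Pi.sub_apply] at e
    linear_combination e + W s * hsp
  rw [hXY, hκY, sub_div, div_self hr0] at e2
  refine mul_right_cancel₀ hy0 ?_
  change (_ + p * (Y s / _)) * Y s = H * Y s
  rw [← e2]
  linear_combination -(k - 1 : ℝ) * hlam

end EulerLagrange

/-! ### Curves with constant generalized mean curvature -/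

/-- A planar curve starting vertically at `(1, 0)`, parametrized by arclength, whose distance to
the origin does not increase. -/
structure IsProfile (u v u' v' u'' v'' : ℝ → ℝ) (β : ℝ) : Prop where
  pos : 0 < β
  hu : ∀ s ∈ Ico 0 β, HasDerivAt u (u' s) s
  hv : ∀ s ∈ Ico 0 β, HasDerivAt v (v' s) s
  hu' : ∀ s ∈ Ico 0 β, HasDerivAt u' (u'' s) s
  hv' : ∀ s ∈ Ico 0 β, HasDerivAt v' (v'' s) s
  hu''c : ContinuousOn u'' (Ico 0 β)
  hv''c : ContinuousOn v'' (Ico 0 β)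
  u_zero : u 0 = 1
  v_zero : v 0 = 0
  u'_zero : u' 0 = 0
  v'_zero : v' 0 = 1
  v_pos : ∀ s ∈ Ioo 0 β, 0 < v s
  speed : ∀ s ∈ Ico 0 β, u' s ^ 2 + v' s ^ 2 = 1
  accel : ∀ s ∈ Ico 0 β, u' s * u'' s + v' s * v'' s = 0
  radial : ∀ s ∈ Ico 0 β, u s * u' s + v s * v' s ≤ 0
  norm_le : ∀ s ∈ Ico 0 β, u s ^ 2 + v s ^ 2 ≤ 1

/-- Continuity induction: at the first point where positivity fails, it holds at all earlier points,
so `hstep` applies. -/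
theorem forall_pos_of_bootstrap {F : ℝ → ℝ} {β : ℝ} (hF : ContinuousOn F (Ico 0 β))
    (h0 : 0 < F 0) (hstep : ∀ s ∈ Ioo 0 β, (∀ t ∈ Ico 0 s, 0 < F t) → 0 < F s) :
    ∀ s ∈ Ico 0 β, 0 < F s := by
  by_contra! hcon
  obtain ⟨t, ht, hFt⟩ := hcon
  have hFc : ContinuousOn F (Icc 0 t) := hF.mono fun s hs => ⟨hs.1, hs.2.trans_lt ht.2⟩
  set Z := Icc 0 t ∩ F ⁻¹' Iic 0
  have hZ : IsClosed Z := hFc.preimage_isClosed_of_isClosed isClosed_Icc isClosed_Iic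
  have hZne : Z.Nonempty := ⟨t, ⟨ht.1, le_rfl⟩, hFt⟩
  have hZb : BddBelow Z := ⟨0, fun s hs => hs.1.1⟩
  obtain ⟨⟨h1, h2⟩, h3⟩ := hZ.csInf_mem hZne hZb
  have hpos : 0 < sInf Z := lt_of_le_of_ne h1 fun h => by
    rw [← h] at h3; exact absurd h3 (not_le.2 h0)
  refine absurd h3 (not_le.2 (hstep _ ⟨hpos, h2.trans_lt ht.2⟩ fun s hs => ?_))
  by_contra! hs0
  exact absurd (csInf_le hZb ⟨⟨hs.1, hs.2.le.trans h2⟩, hs0⟩) (not_le.2 hs.2)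

namespace IsProfile

variable {u v u' v' u'' v'' : ℝ → ℝ} {β : ℝ}

theorem normSq_pos (h : IsProfile u v u' v' u'' v'' β) {s : ℝ} (hs : s ∈ Ico 0 β) :
    0 < u s ^ 2 + v s ^ 2 := by
  rcases hs.1.eq_or_lt with h0 | h0
  · rw [← h0, h.u_zero, h.v_zero]; norm_num
  · have := h.v_pos s ⟨h0, hs.2⟩; positivity

theorem continuousOn (h : IsProfile u v u' v' u'' v'' β) :
    ContinuousOn u (Ico 0 β) ∧ ContinuousOn v (Ico 0 β) ∧ ContinuousOn u' (Ico 0 β) ∧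
      ContinuousOn v' (Ico 0 β) :=
  ⟨fun s hs => (h.hu s hs).continuousAt.continuousWithinAt,
    fun s hs => (h.hv s hs).continuousAt.continuousWithinAt,
    fun s hs => (h.hu' s hs).continuousAt.continuousWithinAt,
    fun s hs => (h.hv' s hs).continuousAt.continuousWithinAt⟩

theorem u''_eq (h : IsProfile u v u' v' u'' v'' β) {s : ℝ} (hs : s ∈ Ico 0 β) :
    u'' s = -((u' s * v'' s - v' s * u'' s) * v' s) := by
  linear_combination -(u'' s) * h.speed s hs + u' s * h.accel s hs

theorem v''_eq (h : IsProfile u v u' v' u'' v'' β) {s : ℝ} (hs : s ∈ Ico 0 β) :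
    v'' s = (u' s * v'' s - v' s * u'' s) * u' s := by
  linear_combination -(v'' s) * h.speed s hs + v' s * h.accel s hs

theorem radial_sq_add_cross_sq (h : IsProfile u v u' v' u'' v'' β) {s : ℝ} (hs : s ∈ Ico 0 β) :
    (u s * u' s + v s * v' s) ^ 2 + (u s * v' s - v s * u' s) ^ 2 = u s ^ 2 + v s ^ 2 := by
  linear_combination (u s ^ 2 + v s ^ 2) * h.speed s hs

theorem hasDerivAt_cross (h : IsProfile u v u' v' u'' v'' β) {s : ℝ} (hs : s ∈ Ico 0 β) :
    HasDerivAt (fun s => u s * v' s - v s * u' s)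
      ((u' s * v'' s - v' s * u'' s) * (u s * u' s + v s * v' s)) s := by
  refine (((h.hu s hs).mul (h.hv' s hs)).sub ((h.hv s hs).mul (h.hu' s hs))).congr_deriv ?_
  linear_combination (u s) * h.v''_eq hs - v s * h.u''_eq hs

theorem hasDerivAt_radial (h : IsProfile u v u' v' u'' v'' β) {s : ℝ} (hs : s ∈ Ico 0 β) :
    HasDerivAt (fun s => u s * u' s + v s * v' s)
      (1 - (u' s * v'' s - v' s * u'' s) * (u s * v' s - v s * u' s)) s := by
  refine (((h.hu s hs).mul (h.hu' s hs)).add ((h.hv s hs).mul (h.hv' s hs))).congr_deriv ?_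
  linear_combination (u s) * h.u''_eq hs + v s * h.v''_eq hs + h.speed s hs

theorem hasDerivAt_normSq (h : IsProfile u v u' v' u'' v'' β) {s : ℝ} (hs : s ∈ Ico 0 β) :
    HasDerivAt (fun s => u s ^ 2 + v s ^ 2) (2 * (u s * u' s + v s * v' s)) s := by
  refine (((h.hu s hs).pow 2).add ((h.hv s hs).pow 2)).congr_deriv ?_
  simp; ring

/-- The derivative of the angular speed. -/
theorem hasDerivAt_angularSpeed (h : IsProfile u v u' v' u'' v'' β) {s : ℝ} (hs : s ∈ Ico 0 β) :
    HasDerivAt (fun s => (u s * v' s - v s * u' s) / (u s ^ 2 + v s ^ 2))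
      (-(u s * u' s + v s * v' s) / (u s ^ 2 + v s ^ 2) *
        (2 * ((u s * v' s - v s * u' s) / (u s ^ 2 + v s ^ 2)) -
          (u' s * v'' s - v' s * u'' s))) s := by
  have hr := (h.normSq_pos hs).ne'
  refine ((h.hasDerivAt_cross hs).div (h.hasDerivAt_normSq hs) hr).congr_deriv ?_
  field_simp; ring

/-- The derivative of the difference between the polar angle and the angle between the normal and
the position vector. -/
theorem hasDerivAt_angle (h : IsProfile u v u' v' u'' v'' β) {s : ℝ} (hs : s ∈ Ioo 0 β)
    (hY : 0 < u s * v' s - v s * u' s) :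
    HasDerivAt (fun s => Real.pi / 2 - Real.arctan (u s / v s) +
        Real.arctan ((u s * u' s + v s * v' s) / (u s * v' s - v s * u' s)))
      (2 * ((u s * v' s - v s * u' s) / (u s ^ 2 + v s ^ 2)) -
          (u' s * v'' s - v' s * u'' s)) s := by
  have hs' : s ∈ Ico 0 β := ⟨hs.1.le, hs.2⟩
  have hv := h.v_pos s hs
  have hr := h.normSq_pos hs'
  have h1 := ((h.hu s hs').div (h.hv s hs') hv.ne').arctan
  have h2 := ((h.hasDerivAt_radial hs').div (h.hasDerivAt_cross hs') hY.ne').arctan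
  refine (((hasDerivAt_const s (Real.pi / 2)).sub h1).add h2).congr_deriv ?_
  have hXY := h.radial_sq_add_cross_sq hs'
  set X := u s * u' s + v s * v' s with hX
  set Y := u s * v' s - v s * u' s with hY'
  set κ := u' s * v'' s - v' s * u'' s with hκ
  have e1 : 1 / (1 + (u s / v s) ^ 2) * ((u' s * v s - u s * v' s) / v s ^ 2) =
      -(Y / (u s ^ 2 + v s ^ 2)) := by
    have : 1 + (u s / v s) ^ 2 = (u s ^ 2 + v s ^ 2) / v s ^ 2 := by field_simp; ring
    rw [this, hY']; field_simp; ring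
  have e2 : 1 / (1 + (X / Y) ^ 2) * (((1 - κ * Y) * Y - X * (κ * X)) / Y ^ 2) =
      Y / (u s ^ 2 + v s ^ 2) - κ := by
    have : 1 + (X / Y) ^ 2 = (u s ^ 2 + v s ^ 2) / Y ^ 2 := by rw [← hXY]; field_simp; ring
    rw [this]; field_simp; linear_combination (-κ) * hXY
  rw [Pi.div_apply, Pi.div_apply]
  rw [e1, e2]; ring

theorem tendsto_angle (h : IsProfile u v u' v' u'' v'' β) :
    Tendsto (fun s => Real.pi / 2 - Real.arctan (u s / v s) +
        Real.arctan ((u s * u' s + v s * v' s) / (u s * v' s - v s * u' s))) (𝓝[>] 0) (𝓝 0) := by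
  have h0 : (0 : ℝ) ∈ Ico 0 β := ⟨le_rfl, h.pos⟩
  have hv : Tendsto v (𝓝[>] 0) (𝓝[>] 0) := by
    refine tendsto_nhdsWithin_iff.2 ⟨?_, ?_⟩
    · have := (h.hv 0 h0).continuousAt.tendsto
      rw [h.v_zero] at this
      exact this.mono_left nhdsWithin_le_nhds
    · filter_upwards [Ioo_mem_nhdsGT h.pos] with s hs using h.v_pos s hs
  have hu : Tendsto u (𝓝[>] 0) (𝓝 1) := by
    have := (h.hu 0 h0).continuousAt.tendsto
    rw [h.u_zero] at this
    exact this.mono_left nhdsWithin_le_nhds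
  have h1 : Tendsto (fun s => Real.arctan (u s / v s)) (𝓝[>] 0) (𝓝 (Real.pi / 2)) := by
    refine (tendsto_nhds_of_tendsto_nhdsWithin Real.tendsto_arctan_atTop).comp ?_
    simp only [div_eq_mul_inv]
    exact hu.pos_mul_atTop one_pos (tendsto_inv_nhdsGT_zero.comp hv)
  have h2 : Tendsto (fun s => (u s * u' s + v s * v' s) / (u s * v' s - v s * u' s)) (𝓝[>] 0)
      (𝓝 0) := by
    have hX := (h.hasDerivAt_radial h0).continuousAt
    have hY := (h.hasDerivAt_cross h0).continuousAt
    have := (hX.div hY (by simp [h.u_zero, h.v_zero, h.v'_zero])).tendsto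
    simp only [Pi.div_apply, h.u_zero, h.v_zero, h.u'_zero, h.v'_zero] at this
    norm_num at this
    exact this.mono_left nhdsWithin_le_nhds
  have h3 := (Real.continuous_arctan.tendsto 0).comp h2
  rw [Real.arctan_zero] at h3
  have := (h1.const_sub (Real.pi / 2)).add h3
  simpa using this

end IsProfile

namespace IsProfile

variable {u v u' v' u'' v'' : ℝ → ℝ} {β : ℝ} {k : ℕ} {p : ℝ}

/-- The Euler–Lagrange equation holds along the curve as long as the polar angle increases. -/
def IsCritical (k : ℕ) (p : ℝ) (u v u' v' u'' v'' : ℝ → ℝ) (β : ℝ) : Prop :=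
  ∀ b ∈ Ioo 0 β, (∀ s ∈ Icc 0 b, 0 < u s * v' s - v s * u' s) →
    ∃ H : ℝ, ∀ s ∈ Ioo 0 b, u' s * v'' s - v' s * u'' s + (k - 1) * (-u' s / v s) +
      p * ((u s * v' s - v s * u' s) / (u s ^ 2 + v s ^ 2)) = H

/-- The constant provided by `IsCritical` may depend on `b`. A vanishing derivative is local and
does not refer to it. -/
theorem hasDerivAt_meanCurvature (hc : IsCritical k p u v u' v' u'' v'' β) {s₁ : ℝ}
    (hs₁ : s₁ ∈ Ioo 0 β) (hY : ∀ t ∈ Ico 0 s₁, 0 < u t * v' t - v t * u' t) {s : ℝ}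
    (hs : s ∈ Ioo 0 s₁) :
    HasDerivAt (fun s => u' s * v'' s - v' s * u'' s + (k - 1) * (-u' s / v s) +
      p * ((u s * v' s - v s * u' s) / (u s ^ 2 + v s ^ 2))) 0 s := by
  have hb : s < (s + s₁) / 2 := by linarith [hs.2]
  have hb' : (s + s₁) / 2 < s₁ := by linarith [hs.2]
  obtain ⟨H, hH⟩ := hc ((s + s₁) / 2) ⟨hs.1.trans hb, hb'.trans hs₁.2⟩
    fun t ht => hY t ⟨ht.1, ht.2.trans_lt hb'⟩
  refine (hasDerivAt_const s H).congr_of_eventuallyEq ?_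
  filter_upwards [isOpen_Ioo.mem_nhds (show s ∈ Ioo 0 ((s + s₁) / 2) from ⟨hs.1, hb⟩)] with t ht
  exact hH t ht

/-- The difference of the principal curvatures, multiplied by a power of the distance to the
axis. -/
def momentum (k : ℕ) (v u' v' u'' v'' : ℝ → ℝ) (s : ℝ) : ℝ :=
  -u' s * v s ^ (k - 1) - (u' s * v'' s - v' s * u'' s) * v s ^ k

theorem continuousOn_momentum (h : IsProfile u v u' v' u'' v'' β) :
    ContinuousOn (momentum k v u' v' u'' v'') (Ico 0 β) := by
  obtain ⟨h1, h2, h3, h4⟩ := h.continuousOn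
  have h5 := h.hu''c
  have h6 := h.hv''c
  unfold momentum
  fun_prop

theorem momentum_zero (h : IsProfile u v u' v' u'' v'' β) (hk : 2 ≤ k) :
    momentum k v u' v' u'' v'' 0 = 0 := by
  unfold momentum
  rw [h.v_zero, zero_pow (by omega), zero_pow (by omega)]; ring

theorem momentum_eq (hk : 1 ≤ k) {s : ℝ} (hv : 0 < v s) :
    momentum k v u' v' u'' v'' s = (-u' s / v s - (u' s * v'' s - v' s * u'' s)) * v s ^ k := by
  obtain ⟨j, rfl⟩ := Nat.exists_eq_add_of_le' hk
  simp only [momentum, Nat.add_sub_cancel, pow_succ]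
  field_simp

/-- Write `Q` for the generalized mean curvature, `λ = -u'/v`, `κ` for the meridian curvature and
`h` for the angular speed. Then `λ - κ = kλ + ph - Q`, where `Q' = 0` and `λ' = (v'/v)(κ - λ)`. Thus
`v^k` is an integrating factor and leaves `p v^k h'`. -/
theorem hasDerivAt_momentum (h : IsProfile u v u' v' u'' v'' β) (hk : 1 ≤ k)
    (hc : IsCritical k p u v u' v' u'' v'' β) {s₁ : ℝ}
    (hs₁ : s₁ ∈ Ioo 0 β) (hY : ∀ t ∈ Ico 0 s₁, 0 < u t * v' t - v t * u' t) {s : ℝ}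
    (hs : s ∈ Ioo 0 s₁) :
    HasDerivAt (momentum k v u' v' u'' v'') (p * v s ^ k *
      (-(u s * u' s + v s * v' s) / (u s ^ 2 + v s ^ 2) *
        (2 * ((u s * v' s - v s * u' s) / (u s ^ 2 + v s ^ 2)) -
          (u' s * v'' s - v' s * u'' s)))) s := by
  have hs' : s ∈ Ico 0 β := ⟨hs.1.le, hs.2.trans hs₁.2⟩
  have hv := h.v_pos s ⟨hs.1, hs'.2⟩
  have hQ := hasDerivAt_meanCurvature hc hs₁ hY hs
  have hh := h.hasDerivAt_angularSpeed hs'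
  have hlam : HasDerivAt (fun s => -u' s / v s)
      (v' s / v s * ((u' s * v'' s - v' s * u'' s) - -u' s / v s)) s := by
    refine ((h.hu' s hs').neg.div (h.hv s hs') hv.ne').congr_deriv ?_
    simp only [Pi.neg_apply]
    field_simp
    linear_combination (-v s) * h.u''_eq hs'
  have hpw := (h.hv s hs').pow k
  have := hpw.mul (((hlam.const_mul (k : ℝ)).add (hh.const_mul p)).sub hQ)
  refine (this.congr_deriv ?_).congr_of_eventuallyEq ?_
  · have hkp : (k : ℝ) * v s ^ (k - 1) = v s ^ k * (k / v s) := by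
      obtain ⟨j, rfl⟩ := Nat.exists_eq_add_of_le' hk
      simp only [Nat.add_sub_cancel, pow_succ]; field_simp
    rw [hkp]; simp only [Pi.add_apply, Pi.sub_apply, Pi.pow_apply]; ring
  · filter_upwards [isOpen_Ioo.mem_nhds (show s ∈ Ioo 0 β from ⟨hs.1, hs'.2⟩)] with t ht
    rw [momentum_eq hk (h.v_pos t ht)]
    simp only [Pi.add_apply, Pi.sub_apply, Pi.pow_apply, Pi.mul_apply]; ring

/-- The principal curvature along the parallels is dominated by twice the angular speed. -/
theorem two_mul_angularSpeed_sub (h : IsProfile u v u' v' u'' v'' β) {s : ℝ} (hs : s ∈ Ioo 0 β) :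
    2 * ((u s * v' s - v s * u' s) / (u s ^ 2 + v s ^ 2)) - -u' s / v s =
      (v s * (u s * v' s - v s * u' s) + u s * (u s * u' s + v s * v' s)) /
        ((u s ^ 2 + v s ^ 2) * v s) := by
  have hv := h.v_pos s hs
  have hr := h.normSq_pos ⟨hs.1.le, hs.2⟩
  field_simp; ring

/-- The bootstrap step. While `D > 0`, the radial condition makes the angular speed and the momentum
nondecreasing, and the angle, whose derivative is `D`, increases from `0`. Its positivity at `s` is
equivalent, where `u > 0`, to the last inequality. -/
theorem good_of_forall_lt (h : IsProfile u v u' v' u'' v'' β) (hk : 2 ≤ k) (hp : 0 < p)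
    (hc : IsCritical k p u v u' v' u'' v'' β) {s : ℝ} (hs : s ∈ Ioo 0 β)
    (hY : ∀ t ∈ Ico 0 s, 0 < u t * v' t - v t * u' t)
    (hD : ∀ t ∈ Ico 0 s, 0 < 2 * ((u t * v' t - v t * u' t) / (u t ^ 2 + v t ^ 2)) -
      (u' t * v'' t - v' t * u'' t)) :
    0 < u s * v' s - v s * u' s ∧ 0 ≤ momentum k v u' v' u'' v'' s ∧
      MonotoneOn (momentum k v u' v' u'' v'') (Icc 0 s) ∧
      0 < 2 * ((u s * v' s - v s * u' s) / (u s ^ 2 + v s ^ 2)) - -u' s / v s := by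
  have hI : ∀ t ∈ Icc 0 s, t ∈ Ico 0 β := fun t ht => ⟨ht.1, ht.2.trans_lt hs.2⟩
  have hs0 : s ∈ Icc 0 s := ⟨hs.1.le, le_rfl⟩
  have h00 : (0 : ℝ) ∈ Icc 0 s := ⟨le_rfl, hs.1.le⟩
  have hr := h.normSq_pos (hI s hs0)
  have hv := h.v_pos s hs
  have hX0 : ∀ t ∈ Icc 0 s, 0 ≤ -(u t * u' t + v t * v' t) / (u t ^ 2 + v t ^ 2) := fun t ht =>
    div_nonneg (by linarith [h.radial t (hI t ht)]) (h.normSq_pos (hI t ht)).le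
  have hmono : MonotoneOn (fun s => (u s * v' s - v s * u' s) / (u s ^ 2 + v s ^ 2))
      (Icc 0 s) := by
    refine monotoneOn_of_hasDerivWithinAt_nonneg (convex_Icc 0 s)
      (fun t ht => (h.hasDerivAt_angularSpeed (hI t ht)).continuousAt.continuousWithinAt)
      (fun t ht => (h.hasDerivAt_angularSpeed
        (hI t (interior_subset ht))).hasDerivWithinAt) fun t ht => ?_
    have ht' := interior_subset ht
    rw [interior_Icc] at ht
    exact mul_nonneg (hX0 t ht') (hD t ⟨ht'.1, ht.2⟩).le
  have hMm : MonotoneOn (momentum k v u' v' u'' v'') (Icc 0 s) := by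
    refine monotoneOn_of_hasDerivWithinAt_nonneg (convex_Icc 0 s)
      (h.continuousOn_momentum.mono hI)
      (fun t ht => (h.hasDerivAt_momentum (by omega) hc hs hY
        (by rwa [interior_Icc] at ht)).hasDerivWithinAt) fun t ht => ?_
    have ht' := interior_subset ht
    rw [interior_Icc] at ht
    have := (h.v_pos t ⟨ht.1, ht.2.trans hs.2⟩).le
    exact mul_nonneg (by positivity) (mul_nonneg (hX0 t ht') (hD t ⟨ht'.1, ht.2⟩).le)
  -- The angular speed equals `1` at the start and does not decrease, so the cross product is at
  -- least `u² + v²`.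
  have hY' : 0 < u s * v' s - v s * u' s := by
    have h1 := hmono h00 hs0 hs.1.le
    simp only [h.u_zero, h.v_zero, h.v'_zero] at h1
    norm_num at h1
    rw [le_div_iff₀ hr] at h1
    linarith
  refine ⟨hY', ?_, hMm, ?_⟩
  · rw [← h.momentum_zero hk]
    exact hMm h00 hs0 hs.1.le
  have hYc : ∀ t ∈ Ioc 0 s, 0 < u t * v' t - v t * u' t := fun t ht => by
    rcases ht.2.eq_or_lt with e | e
    · rwa [e]
    · exact hY t ⟨ht.1.le, e⟩
  have hδ : StrictMonoOn (fun s => Real.pi / 2 - Real.arctan (u s / v s) +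
        Real.arctan ((u s * u' s + v s * v' s) / (u s * v' s - v s * u' s))) (Ioc 0 s) := by
    refine strictMonoOn_of_hasDerivWithinAt_pos (convex_Ioc 0 s)
      (fun t ht => (h.hasDerivAt_angle ⟨ht.1, ht.2.trans_lt hs.2⟩
        (hYc t ht)).continuousAt.continuousWithinAt)
      (fun t ht => (h.hasDerivAt_angle ⟨(interior_subset ht).1,
        (interior_subset ht).2.trans_lt hs.2⟩
        (hYc t (interior_subset ht))).hasDerivWithinAt) fun t ht => ?_
    rw [interior_Ioc] at ht
    exact hD t ⟨ht.1.le, ht.2⟩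
  have hδ0 : 0 < Real.pi / 2 - Real.arctan (u s / v s) +
        Real.arctan ((u s * u' s + v s * v' s) / (u s * v' s - v s * u' s)) := by
    have h2 : s / 2 ∈ Ioc 0 s := ⟨by linarith [hs.1], by linarith [hs.1]⟩
    refine lt_of_le_of_lt ?_ (hδ h2 ⟨hs.1, le_rfl⟩ (by linarith [hs.1]))
    refine le_of_tendsto h.tendsto_angle ?_
    filter_upwards [Ioo_mem_nhdsGT h2.1] with t ht
    exact hδ.monotoneOn ⟨ht.1, ht.2.le.trans h2.2⟩ h2 ht.2.le
  rw [h.two_mul_angularSpeed_sub hs]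
  refine div_pos ?_ (by positivity)
  have hX := h.radial s (hI s hs0)
  -- For `u ≤ 0` the numerator is the sum of a positive and a nonnegative term. For `u > 0` the
  -- positive angle means `-X / Y < v / u`, by monotonicity of the arctangent.
  rcases le_or_gt (u s) 0 with hu | hu
  · nlinarith [mul_pos hv hY', mul_nonneg_of_nonpos_of_nonpos hu hX]
  · have h1 : Real.arctan (-(u s * u' s + v s * v' s) / (u s * v' s - v s * u' s)) <
        Real.arctan (v s / u s) := by
      have h3 := Real.arctan_inv_of_pos (div_pos hu hv)
      rw [inv_div] at h3
      rw [h3, neg_div, Real.arctan_neg]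
      linarith
    have h2 := Real.arctan_strictMono.lt_iff_lt.1 h1
    rw [div_lt_div_iff₀ hY' hu] at h2
    linarith

/-- A critical profile of initial curvature less than `2` whose distance to the origin does not
increase and which returns to the axis lies on the unit circle. -/
theorem normSq_eq_one (h : IsProfile u v u' v' u'' v'' β) (hk : 2 ≤ k) (hp : 0 < p)
    (hc : IsCritical k p u v u' v' u'' v'' β) (h0 : -2 < u'' 0)
    (hend : Tendsto v (𝓝[<] β) (𝓝 0)) :
    ∀ s ∈ Ico 0 β, u s ^ 2 + v s ^ 2 = 1 ∧ 0 < u s * v' s - v s * u' s := by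
  obtain ⟨huc, hvc, hu'c, hv'c⟩ := h.continuousOn
  have hu''c := h.hu''c
  have hv''c := h.hv''c
  have h00 : (0 : ℝ) ∈ Ico 0 β := ⟨le_rfl, h.pos⟩
  set Y : ℝ → ℝ := fun s => u s * v' s - v s * u' s with hYdef
  set D : ℝ → ℝ := fun s => 2 * ((u s * v' s - v s * u' s) / (u s ^ 2 + v s ^ 2)) -
      (u' s * v'' s - v' s * u'' s) with hDdef
  have hYc : ContinuousOn Y (Ico 0 β) := by fun_prop
  have hDc : ContinuousOn D (Ico 0 β) := by
    have : ContinuousOn (fun s => (u s * v' s - v s * u' s) / (u s ^ 2 + v s ^ 2)) (Ico 0 β) :=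
      hYc.div (by fun_prop) fun s hs => (h.normSq_pos hs).ne'
    fun_prop
  -- The splitting `D = (2h - λ) + (λ - κ)`, the second summand being the momentum divided by `v^k`.
  have hDs : ∀ s ∈ Ioo 0 β, D s = (2 * ((u s * v' s - v s * u' s) / (u s ^ 2 + v s ^ 2)) -
      -u' s / v s) + momentum k v u' v' u'' v'' s / v s ^ k := fun s hs => by
    have hv := h.v_pos s hs
    rw [momentum_eq (by omega) hv, mul_div_assoc, div_self (pow_pos hv k).ne']
    simp only [hDdef]; ring
  have hpos := forall_pos_of_bootstrap (F := fun s => min (Y s) (D s)) (hYc.inf hDc)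
    (by
      simp only [hYdef, hDdef, h.u_zero, h.v_zero, h.u'_zero, h.v'_zero, lt_min_iff]
      constructor <;> norm_num; linarith)
    fun s hs hlt => by
      have hg := h.good_of_forall_lt hk hp hc hs (fun t ht => (lt_min_iff.1 (hlt t ht)).1)
        fun t ht => (lt_min_iff.1 (hlt t ht)).2
      refine lt_min hg.1 ?_
      rw [hDs s hs]
      exact add_pos_of_pos_of_nonneg hg.2.2.2 (div_nonneg hg.2.1 (pow_pos (h.v_pos s hs) k).le)
  have hYpos : ∀ s ∈ Ico 0 β, 0 < Y s := fun s hs => (lt_min_iff.1 (hpos s hs)).1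
  have hDpos : ∀ s ∈ Ico 0 β, 0 < D s := fun s hs => (lt_min_iff.1 (hpos s hs)).2
  have hgood := fun s (hs : s ∈ Ioo 0 β) => h.good_of_forall_lt hk hp hc hs
    (fun t ht => hYpos t ⟨ht.1, ht.2.trans hs.2⟩) fun t ht => hDpos t ⟨ht.1, ht.2.trans hs.2⟩
  -- the distance to the origin is constant
  have hX : ∀ s ∈ Ioo 0 β, u s * u' s + v s * v' s = 0 := by
    by_contra! hcon
    obtain ⟨s₀, hs₀, hX₀⟩ := hcon
    -- If the momentum vanished identically, its derivative at `s₀` would be zero; but each factor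
    -- of that derivative is positive where the distance strictly decreases.
    obtain ⟨s₂, hs₂, hM₂⟩ : ∃ s₂ ∈ Ioo 0 β, momentum k v u' v' u'' v'' s₂ ≠ 0 := by
      by_contra! hM
      have hs₁ : (s₀ + β) / 2 ∈ Ioo 0 β := ⟨by linarith [hs₀.1, hs₀.2], by linarith [hs₀.2]⟩
      have hd := h.hasDerivAt_momentum (by omega) hc hs₁
        (fun t ht => hYpos t ⟨ht.1, ht.2.trans hs₁.2⟩)
        (show s₀ ∈ Ioo 0 ((s₀ + β) / 2) from ⟨hs₀.1, by linarith [hs₀.2]⟩)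
      have hd0 : HasDerivAt (momentum k v u' v' u'' v'') 0 s₀ := by
        refine (hasDerivAt_const s₀ (0 : ℝ)).congr_of_eventuallyEq ?_
        filter_upwards [isOpen_Ioo.mem_nhds hs₀] with t ht using hM t ht
      have he := hd.unique hd0
      have hs₀' : s₀ ∈ Ico 0 β := ⟨hs₀.1.le, hs₀.2⟩
      have h1 := pow_pos (h.v_pos s₀ hs₀) k
      have h2 := hDpos s₀ hs₀'
      have h3 : 0 < -(u s₀ * u' s₀ + v s₀ * v' s₀) / (u s₀ ^ 2 + v s₀ ^ 2) :=
        div_pos (by have := lt_of_le_of_ne (h.radial s₀ hs₀') hX₀; linarith) (h.normSq_pos hs₀')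
      exact absurd he (mul_pos (mul_pos hp h1) (mul_pos h3 h2)).ne'
    set m₀ := momentum k v u' v' u'' v'' s₂ with hm₀
    have hm₀pos : 0 < m₀ := lt_of_le_of_ne (hgood s₂ hs₂).2.1 hM₂.symm
    -- From `s₂` on the momentum is at least `m₀`. Since `v ≤ 1` and `v' ≥ -1`, this gives `D ≥ m₀ /
    -- v ≥ -m₀ v'/v`, so `g` is nondecreasing.
    set g : ℝ → ℝ := fun s => (Real.pi / 2 - Real.arctan (u s / v s) +
        Real.arctan ((u s * u' s + v s * v' s) / (u s * v' s - v s * u' s))) +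
        m₀ * Real.log (v s) with hg
    have hgd : ∀ s ∈ Ico s₂ β, HasDerivAt g (D s + m₀ * (v' s / v s)) s := fun s hs => by
      have hs' : s ∈ Ioo 0 β := ⟨hs₂.1.trans_le hs.1, hs.2⟩
      exact (h.hasDerivAt_angle hs' (hYpos s ⟨hs'.1.le, hs'.2⟩)).add
        (((h.hv s ⟨hs'.1.le, hs'.2⟩).log (h.v_pos s hs').ne').const_mul m₀)
    have hgm : MonotoneOn g (Ico s₂ β) := by
      refine monotoneOn_of_hasDerivWithinAt_nonneg (convex_Ico s₂ β)
        (fun s hs => (hgd s hs).continuousAt.continuousWithinAt)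
        (fun s hs => (hgd s (interior_subset hs)).hasDerivWithinAt) fun s hs => ?_
      have hs1 := interior_subset hs
      have hs' : s ∈ Ioo 0 β := ⟨hs₂.1.trans_le hs1.1, hs1.2⟩
      have hs'' : s ∈ Ico 0 β := ⟨hs'.1.le, hs'.2⟩
      have hv := h.v_pos s hs'
      have hv1 : v s ≤ 1 := by nlinarith [h.norm_le s hs'', sq_nonneg (u s)]
      have hm : m₀ ≤ momentum k v u' v' u'' v'' s :=
        (hgood s hs').2.2.1 ⟨hs₂.1.le, hs1.1⟩ ⟨hs'.1.le, le_rfl⟩ hs1.1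
      have h1 : m₀ / v s ≤ momentum k v u' v' u'' v'' s / v s ^ k := by
        refine div_le_div₀ (hm₀pos.le.trans hm) hm (pow_pos hv k) ?_
        exact pow_le_of_le_one hv.le hv1 (by omega)
      have h2 : -(m₀ / v s) ≤ m₀ * (v' s / v s) := by
        rw [← mul_div_assoc, ← neg_div]
        refine div_le_div_of_nonneg_right ?_ hv.le
        have : -1 ≤ v' s := by nlinarith [h.speed s hs'', sq_nonneg (u' s)]
        nlinarith
      rw [hDs s hs']
      linarith [(hgood s hs').2.2.2]
    have hlog : Tendsto (fun s => Real.log (v s)) (𝓝[<] β) atBot := by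
      refine Real.tendsto_log_nhdsGT_zero.comp (tendsto_nhdsWithin_iff.2 ⟨hend, ?_⟩)
      filter_upwards [Ioo_mem_nhdsLT h.pos] with s hs using h.v_pos s hs
    -- The angle is always below `3π/2`, so `2π` is enough to force `g s < g s₂`.
    have hev := hlog.eventually_lt_atBot ((g s₂ - 2 * Real.pi) / m₀)
    obtain ⟨s, hs1, hs2⟩ := (hev.and (Ico_mem_nhdsLT hs₂.2)).exists
    have h1 := hgm ⟨le_rfl, hs₂.2⟩ hs2 hs2.1
    rw [lt_div_iff₀ hm₀pos] at hs1
    have h2 := Real.neg_pi_div_two_lt_arctan (u s / v s)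
    have h3 := Real.arctan_lt_pi_div_two
      ((u s * u' s + v s * v' s) / (u s * v' s - v s * u' s))
    have h4 : g s = (Real.pi / 2 - Real.arctan (u s / v s) +
        Real.arctan ((u s * u' s + v s * v' s) / (u s * v' s - v s * u' s))) +
        m₀ * Real.log (v s) := rfl
    nlinarith [Real.pi_pos]
  intro s hs
  refine ⟨?_, hYpos s hs⟩
  rcases hs.1.eq_or_lt with e | e
  · rw [← e, h.u_zero, h.v_zero]; norm_num
  have hI : ∀ t ∈ Icc 0 s, t ∈ Ico 0 β := fun t ht => ⟨ht.1, ht.2.trans_lt hs.2⟩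
  have hconst := constant_of_has_deriv_right_zero (f := fun s => u s ^ 2 + v s ^ 2) (a := 0)
    (b := s) (fun t ht => (h.hasDerivAt_normSq (hI t ht)).continuousAt.continuousWithinAt)
    (fun t ht => by
      have ht' := hI t ⟨ht.1, ht.2.le⟩
      have h1 := (h.hasDerivAt_normSq ht').hasDerivWithinAt (s := Ici t)
      have h2 : u t * u' t + v t * v' t = 0 := by
        rcases ht.1.eq_or_lt with e0 | e0
        · rw [← e0, h.u'_zero, h.v_zero]; ring
        · exact hX t ⟨e0, ht'.2⟩
      rwa [h2, mul_zero] at h1) s ⟨hs.1, le_rfl⟩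
  simp only [h.u_zero, h.v_zero] at hconst
  rw [hconst]; norm_num

end IsProfile

/-! ### Second variation of balls about the origin -/

/-- Expand `exp (q log (1 + e))`. The quadratic coefficient must be exact for the second variation;
the constant in the cubic remainder is only a convenient bound. -/
theorem one_add_rpow_le {q e : ℝ} (hq0 : 0 ≤ q) (hq1 : q ≤ 1) (he : |e| ≤ 1 / 2) :
    (1 + e) ^ q ≤ 1 + q * e - q * (1 - q) / 2 * e ^ 2 + 13 * |e| ^ 3 := by
  obtain ⟨he1, he2⟩ := abs_le.1 he
  have h1e : 0 < 1 + e := by linarith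
  have ha := abs_nonneg e
  have hsq : e ^ 2 = |e| ^ 2 := (sq_abs e).symm
  have hlog : Real.log (1 + e) ≤ e - e ^ 2 / 2 + 2 * |e| ^ 3 := by
    have h := Real.abs_log_sub_add_sum_range_le (x := -e) (by rw [abs_neg]; linarith) 2
    simp only [Finset.sum_range_succ, Finset.sum_range_zero, abs_neg, sub_neg_eq_add] at h
    norm_num at h
    have h3 : |e| ^ 3 / (1 - |e|) ≤ 2 * |e| ^ 3 := by
      rw [div_le_iff₀ (by linarith)]; nlinarith [pow_nonneg ha 3]
    have := (abs_le.1 h).2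
    linarith
  set w := q * (-e ^ 2 / 2 + 2 * |e| ^ 3) with hw
  have hwabs : |w| ≤ 3 / 2 * |e| ^ 2 := by
    rw [hw, abs_mul, abs_of_nonneg hq0]
    have h1 : |(-e ^ 2 / 2 + 2 * |e| ^ 3)| ≤ 3 / 2 * |e| ^ 2 := by
      rw [hsq, abs_le]; constructor <;> nlinarith [pow_nonneg ha 3, sq_nonneg |e|]
    calc q * _ ≤ 1 * (3 / 2 * |e| ^ 2) := by gcongr
      _ = _ := one_mul _
  set z := q * e + w with hz
  have hz1 : |z| ≤ 2 * |e| := by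
    refine (abs_add_le _ _).trans ?_
    rw [abs_mul, abs_of_nonneg hq0]
    nlinarith
  have hz2 : z ^ 2 ≤ q ^ 2 * e ^ 2 + 6 * |e| ^ 3 := by
    have h1 : z ^ 2 = q ^ 2 * e ^ 2 + 2 * q * (e * w) + w ^ 2 := by rw [hz]; ring
    have h2 : e * w ≤ |e| * (3 / 2 * |e| ^ 2) := by
      refine (le_abs_self _).trans ?_
      rw [abs_mul]; gcongr
    have h3 : w ^ 2 ≤ (3 / 2 * |e| ^ 2) ^ 2 := by rw [← sq_abs w]; gcongr
    have h4 : 2 * q * (e * w) ≤ 3 * |e| ^ 3 := by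
      calc 2 * q * (e * w) ≤ 2 * q * (|e| * (3 / 2 * |e| ^ 2)) := by gcongr
        _ ≤ 2 * 1 * (|e| * (3 / 2 * |e| ^ 2)) := by gcongr
        _ = _ := by ring
    have h5 : (3 / 2 * |e| ^ 2) ^ 2 ≤ 3 * |e| ^ 3 := by
      have : (3 / 2 * |e| ^ 2) ^ 2 = 9 / 4 * (|e| ^ 3 * |e|) := by ring
      rw [this]; nlinarith [pow_nonneg ha 3]
    linarith
  have hexp : Real.exp z ≤ 1 + z + z ^ 2 / 2 + |z| ^ 3 := by
    have h := Real.exp_bound (x := z) (by linarith) (n := 3) (by norm_num)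
    simp only [Finset.sum_range_succ, Finset.sum_range_zero] at h
    norm_num [Nat.factorial] at h
    have := (abs_le.1 h).2
    nlinarith [pow_nonneg (abs_nonneg z) 3]
  have hz3 : |z| ^ 3 ≤ 8 * |e| ^ 3 := by
    calc |z| ^ 3 ≤ (2 * |e|) ^ 3 := by gcongr
      _ = _ := by ring
  calc (1 + e) ^ q = Real.exp (Real.log (1 + e) * q) := Real.rpow_def_of_pos h1e q
    _ ≤ Real.exp z := by
        refine Real.exp_le_exp.2 ?_
        calc Real.log (1 + e) * q ≤ (e - e ^ 2 / 2 + 2 * |e| ^ 3) * q := by gcongr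
          _ = z := by rw [hz, hw]; ring
    _ ≤ 1 + z + z ^ 2 / 2 + |z| ^ 3 := hexp
    _ ≤ 1 + (q * e + w) + (q ^ 2 * e ^ 2 + 6 * |e| ^ 3) / 2 + 8 * |e| ^ 3 := by gcongr
    _ ≤ _ := by rw [hw]; nlinarith [pow_nonneg ha 3]

theorem length_element_le_second_order {q e f : ℝ} (hq0 : 0 ≤ q) (hq1 : q ≤ 1) (he : |e| ≤ 1 / 2) :
    (1 + e) ^ q * √(1 + (f / (1 + e)) ^ 2) ≤
      1 + q * e - q * (1 - q) / 2 * e ^ 2 + f ^ 2 / 2 + 13 * |e| ^ 3 + 5 * (f ^ 2 * |e|) := by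
  obtain ⟨he1, he2⟩ := abs_le.1 he
  have h1e : 0 < 1 + e := by linarith
  have ha := abs_nonneg e
  have hP : (1 + e) ^ q ≤ 1 + |e| :=
    (rpow_one_add_le_one_add_mul_self (by linarith) hq0 hq1).trans (by
      have : q * e ≤ q * |e| := by gcongr; exact le_abs_self e
      nlinarith)
  have hQ : √(1 + (f / (1 + e)) ^ 2) ≤ 1 + (f / (1 + e)) ^ 2 / 2 := by
    refine Real.sqrt_le_iff.2 ⟨by positivity, ?_⟩
    nlinarith [sq_nonneg ((f / (1 + e)) ^ 2)]
  have h3 : (1 + |e|) * (f / (1 + e)) ^ 2 ≤ f ^ 2 * (1 + 10 * |e|) := by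
    rw [div_pow, ← mul_div_assoc, div_le_iff₀ (by positivity)]
    have h4 : (1 - |e|) ^ 2 ≤ (1 + e) ^ 2 := by
      have : -|e| ≤ e := neg_abs_le e
      gcongr
      · linarith
      · linarith
    have h5 : 1 + |e| ≤ (1 + 10 * |e|) * (1 - |e|) ^ 2 := by
      have : 0 ≤ |e| * ((1 - 2 * |e|) * (7 - 5 * |e|)) :=
        mul_nonneg ha (mul_nonneg (by linarith) (by linarith))
      nlinarith
    calc (1 + |e|) * f ^ 2 ≤ ((1 + 10 * |e|) * (1 - |e|) ^ 2) * f ^ 2 := by gcongr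
      _ ≤ ((1 + 10 * |e|) * (1 + e) ^ 2) * f ^ 2 := by gcongr
      _ = _ := by ring
  calc (1 + e) ^ q * √(1 + (f / (1 + e)) ^ 2)
      ≤ (1 + e) ^ q * (1 + (f / (1 + e)) ^ 2 / 2) := by gcongr
    _ = (1 + e) ^ q + (1 + e) ^ q * (f / (1 + e)) ^ 2 / 2 := by ring
    _ ≤ (1 + q * e - q * (1 - q) / 2 * e ^ 2 + 13 * |e| ^ 3) +
        (1 + |e|) * (f / (1 + e)) ^ 2 / 2 := by
        gcongr
        exact one_add_rpow_le hq0 hq1 he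
    _ ≤ _ := by linarith

theorem setIntegral_eq_zero_of_hasDerivAt_of_eq {f f' : ℝ → ℝ} {a b : ℝ} (hab : a ≤ b)
    (hf : ∀ s, HasDerivAt f (f' s) s) (hf' : Continuous f') (h : f a = f b) :
    ∫ s in Ioo a b, f' s = 0 := by
  rw [← integral_Ioc_eq_integral_Ioo, ← intervalIntegral.integral_of_le hab,
    intervalIntegral.integral_eq_sub_of_hasDerivAt (fun s _ => hf s)
      (hf'.intervalIntegrable _ _), h, sub_self]

/-- The total weight of the upper half of the unit circle. -/
def circleMass (k : ℕ) : ℝ := ∫ s in Ioo 0 Real.pi, Real.sin s ^ (k - 1)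

theorem integrableOn_circle {f : ℝ → ℝ} (hf : Continuous f) : IntegrableOn f (Ioo 0 Real.pi) :=
  (hf.integrableOn_Icc).mono_set Ioo_subset_Icc_self

theorem circleMass_pos (k : ℕ) : 0 < circleMass k := by
  unfold circleMass
  rw [← integral_Ioc_eq_integral_Ioo, ← intervalIntegral.integral_of_le Real.pi_pos.le]
  exact intervalIntegral.intervalIntegral_pos_of_pos_on
    ((Real.continuous_sin.pow _).intervalIntegrable _ _)
    (fun s hs => pow_pos (Real.sin_pos_of_mem_Ioo hs) _) Real.pi_pos

/-- Up to a factor the integrand is the derivative of `sin^k`, which vanishes at both ends. It makes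
the volume of the perturbed ball independent of `ε` and removes the linear term of its area. -/
theorem circle_first_moment {k : ℕ} (hk : 1 ≤ k) :
    ∫ s in Ioo 0 Real.pi, Real.sin s ^ (k - 1) * Real.cos s = 0 := by
  have h := setIntegral_eq_zero_of_hasDerivAt_of_eq (f := fun s => Real.sin s ^ k)
    (f' := fun s => k * (Real.sin s ^ (k - 1) * Real.cos s)) Real.pi_pos.le
    (fun s => ((Real.hasDerivAt_sin s).pow k).congr_deriv (by ring)) (by fun_prop)
    (by simp)
  rw [integral_const_mul] at h
  rcases mul_eq_zero.1 h with h | h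
  · exact absurd h (by positivity)
  · exact h

/-- Integrate the derivative of `sin^k · cos` over the half-circle. -/
theorem circle_second_moment {k : ℕ} (hk : 1 ≤ k) :
    (k + 1) * ∫ s in Ioo 0 Real.pi, Real.sin s ^ (k - 1) * Real.cos s ^ 2 = circleMass k := by
  have h := setIntegral_eq_zero_of_hasDerivAt_of_eq (f := fun s => Real.sin s ^ k * Real.cos s)
    (f' := fun s => (k + 1) * (Real.sin s ^ (k - 1) * Real.cos s ^ 2) - Real.sin s ^ (k - 1))
    Real.pi_pos.le (fun s => by
      refine (((Real.hasDerivAt_sin s).pow k).mul (Real.hasDerivAt_cos s)).congr_deriv ?_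
      obtain ⟨j, rfl⟩ := Nat.exists_eq_add_of_le' hk
      simp only [Nat.add_sub_cancel, pow_succ, Pi.pow_apply]
      push_cast
      linear_combination (-(Real.sin s ^ j)) * Real.sin_sq_add_cos_sq s) (by fun_prop)
    (by simp [show k ≠ 0 by omega])
  rw [integral_sub (integrableOn_circle (by fun_prop)) (integrableOn_circle (by fun_prop)),
    integral_const_mul] at h
  rw [circleMass]
  linarith

/-- The density of the weighted area of a perturbed ball. -/
def perturbedElement (m ε s : ℝ) : ℝ :=
  (1 + ε * Real.cos s) ^ ((m - 1) / m) *
    √(1 + (-(ε * Real.sin s) / m / (1 + ε * Real.cos s)) ^ 2)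

theorem abs_mul_cos_le {ε : ℝ} (hε : |ε| ≤ 1 / 2) (s : ℝ) : |ε * Real.cos s| ≤ 1 / 2 := by
  rw [abs_mul]
  calc |ε| * |Real.cos s| ≤ 1 / 2 * 1 := by gcongr; exact Real.abs_cos_le_one s
    _ = 1 / 2 := mul_one _

theorem one_add_mul_cos_pos {ε : ℝ} (hε : |ε| ≤ 1 / 2) (s : ℝ) : 0 < 1 + ε * Real.cos s := by
  have := (abs_le.1 (abs_mul_cos_le hε s)).1; linarith

theorem continuous_perturbedElement {m ε : ℝ} (hε : |ε| ≤ 1 / 2) :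
    Continuous (perturbedElement m ε) := by
  have h := one_add_mul_cos_pos hε
  unfold perturbedElement
  refine (Continuous.rpow_const (by fun_prop) fun s => Or.inl (h s).ne').mul ?_
  refine Continuous.sqrt (continuous_const.add (Continuous.pow ?_ 2))
  exact Continuous.div (by fun_prop) (by fun_prop) fun s => (h s).ne'

/-- This is the second-order expansion with `q = (m - 1)/m`, so that `q (1 - q)` combines with the
gradient term. The remainder constant is `18 = 13 + 5`. -/
theorem perturbedElement_le {m ε : ℝ} (hm : 1 ≤ m) (hε0 : 0 < ε) (hε : ε ≤ 1 / 2) (s : ℝ) :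
    perturbedElement m ε s ≤ 1 + (m - 1) / m * (ε * Real.cos s) + ε ^ 2 / (2 * m ^ 2) -
      ε ^ 2 / (2 * m) * Real.cos s ^ 2 + 18 * ε ^ 3 := by
  have hm0 : 0 < m := by linarith
  have hεa : |ε| ≤ 1 / 2 := by rwa [abs_of_pos hε0]
  have h := length_element_le_second_order (q := (m - 1) / m) (e := ε * Real.cos s)
    (f := -(ε * Real.sin s) / m) (div_nonneg (by linarith) hm0.le)
    (by rw [div_le_one hm0]; linarith) (abs_mul_cos_le hεa s)
  have hcos : |ε * Real.cos s| ≤ ε := by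
    rw [abs_mul, abs_of_pos hε0]
    exact mul_le_of_le_one_right hε0.le (Real.abs_cos_le_one s)
  have hf2 : (-(ε * Real.sin s) / m) ^ 2 = ε ^ 2 * (1 - Real.cos s ^ 2) / m ^ 2 := by
    rw [← Real.sin_sq, div_pow, neg_sq, mul_pow]
  have hf2' : (-(ε * Real.sin s) / m) ^ 2 ≤ ε ^ 2 := by
    rw [hf2, div_le_iff₀ (by positivity)]
    have h1 : 1 ≤ m ^ 2 := one_le_pow₀ hm
    have h2 : 1 - Real.cos s ^ 2 ≤ 1 := by linarith [sq_nonneg (Real.cos s)]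
    exact mul_le_mul_of_nonneg_left (h2.trans h1) (sq_nonneg ε)
  have h2 : 13 * |ε * Real.cos s| ^ 3 + 5 * ((-(ε * Real.sin s) / m) ^ 2 * |ε * Real.cos s|) ≤
      18 * ε ^ 3 := by
    have h3 : |ε * Real.cos s| ^ 3 ≤ ε ^ 3 := pow_le_pow_left₀ (abs_nonneg _) hcos 3
    have h4 : (-(ε * Real.sin s) / m) ^ 2 * |ε * Real.cos s| ≤ ε ^ 2 * ε :=
      mul_le_mul hf2' hcos (abs_nonneg _) (sq_nonneg ε)
    linarith
  have h3 : -((m - 1) / m * (1 - (m - 1) / m) / 2 * (ε * Real.cos s) ^ 2) +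
      ε ^ 2 * (1 - Real.cos s ^ 2) / m ^ 2 / 2 =
      ε ^ 2 / (2 * m ^ 2) - ε ^ 2 / (2 * m) * Real.cos s ^ 2 := by
    field_simp; ring
  unfold perturbedElement
  rw [hf2] at h h2
  linarith

/-- Balls about the origin are unstable under a perturbation in the direction of the axis. -/
theorem exists_perturbedElement_lt {k : ℕ} (hk : 1 ≤ k) {p : ℝ} (hp : 0 < p) :
    ∃ ε : ℝ, |ε| ≤ 1 / 2 ∧
      ∫ s in Ioo 0 Real.pi, Real.sin s ^ (k - 1) * perturbedElement (p + k + 1) ε s <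
        circleMass k := by
  set m : ℝ := p + k + 1 with hm
  have hk0 : (0 : ℝ) ≤ k := k.cast_nonneg
  have hm1 : 1 ≤ m := by linarith
  have hm0 : 0 < m := by linarith
  set I := circleMass k with hI
  have hI0 : 0 < I := circleMass_pos k
  set J := ∫ s in Ioo 0 Real.pi, Real.sin s ^ (k - 1) * Real.cos s ^ 2 with hJ
  have hJI : (k + 1) * J = I := circle_second_moment hk
  have hJ0 : 0 < J := by
    by_contra! h
    nlinarith
  -- Minus the second-order coefficient: `I/(2m²) - J/(2m) = J (k + 1 - m)/(2m²)`, and `m - (k + 1)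
  -- = p > 0`. The choice of `ε` makes the cubic error at most half of `c ε²`.
  set c := p * J / (2 * m ^ 2) with hc
  have hc0 : 0 < c := by positivity
  set ε := min (1 / 2) (c / (36 * I)) with hε
  have hε0 : 0 < ε := lt_min (by norm_num) (by positivity)
  have hε1 : ε ≤ 1 / 2 := min_le_left _ _
  have hε2 : 18 * I * ε < c := by
    have : ε ≤ c / (36 * I) := min_le_right _ _
    rw [le_div_iff₀ (by positivity)] at this
    nlinarith
  have hεa : |ε| ≤ 1 / 2 := by rwa [abs_of_pos hε0]
  refine ⟨ε, hεa, ?_⟩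
  have hbd : ∀ s ∈ Ioo 0 Real.pi, Real.sin s ^ (k - 1) * perturbedElement m ε s ≤
      (1 + ε ^ 2 / (2 * m ^ 2) + 18 * ε ^ 3) * Real.sin s ^ (k - 1) +
        ((m - 1) / m * ε) * (Real.sin s ^ (k - 1) * Real.cos s) -
        (ε ^ 2 / (2 * m)) * (Real.sin s ^ (k - 1) * Real.cos s ^ 2) := fun s hs => by
    have hs0 : 0 ≤ Real.sin s ^ (k - 1) := pow_nonneg (Real.sin_pos_of_mem_Ioo hs).le _
    refine (mul_le_mul_of_nonneg_left (perturbedElement_le hm1 hε0 hε1 s) hs0).trans (le_of_eq ?_)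
    ring
  have hi0 : IntegrableOn (fun s => Real.sin s ^ (k - 1)) (Ioo 0 Real.pi) :=
    integrableOn_circle (by fun_prop)
  have hi1 : IntegrableOn (fun s => Real.sin s ^ (k - 1) * Real.cos s) (Ioo 0 Real.pi) :=
    integrableOn_circle (by fun_prop)
  have hi2 : IntegrableOn (fun s => Real.sin s ^ (k - 1) * Real.cos s ^ 2) (Ioo 0 Real.pi) :=
    integrableOn_circle (by fun_prop)
  have hle := setIntegral_mono_on (integrableOn_circle (by
      have := continuous_perturbedElement (m := m) hεa; fun_prop))
    (((hi0.const_mul (1 + ε ^ 2 / (2 * m ^ 2) + 18 * ε ^ 3)).add (hi1.const_mul ((m - 1) / m * ε))).sub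
      (hi2.const_mul (ε ^ 2 / (2 * m)))) measurableSet_Ioo hbd
  refine hle.trans_lt ?_
  have e1 : ∫ s in Ioo 0 Real.pi, ((1 + ε ^ 2 / (2 * m ^ 2) + 18 * ε ^ 3) * Real.sin s ^ (k - 1) +
        ((m - 1) / m * ε) * (Real.sin s ^ (k - 1) * Real.cos s) -
        (ε ^ 2 / (2 * m)) * (Real.sin s ^ (k - 1) * Real.cos s ^ 2)) =
      (1 + ε ^ 2 / (2 * m ^ 2) + 18 * ε ^ 3) * I - ε ^ 2 / (2 * m) * J := by
    have hi3 : IntegrableOn (fun s =>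
        (1 + ε ^ 2 / (2 * m ^ 2) + 18 * ε ^ 3) * Real.sin s ^ (k - 1) +
        ((m - 1) / m * ε) * (Real.sin s ^ (k - 1) * Real.cos s)) (Ioo 0 Real.pi) :=
      (hi0.const_mul _).add (hi1.const_mul _)
    rw [integral_sub hi3 (hi2.const_mul _), integral_add (hi0.const_mul _) (hi1.const_mul _), integral_const_mul, integral_const_mul,
      integral_const_mul, circle_first_moment hk, mul_zero, add_zero]
    rfl
  refine (le_of_eq e1).trans_lt ?_
  have e2 : (1 + ε ^ 2 / (2 * m ^ 2) + 18 * ε ^ 3) * I - ε ^ 2 / (2 * m) * J =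
      I + ε ^ 2 * (18 * I * ε - c) := by
    rw [← hJI, hc, hm]; field_simp; ring
  rw [e2]
  nlinarith [pow_pos hε0 2]

/-! ### Perturbed balls as competitors -/

section StarBody

variable {k : ℕ}

/-- The starshaped body whose radial function depends only on the angle to the axis, without the
origin. -/
def starBody (k : ℕ) (ρ : ℝ → ℝ) : Set (EuclideanSpace ℝ (Fin (k + 1))) :=
  {x | x ≠ 0 ∧ ‖x‖ < ρ (x 0 / ‖x‖)}

theorem continuousAt_radius {ρ : ℝ → ℝ} (hρ : Continuous ρ) {x : EuclideanSpace ℝ (Fin (k + 1))}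
    (hx : x ≠ 0) :
    ContinuousAt (fun x : EuclideanSpace ℝ (Fin (k + 1)) => ρ (x 0 / ‖x‖)) x := by
  have h0 : ‖x‖ ≠ 0 := norm_ne_zero_iff.2 hx
  exact hρ.continuousAt.comp (ContinuousAt.div (by fun_prop) (by fun_prop) h0)

theorem isOpen_starBody {ρ : ℝ → ℝ} (hρ : Continuous ρ) : IsOpen (starBody k ρ) := by
  rw [isOpen_iff_mem_nhds]
  rintro x ⟨hx, hlt⟩
  filter_upwards [isOpen_ne.mem_nhds hx,
    continuous_norm.continuousAt.eventually_lt (continuousAt_radius hρ hx) hlt] with y h1 h2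
  exact ⟨h1, h2⟩

theorem tail_eq_zero_of_sin {x : EuclideanSpace ℝ (Fin (k + 1))} (h : ‖tail x‖ = 0) :
    x = join (x 0) 0 := by
  rw [norm_eq_zero] at h
  rw [← h, join_tail]

theorem exists_angle {x : EuclideanSpace ℝ (Fin (k + 1))} (hx : 0 < ‖tail x‖) :
    ∃ s ∈ Ioo 0 Real.pi, x 0 = ‖x‖ * Real.cos s ∧ ‖tail x‖ = ‖x‖ * Real.sin s := by
  have hsq := norm_sq_eq_tail x
  have hn : 0 < ‖x‖ := by
    by_contra! h
    have : ‖x‖ = 0 := le_antisymm h (norm_nonneg _)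
    rw [this] at hsq; nlinarith [sq_nonneg (x 0)]
  have habs : |x 0 / ‖x‖| < 1 := by
    rw [abs_div, abs_norm, div_lt_one hn]
    exact abs_lt_of_sq_lt_sq (by nlinarith) hn.le
  obtain ⟨h1, h2⟩ := abs_lt.1 habs
  refine ⟨Real.arccos (x 0 / ‖x‖), ⟨Real.arccos_pos.2 h2, ?_⟩, ?_, ?_⟩
  · refine lt_of_le_of_ne (Real.arccos_le_pi _) fun h => ?_
    rw [Real.arccos_eq_pi] at h; linarith
  · rw [Real.cos_arccos h1.le h2.le]; field_simp
  · rw [Real.sin_arccos]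
    have : 1 - (x 0 / ‖x‖) ^ 2 = (‖tail x‖ / ‖x‖) ^ 2 := by
      field_simp; linarith
    rw [this, Real.sqrt_sq (by positivity)]; field_simp

/-- Off the origin a boundary point satisfies `‖x‖ = ρ (x 0 / ‖x‖)` by continuity. On the axis this
leaves only the two poles; off the axis the angle places the point on the rotated curve. The three
exceptional points have no weighted area. -/
theorem frontier_starBody_subset {ρ : ℝ → ℝ} (hρ : Continuous ρ) :
    frontier (starBody k ρ) ⊆ {0, join (ρ 1) 0, join (-ρ (-1)) 0} ∪
      rotatedCurve k (fun s => ρ (Real.cos s) * Real.cos s) (fun s => ρ (Real.cos s) * Real.sin s)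
        (Ioo 0 Real.pi) := by
  intro x hx
  rw [(isOpen_starBody hρ).frontier_eq] at hx
  obtain ⟨hcl, hnot⟩ := hx
  by_cases h0 : x = 0
  · exact Or.inl (Or.inl h0)
  have hn : 0 < ‖x‖ := norm_pos_iff.2 h0
  have heq : ‖x‖ = ρ (x 0 / ‖x‖) := by
    refine le_antisymm ?_ (not_lt.1 fun h => hnot ⟨h0, h⟩)
    by_contra! hlt
    obtain ⟨y, hy1, hy2⟩ := mem_closure_iff_nhds.1 hcl _
      ((continuousAt_radius hρ h0).eventually_lt continuous_norm.continuousAt hlt)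
    exact lt_asymm hy1 hy2.2
  rcases (norm_nonneg (tail x)).eq_or_lt with ht | ht
  · refine Or.inl (Or.inr ?_)
    have hsq := norm_sq_eq_tail x
    rw [← ht, zero_pow two_ne_zero, add_zero] at hsq
    have hj := tail_eq_zero_of_sin ht.symm
    rcases sq_eq_sq_iff_eq_or_eq_neg.1 hsq with h | h
    · left
      rw [← h, div_self hn.ne'] at heq
      rw [hj, ← h, heq]
    · right
      have h' : x 0 = -‖x‖ := by linarith
      rw [h', neg_div, div_self hn.ne'] at heq
      rw [mem_singleton_iff, hj, h', heq]
  · obtain ⟨s, hs, h1, h2⟩ := exists_angle ht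
    refine Or.inr ⟨s, hs, ?_, ?_⟩
    · have : x 0 / ‖x‖ = Real.cos s := by rw [h1]; field_simp
      rw [this] at heq; simp only; rw [← heq]; exact h1
    · have : x 0 / ‖x‖ = Real.cos s := by rw [h1]; field_simp
      rw [this] at heq; simp only; rw [← heq]; exact h2

theorem volume_axis (hk : 1 ≤ k) :
    volume {x : EuclideanSpace ℝ (Fin (k + 1)) | tail x = 0} = 0 := by
  have h := (measurePreserving_join_symm (k := k)).measure_preimage
    (s := univ ×ˢ {0}) (MeasurableSet.univ.prod (measurableSet_singleton 0)).nullMeasurableSet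
  have e : (fun x : EuclideanSpace ℝ (Fin (k + 1)) => (x 0, tail x)) ⁻¹' (univ ×ˢ {0}) =
      {x | tail x = 0} := by
    ext x; simp
  have : Nontrivial (EuclideanSpace ℝ (Fin k)) := by
    have : Nonempty (Fin k) := ⟨⟨0, by omega⟩⟩
    infer_instance
  rw [e] at h
  rw [h, Measure.volume_eq_prod, Measure.prod_prod, measure_singleton, mul_zero]

theorem injOn_cot : InjOn (fun s => Real.cos s / Real.sin s) (Ioo 0 Real.pi) := by
  intro s hs t ht h
  have h1 := Real.sin_pos_of_mem_Ioo hs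
  have h2 := Real.sin_pos_of_mem_Ioo ht
  simp only at h
  rw [div_eq_div_iff h1.ne' h2.ne'] at h
  have h3 : Real.sin (t - s) = 0 := by rw [Real.sin_sub]; linarith
  have h4 := (Real.sin_eq_zero_iff_of_lt_of_lt (by linarith [hs.2, ht.1])
    (by linarith [hs.1, ht.2])).1 h3
  linarith

theorem weight_circle (p s : ℝ) : weight k p (Real.cos s) (Real.sin s) = Real.sin s ^ (k - 1) := by
  rw [weight, Real.cos_sq_add_sin_sq, Real.sqrt_one, Real.one_rpow, one_mul]

/-- Weighted volume in polar coordinates. -/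
theorem weightedVolume_starBody (hk : 1 ≤ k) {p : ℝ} (hp : 0 < p) {ρ : ℝ → ℝ} (hρ : Continuous ρ)
    (hρ0 : ∀ s ∈ Ioo 0 Real.pi, 0 ≤ ρ (Real.cos s)) :
    weightedVolume p (starBody k ρ) = sphereMass k * ∫⁻ s in Ioo 0 Real.pi, ENNReal.ofReal
      (Real.sin s ^ (k - 1) * (ρ (Real.cos s) ^ (p + k + 1) / (p + k + 1))) := by
  have hk0 : (0 : ℝ) ≤ k := k.cast_nonneg
  have h := weightedVolume_coneBody_between hk hp (u := Real.cos) (v := Real.sin)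
    (u' := fun s => -Real.sin s) (v' := Real.cos) (fun s _ => Real.hasDerivAt_cos s)
    (fun s _ => Real.hasDerivAt_sin s) (by fun_prop) (by fun_prop)
    (fun s hs => Real.sin_pos_of_mem_Ioo hs) (fun s _ => by
      nlinarith [Real.sin_sq_add_cos_sq s]) injOn_cot le_rfl
    (κ := fun s => ρ (Real.cos s)) (by fun_prop) hρ0
  -- Cone coordinates along the open half-circle miss only the axis, which is a null set.
  have e : (starBody k ρ : Set (EuclideanSpace ℝ (Fin (k + 1)))) =ᵐ[volume]
      coneBody k Real.cos Real.sin {q | q.1 ∈ Ioo 0 Real.pi ∧ 0 < q.2 ∧ q.2 < ρ (Real.cos q.1)} := by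
    have hax : ∀ᵐ x : EuclideanSpace ℝ (Fin (k + 1)), tail x ≠ 0 :=
      measure_eq_zero_iff_ae_notMem.1 (volume_axis hk)
    filter_upwards [hax] with x hx
    refine propext ?_
    have hx0 := norm_pos_iff.2 hx
    have hn : 0 < ‖x‖ := by
      have := norm_sq_eq_tail x
      by_contra! h
      rw [le_antisymm h (norm_nonneg _)] at this; nlinarith [sq_nonneg (x 0)]
    constructor
    · rintro ⟨h0, hlt⟩
      obtain ⟨s, hs, h1, h2⟩ := exists_angle hx0
      refine ⟨(s, ‖x‖), ⟨hs, hn, ?_⟩, ?_⟩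
      · have : x 0 / ‖x‖ = Real.cos s := by rw [h1]; field_simp
        rwa [this] at hlt
      · simp only [coneMap]; rw [← h1, ← h2]
    · rintro ⟨⟨s, t⟩, ⟨hs, ht, hlt⟩, heq⟩
      simp only [coneMap, Prod.mk.injEq] at heq hs ht hlt
      have hnt : ‖x‖ = t := by
        rw [← sq_eq_sq₀ (norm_nonneg _) ht.le, norm_sq_eq_tail, ← heq.1, ← heq.2]
        linear_combination (t ^ 2) * Real.sin_sq_add_cos_sq s
      refine ⟨norm_pos_iff.1 hn, ?_⟩
      have : x 0 / ‖x‖ = Real.cos s := by rw [hnt, ← heq.1]; field_simp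
      rw [this, hnt]; exact hlt
  rw [weightedVolume, setLIntegral_congr e]
  refine h.trans ?_
  congr 1
  refine setLIntegral_congr_fun measurableSet_Ioo fun s hs => ?_
  rw [weight_circle, Real.zero_rpow (by positivity)]
  congr 1
  have := Real.sin_sq_add_cos_sq s
  linear_combination (Real.sin s ^ (k - 1) * (ρ (Real.cos s) ^ (p + k + 1) / (p + k + 1))) * this

theorem euclideanHausdorffMeasure_finite_eq_zero {n d : ℕ} (hd : 0 < d)
    {T : Set (EuclideanSpace ℝ (Fin n))} (hT : T.Finite) : μHE[d] T = 0 := by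
  have := Measure.nullSingletonClass_hausdorff (EuclideanSpace ℝ (Fin n)) (d := d) (by positivity)
  rw [Measure.euclideanHausdorffMeasure_def, Measure.smul_apply, hT.measure_zero, smul_zero]

end StarBody

section Competitor

variable {k : ℕ} {p : ℝ} {E : Set (EuclideanSpace ℝ (Fin (k + 1)))}

/-- The radial function of a perturbed ball whose weighted volume does not depend on `ε`. -/
def perturbedRadius (m l ε c : ℝ) : ℝ := l * (1 + ε * c) ^ m⁻¹

theorem continuous_perturbedRadius {m l ε : ℝ} (hm : 0 < m) :
    Continuous (perturbedRadius m l ε) := by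
  unfold perturbedRadius
  exact continuous_const.mul (Continuous.rpow_const (by fun_prop) fun c => Or.inr (by positivity))

theorem perturbedRadius_cos_pos {m l ε : ℝ} (hl : 0 < l) (hε : |ε| ≤ 1 / 2) (s : ℝ) :
    0 < perturbedRadius m l ε (Real.cos s) :=
  mul_pos hl (Real.rpow_pos_of_pos (one_add_mul_cos_pos hε s) _)

theorem hasStrictDerivAt_perturbedRadius {m l ε : ℝ} (hε : |ε| ≤ 1 / 2) (s : ℝ) :
    HasStrictDerivAt (fun s => perturbedRadius m l ε (Real.cos s))
      (perturbedRadius m l ε (Real.cos s) *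
        (-(ε * Real.sin s) / m / (1 + ε * Real.cos s))) s := by
  have h0 := one_add_mul_cos_pos hε s
  refine ((HasStrictDerivAt.comp (h₂ := fun x : ℝ => x ^ m⁻¹) (h := fun s => 1 + ε * Real.cos s) s
      (Real.hasStrictDerivAt_rpow_const_of_ne h0.ne' m⁻¹)
      (((Real.hasStrictDerivAt_cos s).const_mul ε).const_add 1)).const_mul l).congr_deriv ?_
  rw [perturbedRadius, Real.rpow_sub_one h0.ne']
  ring

/-- The `m`-th power of the radius is affine in `cos s`, and the cosine term integrates to zero. -/
theorem weightedVolume_perturbedBall (hk : 1 ≤ k) (hp : 0 < p) {l ε : ℝ} (hl : 0 < l)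
    (hε : |ε| ≤ 1 / 2) :
    weightedVolume p (starBody k (perturbedRadius (p + k + 1) l ε)) =
      sphereMass k * ENNReal.ofReal (l ^ (p + k + 1) / (p + k + 1) * circleMass k) := by
  have hk0 : (0 : ℝ) ≤ k := k.cast_nonneg
  set m := p + k + 1 with hm
  have hm0 : 0 < m := by linarith
  rw [weightedVolume_starBody hk hp (continuous_perturbedRadius hm0)
    fun s _ => (perturbedRadius_cos_pos hl hε s).le, ← hm]
  congr 1
  have e : ∀ s, perturbedRadius m l ε (Real.cos s) ^ m = l ^ m * (1 + ε * Real.cos s) := fun s => by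
    have h0 := one_add_mul_cos_pos hε s
    rw [perturbedRadius, Real.mul_rpow hl.le (Real.rpow_nonneg h0.le _),
      Real.rpow_inv_rpow h0.le hm0.ne']
  rw [← ofReal_integral_eq_lintegral_ofReal]
  · congr 1
    have e2 : ∀ s, Real.sin s ^ (k - 1) * (perturbedRadius m l ε (Real.cos s) ^ m / m) =
        l ^ m / m * (Real.sin s ^ (k - 1) + ε * (Real.sin s ^ (k - 1) * Real.cos s)) := fun s => by
      rw [e]; ring
    simp only [e2]
    rw [integral_const_mul, integral_add (integrableOn_circle (by fun_prop))
      (integrableOn_circle (by fun_prop)), integral_const_mul, circle_first_moment hk, mul_zero,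
      add_zero, circleMass]
  · refine integrableOn_circle ?_
    simp only [e]; fun_prop
  · filter_upwards [ae_restrict_mem measurableSet_Ioo] with s hs
    have h1 := Real.sin_pos_of_mem_Ioo hs
    have h2 := perturbedRadius_cos_pos (m := m) hl hε s
    positivity

theorem lintegral_rotatedCircle (hk : 1 ≤ k) (hp : 0 < p) {l ε : ℝ} (hl : 0 < l)
    (hε : |ε| ≤ 1 / 2) :
    MeasurableSet (rotatedCurve k
      (fun s => perturbedRadius (p + k + 1) l ε (Real.cos s) * Real.cos s)
      (fun s => perturbedRadius (p + k + 1) l ε (Real.cos s) * Real.sin s) (Ioo 0 Real.pi)) ∧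
    ∫⁻ x in rotatedCurve k (fun s => perturbedRadius (p + k + 1) l ε (Real.cos s) * Real.cos s)
        (fun s => perturbedRadius (p + k + 1) l ε (Real.cos s) * Real.sin s) (Ioo 0 Real.pi),
        density p x ∂(μHE[k]) =
      sphereMass k * ENNReal.ofReal (l ^ (p + k) * ∫ s in Ioo 0 Real.pi,
        Real.sin s ^ (k - 1) * perturbedElement (p + k + 1) ε s) := by
  have hk0 : (0 : ℝ) ≤ k := k.cast_nonneg
  set m := p + k + 1 with hm
  have hm0 : 0 < m := by linarith
  set κ : ℝ → ℝ := fun s => perturbedRadius m l ε (Real.cos s) with hκ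
  set z : ℝ → ℝ := fun s => -(ε * Real.sin s) / m / (1 + ε * Real.cos s) with hz
  have hκ0 : ∀ s, 0 < κ s := perturbedRadius_cos_pos hl hε
  have hκd : ∀ s, HasStrictDerivAt κ (κ s * z s) s := hasStrictDerivAt_perturbedRadius hε
  have hκc : Continuous κ := continuous_iff_continuousAt.2 fun s => (hκd s).hasDerivAt.continuousAt
  have hzc : Continuous z :=
    Continuous.div (by fun_prop) (by fun_prop) fun s => (one_add_mul_cos_pos hε s).ne'
  have hsp : ∀ s, (κ s * z s * Real.cos s + κ s * -Real.sin s) ^ 2 +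
      (κ s * z s * Real.sin s + κ s * Real.cos s) ^ 2 = κ s ^ 2 * (1 + z s ^ 2) := fun s => by
    linear_combination (κ s ^ 2 * (1 + z s ^ 2)) * Real.sin_sq_add_cos_sq s
  obtain ⟨hmeas, hint⟩ := lintegral_rotatedCurve hk p (u := fun s => κ s * Real.cos s)
    (v := fun s => κ s * Real.sin s) (b := Real.pi)
    (fun s _ => (hκd s).mul (Real.hasStrictDerivAt_cos s))
    (fun s _ => (hκd s).mul (Real.hasStrictDerivAt_sin s)) (by fun_prop) (by fun_prop)
    (fun s _ => by rw [hsp]; have := hκ0 s; positivity)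
    (fun s hs => mul_pos (hκ0 s) (Real.sin_pos_of_mem_Ioo hs))
    (fun s hs t ht h => injOn_cot hs ht (by
      simp only [Prod.mk.injEq] at h
      simp only
      rw [← mul_div_mul_left _ _ (hκ0 s).ne', h.1, h.2, mul_div_mul_left _ _ (hκ0 t).ne']))
  refine ⟨hmeas, hint.trans ?_⟩
  congr 1
  have e : ∀ s, weight k p (κ s * Real.cos s) (κ s * Real.sin s) *
      √((κ s * z s * Real.cos s + κ s * -Real.sin s) ^ 2 +
        (κ s * z s * Real.sin s + κ s * Real.cos s) ^ 2) =
      l ^ (p + k) * (Real.sin s ^ (k - 1) * perturbedElement m ε s) := fun s => by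
    have h0 := one_add_mul_cos_pos hε s
    rw [hsp, Real.sqrt_mul (sq_nonneg _), Real.sqrt_sq (hκ0 s).le, weight_smul (hκ0 s),
      weight_circle, Nat.cast_sub hk, Nat.cast_one, ← add_sub_assoc, Real.rpow_sub_one (hκ0 s).ne']
    have h1 : κ s ^ (p + k) = l ^ (p + k) * (1 + ε * Real.cos s) ^ ((m - 1) / m) := by
      simp only [hκ, perturbedRadius]
      rw [Real.mul_rpow hl.le (Real.rpow_nonneg h0.le _), ← Real.rpow_mul h0.le]
      congr 2
      rw [hm]; field_simp; ring
    rw [h1]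
    change _ = _ * (_ * (_ * √(1 + z s ^ 2)))
    have := (hκ0 s).ne'
    field_simp
  simp only [e]
  rw [← integral_const_mul, ← ofReal_integral_eq_lintegral_ofReal]
  · refine (integrableOn_circle ?_).const_mul _
    have := continuous_perturbedElement (m := m) hε
    fun_prop
  · filter_upwards [ae_restrict_mem measurableSet_Ioo] with s hs
    have h1 := Real.sin_pos_of_mem_Ioo hs
    have h0 := one_add_mul_cos_pos hε s
    unfold perturbedElement
    positivity

theorem weightedPerimeter_perturbedBall_le (hk : 1 ≤ k) (hp : 0 < p) {l ε : ℝ} (hl : 0 < l)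
    (hε : |ε| ≤ 1 / 2) :
    weightedPerimeter p (starBody k (perturbedRadius (p + k + 1) l ε)) ≤
      sphereMass k * ENNReal.ofReal (l ^ (p + k) * ∫ s in Ioo 0 Real.pi,
        Real.sin s ^ (k - 1) * perturbedElement (p + k + 1) ε s) := by
  have hk0 : (0 : ℝ) ≤ k := k.cast_nonneg
  rw [← (lintegral_rotatedCircle hk hp hl hε).2]
  refine (lintegral_mono_set (frontier_starBody_subset
    (continuous_perturbedRadius (by positivity)))).trans ?_
  refine (lintegral_union_le _ _ _).trans ?_
  rw [setLIntegral_measure_zero _ _ (euclideanHausdorffMeasure_finite_eq_zero (by omega)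
    (Set.toFinite _)), zero_add]
  exact le_rfl

/-- An isoperimetric set beats all perturbed balls of the same weighted volume. -/
theorem IsIsoperimetric.weightedPerimeter_le (hE : IsIsoperimetric p E) (hk : 1 ≤ k) (hp : 0 < p)
    {l ε : ℝ} (hl : 0 < l) (hε : |ε| ≤ 1 / 2) (hvol : weightedVolume p E =
      sphereMass k * ENNReal.ofReal (l ^ (p + k + 1) / (p + k + 1) * circleMass k)) :
    weightedPerimeter p E ≤ sphereMass k * ENNReal.ofReal (l ^ (p + k) * ∫ s in Ioo 0 Real.pi,
        Real.sin s ^ (k - 1) * perturbedElement (p + k + 1) ε s) := by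
  have hk0 : (0 : ℝ) ≤ k := k.cast_nonneg
  refine (hE.minimal _ (isOpen_starBody
    (continuous_perturbedRadius (by positivity))).measurableSet ?_).trans
    (weightedPerimeter_perturbedBall_le hk hp hl hε)
  rw [hvol, weightedVolume_perturbedBall hk hp hl hε]

theorem weightedVolume_pos (hE : IsOpen E) (hne : E.Nonempty) (hk : 1 ≤ k) :
    0 < weightedVolume p E := by
  have : NeZero (k + 1) := ⟨by omega⟩
  have hE' : IsOpen (E \ {0}) := hE.sdiff isClosed_singleton
  have hne' : (E \ {0}).Nonempty := by
    by_contra h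
    rw [not_nonempty_iff_eq_empty] at h
    have hm := hE.measure_pos volume hne
    have h0 : volume (E \ {0}) = volume E := measure_sdiff_null (measure_singleton _)
    rw [h, measure_empty] at h0
    exact hm.ne h0
  refine lt_of_lt_of_le ?_ (lintegral_mono_set (sdiff_subset (t := ({0} : Set _))))
  rw [setLIntegral_pos_iff (by
    unfold density
    exact ENNReal.measurable_ofReal.comp (measurable_norm.pow_const p))]
  refine lt_of_lt_of_le (hE'.measure_pos volume hne') (measure_mono fun x hx => ⟨?_, hx⟩)
  rw [Function.mem_support, density]
  exact (ENNReal.ofReal_pos.2 (Real.rpow_pos_of_pos (norm_pos_iff.2 hx.2) p)).ne'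

/-- The radius of the ball about the origin with the same weighted volume. -/
theorem exists_radius (hE : IsOpen E) (hne : E.Nonempty) (hk : 1 ≤ k) (hp : 0 < p)
    (hfin : weightedVolume p E ≠ ⊤) :
    ∃ l : ℝ, 0 < l ∧ weightedVolume p E =
      sphereMass k * ENNReal.ofReal (l ^ (p + k + 1) / (p + k + 1) * circleMass k) := by
  have hk0 : (0 : ℝ) ≤ k := k.cast_nonneg
  have hI := circleMass_pos k
  have hm0 : 0 < p + k + 1 := by linarith
  set V := weightedVolume p E / sphereMass k with hV
  have hV0 : V ≠ 0 := (ENNReal.div_pos (weightedVolume_pos hE hne hk).ne' sphereMass_ne_top).ne'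
  have hVt : V ≠ ⊤ := (ENNReal.div_lt_top hfin (sphereMass_ne_zero hk)).ne
  have hVr : 0 < V.toReal := ENNReal.toReal_pos hV0 hVt
  have hx : 0 < (p + k + 1) * V.toReal / circleMass k := by positivity
  refine ⟨((p + k + 1) * V.toReal / circleMass k) ^ (p + k + 1)⁻¹, Real.rpow_pos_of_pos hx _, ?_⟩
  rw [Real.rpow_inv_rpow hx.le hm0.ne']
  have : (p + k + 1) * V.toReal / circleMass k / (p + k + 1) * circleMass k = V.toReal := by
    field_simp
  rw [this, ENNReal.ofReal_toReal hVt, hV,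
    ENNReal.mul_div_cancel (sphereMass_ne_zero hk) sphereMass_ne_top]

/-- The round ball, `ε = 0`, is a competitor of finite weighted perimeter. -/
theorem IsIsoperimetric.weightedPerimeter_ne_top (hE : IsIsoperimetric p E) (hEo : IsOpen E)
    (hne : E.Nonempty) (hk : 1 ≤ k) (hp : 0 < p) : weightedPerimeter p E ≠ ⊤ := by
  obtain ⟨l, hl, hvol⟩ := exists_radius hEo hne hk hp hE.volume_ne_top
  refine ne_top_of_le_ne_top ?_ (hE.weightedPerimeter_le hk hp hl (ε := 0) (by norm_num) hvol)
  exact ENNReal.mul_ne_top sphereMass_ne_top ENNReal.ofReal_ne_top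

/-- An isoperimetric set inside the unit ball does not have the unit sphere in its boundary. -/
theorem IsIsoperimetric.not_sphere_subset (hE : IsIsoperimetric p E) (hEo : IsOpen E)
    (hne : E.Nonempty) (hk : 1 ≤ k) (hp : 0 < p) (hle : ∀ x ∈ E, ‖x‖ ≤ 1) :
    ¬ rotatedCurve k Real.cos Real.sin (Ioo 0 Real.pi) ⊆ frontier E := by
  intro hsub
  have hk0 : (0 : ℝ) ≤ k := k.cast_nonneg
  have hI := circleMass_pos k
  have hm0 : 0 < p + k + 1 := by linarith
  have hσ0 := sphereMass_ne_zero hk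
  obtain ⟨l, hl, hvol⟩ := exists_radius hEo hne hk hp hE.volume_ne_top
  have h0 : |(0 : ℝ)| ≤ 1 / 2 := by norm_num
  -- Up to a null set, `E` is contained in the unit ball without the origin, so the ball of equal
  -- weighted volume is no larger than it.
  have hl1 : l ≤ 1 := by
    have hmono : weightedVolume p E ≤
        weightedVolume p (starBody k (perturbedRadius (p + k + 1) 1 0)) := by
      refine lintegral_mono_set' ?_
      have h1 : ∀ᵐ x : EuclideanSpace ℝ (Fin (k + 1)), x ∉ Metric.sphere 0 1 :=
        measure_eq_zero_iff_ae_notMem.1 (Measure.addHaar_sphere _ _ _)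
      have h2 : ∀ᵐ x : EuclideanSpace ℝ (Fin (k + 1)), x ∉ ({0} : Set _) :=
        measure_eq_zero_iff_ae_notMem.1 (measure_singleton _)
      filter_upwards [h1, h2] with x hx1 hx2 hxE
      refine ⟨hx2, ?_⟩
      simp only [perturbedRadius, zero_mul, add_zero, Real.one_rpow, mul_one]
      exact lt_of_le_of_ne (hle x hxE) fun h => hx1 (by simpa using h)
    rw [hvol, weightedVolume_perturbedBall hk hp one_pos h0,
      ENNReal.mul_le_mul_iff_right hσ0 sphereMass_ne_top,
      ENNReal.ofReal_le_ofReal_iff (by positivity), Real.one_rpow] at hmono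
    have h3 : l ^ (p + k + 1) ≤ 1 := by
      by_contra! h
      have : 1 / (p + k + 1) * circleMass k < l ^ (p + k + 1) / (p + k + 1) * circleMass k := by
        gcongr
      linarith
    by_contra! h
    exact absurd (Real.one_lt_rpow h hm0) (not_lt.2 h3)
  obtain ⟨ε, hε, hlt⟩ := exists_perturbedElement_lt hk hp
  have hup := hE.weightedPerimeter_le hk hp hl hε hvol
  -- The boundary contains the unit sphere up to its poles. The perturbed ball of radius scale `l ≤
  -- 1` has strictly smaller perimeter.
  have hlow : sphereMass k * ENNReal.ofReal (circleMass k) ≤ weightedPerimeter p E := by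
    have h := (lintegral_rotatedCircle (k := k) (p := p) hk hp one_pos h0).2
    have e1 : ∀ s, perturbedRadius (p + k + 1) 1 0 (Real.cos s) = 1 := fun s => by
      simp [perturbedRadius]
    have e2 : ∀ s, perturbedElement (p + k + 1) 0 s = 1 := fun s => by simp [perturbedElement]
    simp only [e1, e2, one_mul, mul_one, Real.one_rpow] at h
    rw [circleMass, ← h]
    exact lintegral_mono_set hsub
  have hfin := (hlow.trans hup)
  rw [ENNReal.mul_le_mul_iff_right hσ0 sphereMass_ne_top] at hfin
  set J := ∫ s in Ioo 0 Real.pi, Real.sin s ^ (k - 1) * perturbedElement (p + k + 1) ε s with hJ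
  have hJ0 : 0 ≤ J := by
    refine setIntegral_nonneg measurableSet_Ioo fun s hs => ?_
    have h1 := Real.sin_pos_of_mem_Ioo hs
    have h2 := one_add_mul_cos_pos hε s
    unfold perturbedElement
    positivity
  have h4 : l ^ (p + k) ≤ 1 := Real.rpow_le_one hl.le hl1 (by linarith)
  rw [ENNReal.ofReal_le_ofReal_iff (by positivity)] at hfin
  nlinarith

end Competitor

/-! ### The generating curve of an isoperimetric set -/

section Conclusion

variable {k : ℕ} {p β : ℝ} {E : Set (EuclideanSpace ℝ (Fin (k + 2)))}
  {A : Set (EuclideanSpace ℝ (Fin 2))} {γ : ℝ → EuclideanSpace ℝ (Fin 2)}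

theorem IsGeneratingCurve.contDiffOn_deriv (hγ : IsGeneratingCurve A β γ) (i : Fin 2) :
    ContDiffOn ℝ ∞ (deriv fun s => γ s i) (Ioo (-β) β) :=
  (hγ.contDiffOn_coord i).deriv_of_isOpen isOpen_Ioo (by simp)

theorem IsGeneratingCurve.hasDerivAt_deriv (hγ : IsGeneratingCurve A β γ) {s : ℝ}
    (hs : s ∈ Ioo (-β) β) (i : Fin 2) :
    HasDerivAt (deriv fun s => γ s i) (deriv (deriv fun s => γ s i) s) s :=
  (((hγ.contDiffOn_deriv i).differentiableOn (by simp)).differentiableAt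
    (isOpen_Ioo.mem_nhds hs)).hasDerivAt

theorem IsGeneratingCurve.continuousOn_deriv_deriv (hγ : IsGeneratingCurve A β γ) (i : Fin 2) :
    ContinuousOn (deriv (deriv fun s => γ s i)) (Ioo (-β) β) :=
  ((hγ.contDiffOn_deriv i).deriv_of_isOpen (m := ∞) isOpen_Ioo (by simp)).continuousOn

theorem IsGeneratingCurve.hasStrictDerivAt_coord (hγ : IsGeneratingCurve A β γ) {s : ℝ}
    (hs : s ∈ Ioo (-β) β) (i : Fin 2) :
    HasStrictDerivAt (fun s => γ s i) (deriv (fun s => γ s i) s) s :=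
  ((hγ.contDiffOn_coord i).contDiffAt (isOpen_Ioo.mem_nhds hs)).hasStrictDerivAt (by simp)

theorem norm_le_one_of_mem (hE : IsSphericallySymmetric E)
    (hball : ∀ q ∈ crossSection E, ‖q‖ ≤ 1) {x : EuclideanSpace ℝ (Fin (k + 2))} (hx : x ∈ E) :
    ‖x‖ ≤ 1 := by
  have hn : ‖x‖ = ‖(!₂[x 0, ‖tail x‖] : EuclideanSpace ℝ (Fin 2))‖ := by
    rw [← sq_eq_sq₀ (norm_nonneg _) (norm_nonneg _), norm_sq_plane, norm_sq_eq_tail]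
    rfl
  rw [hn]
  exact hball _ ((mem_iff_mem_crossSection hE hn rfl).1 hx)

theorem IsGeneratingCurve.norm_le_one (hγ : IsGeneratingCurve A β γ)
    (hball : ∀ q ∈ A, ‖q‖ ≤ 1) {s : ℝ} (hs : s ∈ Icc (-β) β) : ‖γ s‖ ≤ 1 :=
  closure_minimal (t := {q | ‖q‖ ≤ 1}) hball (isClosed_le continuous_norm continuous_const)
    (frontier_subset_closure (hγ.mem_boundary s hs))

theorem IsGeneratingCurve.isProfile (hγ : IsGeneratingCurve (crossSection E) β γ) (hEo : IsOpen E)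
    (hE : IsSphericallySymmetric E) (hball : ∀ q ∈ crossSection E, ‖q‖ ≤ 1) :
    IsProfile (fun s => γ s 0) (fun s => γ s 1) (deriv fun s => γ s 0) (deriv fun s => γ s 1)
      (deriv (deriv fun s => γ s 0)) (deriv (deriv fun s => γ s 1)) β := by
  have hI : Ico 0 β ⊆ Ioo (-β) β := fun s hs => ⟨by linarith [hγ.pos, hs.1], hs.2⟩
  refine ⟨hγ.pos, fun s hs => hγ.hasDerivAt_coord (hI hs) 0,
    fun s hs => hγ.hasDerivAt_coord (hI hs) 1, fun s hs => hγ.hasDerivAt_deriv (hI hs) 0,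
    fun s hs => hγ.hasDerivAt_deriv (hI hs) 1, (hγ.continuousOn_deriv_deriv 0).mono hI,
    (hγ.continuousOn_deriv_deriv 1).mono hI, hγ.apply_zero_zero, hγ.apply_zero_one,
    hγ.deriv_zero.1, hγ.deriv_zero.2, hγ.above, fun s hs => hγ.unit_speed_sq (hI hs),
    fun s hs => ?_, fun s hs => ?_, fun s hs => ?_⟩
  · have h1 := ((hγ.hasDerivAt_deriv (hI hs) 0).fun_pow 2).add
      ((hγ.hasDerivAt_deriv (hI hs) 1).fun_pow 2)
    have h2 := (hasDerivAt_const s (1 : ℝ)).congr_of_eventuallyEq (f₁ := fun s =>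
      deriv (fun s => γ s 0) s ^ 2 + deriv (fun s => γ s 1) s ^ 2) (by
        filter_upwards [isOpen_Ioo.mem_nhds (hI hs)] with t ht using hγ.unit_speed_sq ht)
    have h3 := h1.unique h2
    push_cast at h3
    linarith
  · rcases hs.1.eq_or_lt with h0 | h0
    · rw [← h0, hγ.deriv_zero.1, hγ.apply_zero_one]; simp
    · exact radial_deriv_nonpos hEo hE hγ hball ⟨h0, hs.2⟩
  · have h := hγ.norm_le_one hball ⟨(hI hs).1.le, hs.2.le⟩
    rw [← norm_sq_plane]
    exact pow_le_one₀ (norm_nonneg _) h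

/-- The derivative of `u / v` is `-(u v' - v u') / v²`, which is negative: the polar angle
increases. -/
theorem injOn_ratio {u v u' v' : ℝ → ℝ} {b : ℝ} (hu : ∀ s ∈ Ioo 0 b, HasDerivAt u (u' s) s)
    (hv : ∀ s ∈ Ioo 0 b, HasDerivAt v (v' s) s) (hv0 : ∀ s ∈ Ioo 0 b, 0 < v s)
    (hY : ∀ s ∈ Ioo 0 b, 0 < u s * v' s - v s * u' s) :
    InjOn (fun s => u s / v s) (Ioo 0 b) := by
  have hd : ∀ s ∈ Ioo 0 b, HasDerivAt (fun s => u s / v s)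
      ((u' s * v s - u s * v' s) / v s ^ 2) s := fun s hs =>
    (hu s hs).div (hv s hs) (hv0 s hs).ne'
  refine (strictAntiOn_of_hasDerivWithinAt_neg (convex_Ioo 0 b)
    (fun s hs => (hd s hs).continuousAt.continuousWithinAt)
    (fun s hs => (hd s (interior_subset hs)).hasDerivWithinAt) fun s hs => ?_).injOn
  have hs' := interior_subset hs
  exact div_neg_of_neg_of_pos (by linarith [hY s hs']) (pow_pos (hv0 s hs') 2)

/-- The generating curve satisfies the Euler–Lagrange equation as long as it is a polar graph. -/
theorem IsGeneratingCurve.isCritical (hγ : IsGeneratingCurve (crossSection E) β γ)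
    (hp : 0 < p) (hEo : IsOpen E) (hE : IsSphericallySymmetric E) (hiso : IsIsoperimetric p E)
    (hfin : weightedPerimeter p E ≠ ⊤) (hball : ∀ q ∈ crossSection E, ‖q‖ ≤ 1) :
    IsProfile.IsCritical (k + 1) p (fun s => γ s 0) (fun s => γ s 1) (deriv fun s => γ s 0)
      (deriv fun s => γ s 1) (deriv (deriv fun s => γ s 0)) (deriv (deriv fun s => γ s 1)) β := by
  intro b hb hY
  have hprof := hγ.isProfile hEo hE hball
  have hI : Ico 0 β ⊆ Ioo (-β) β := fun s hs => ⟨by linarith [hγ.pos, hs.1], hs.2⟩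
  -- the polar angle still increases slightly beyond `b`
  obtain ⟨b', hbb', hb'β, hY'⟩ : ∃ b', b < b' ∧ b' ≤ β ∧ ∀ s ∈ Ioo 0 b',
      0 < γ s 0 * deriv (fun s => γ s 1) s - γ s 1 * deriv (fun s => γ s 0) s := by
    have hbI : b ∈ Ico 0 β := ⟨hb.1.le, hb.2⟩
    have h1 := (hprof.hasDerivAt_cross hbI).continuousAt.eventually
      (lt_mem_nhds (hY b ⟨hb.1.le, le_rfl⟩))
    obtain ⟨δ, hδ, hball'⟩ := Metric.eventually_nhds_iff.1 h1
    refine ⟨min (b + δ) β, lt_min (by linarith) hb.2, min_le_right _ _, fun s hs => ?_⟩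
    rcases le_or_gt s b with h | h
    · exact hY s ⟨hs.1.le, h⟩
    · refine hball' ?_
      rw [Real.dist_eq, abs_of_pos (by linarith)]
      linarith [hs.2.trans_le (min_le_left (b + δ) β)]
  have hI' : Ioo 0 b' ⊆ Ioo (-β) β := fun s hs =>
    hI ⟨hs.1.le, hs.2.trans_le hb'β⟩
  have hIb : Ioo 0 b ⊆ Ioo 0 b' := Ioo_subset_Ioo_right hbb'.le
  have hinj' := injOn_ratio (fun s hs => hγ.hasDerivAt_coord (hI' hs) 0)
    (fun s hs => hγ.hasDerivAt_coord (hI' hs) 1)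
    (fun s hs => hγ.above s ⟨hs.1, hs.2.trans_le hb'β⟩) hY'
  have harc : IsPolarArc (fun s => γ s 0) (fun s => γ s 1) (deriv fun s => γ s 0)
      (deriv fun s => γ s 1) b :=
    ⟨hb.1, fun s hs => hγ.hasStrictDerivAt_coord (hI' (hIb hs)) 0,
      fun s hs => hγ.hasStrictDerivAt_coord (hI' (hIb hs)) 1,
      (hγ.contDiffOn_deriv 0).continuousOn.mono (hIb.trans hI'),
      (hγ.contDiffOn_deriv 1).continuousOn.mono (hIb.trans hI'),
      fun s hs => hγ.above s ⟨hs.1, hs.2.trans hb.2⟩, fun s hs => hY' s (hIb hs),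
      hinj'.mono hIb, fun s hs => hγ.unit_speed_sq (hI' (hIb hs)),
      fun s hs => hprof.norm_le s ⟨hs.1.le, hs.2.trans hb.2⟩⟩
  obtain ⟨τ, hτ, hsub⟩ := hγ.exists_subgraph (isOpen_crossSection hEo) hball hb.1 hbb' hb'β hinj'
    fun Ω hΩ hΩs => by
      have ho := isOpen_image_coneMap harc.hu harc.hv harc.cross_pos hΩ hΩs
      have hc : Continuous fun q : EuclideanSpace ℝ (Fin 2) => (q 0, q 1) := by fun_prop
      convert ho.preimage hc using 1
      ext q
      constructor
      · rintro ⟨z, hz, rfl⟩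
        exact ⟨z, hz, rfl⟩
      · rintro ⟨z, hz, he⟩
        simp only [coneMap, Prod.mk.injEq] at he
        exact ⟨z, hz, plane_ext he.1 he.2⟩
  have hin : IsInsideArc (k := k + 1) E (fun s => γ s 0) (fun s => γ s 1) b τ := by
    refine ⟨hτ, fun s hs t ht x h0 h1 => ?_, ?_⟩
    · have hn : ‖x‖ = ‖t • γ s‖ := by
        rw [← sq_eq_sq₀ (norm_nonneg _) (norm_nonneg _), norm_sq_plane, norm_sq_eq_tail, h0, h1]
        rfl
      rw [mem_iff_mem_crossSection hE hn h0]
      exact hsub s hs t ht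
    · rintro x ⟨s, hs, h0, h1⟩
      have hsβ : s ∈ Ioo 0 β := ⟨hs.1, hs.2.trans hb.2⟩
      exact mem_frontier_of_mem_frontier_crossSection hEo hE
        (hγ.mem_boundary s ⟨by linarith [hγ.pos, hs.1], hsβ.2.le⟩) (hγ.above s hsβ) h0 h1
  exact euler_lagrange (k := k + 1) (by omega) hp hiso hfin harc hin
    (fun s hs => hγ.hasDerivAt_deriv (hI' (hIb hs)) 0)
    (fun s hs => hγ.hasDerivAt_deriv (hI' (hIb hs)) 1)
    ((hγ.continuousOn_deriv_deriv 0).mono (hIb.trans hI'))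
    ((hγ.continuousOn_deriv_deriv 1).mono (hIb.trans hI'))

/-- The limit of the canonical circles is the osculating circle. -/
theorem IsInitialAbscissa.sub_one_mul (hγ : IsGeneratingCurve A β γ) {F₀ : ℝ}
    (hF : IsInitialAbscissa γ F₀) : (F₀ - 1) * deriv (deriv fun s => γ s 0) 0 = 1 := by
  obtain ⟨F, hcan, hlim⟩ := hF
  have h0 := hγ.zero_mem
  have hu' := hγ.hasDerivAt_deriv h0 0
  have hX : HasDerivAt (fun s => γ s 0 * deriv (fun s => γ s 0) s +
      γ s 1 * deriv (fun s => γ s 1) s) (1 + deriv (deriv fun s => γ s 0) 0) 0 := by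
    refine (((hγ.hasDerivAt_coord h0 0).fun_mul hu').add
      ((hγ.hasDerivAt_coord h0 1).fun_mul (hγ.hasDerivAt_deriv h0 1))).congr_deriv ?_
    rw [hγ.deriv_zero.1, hγ.deriv_zero.2, hγ.apply_zero_zero, hγ.apply_zero_one]; ring
  rw [hasDerivAt_iff_tendsto_slope] at hu' hX
  have heq := tendsto_nhds_unique_of_eventuallyEq (hlim.mul hu') hX ?_
  · linear_combination heq
  filter_upwards [hcan, nhdsWithin_le_nhds (isOpen_Ioo.mem_nhds h0), self_mem_nhdsWithin]
    with s hs hsI hs0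
  obtain ⟨R, hR, -, hin⟩ := hs
  -- Tangency reads `F u' = u u' + v v'`. Dividing by `s` and letting `s → 0` gives `F₀ u''(0) = 1 +
  -- u''(0)`.
  have hin' : (γ s 0 - F s) * deriv (fun s => γ s 0) s + γ s 1 * deriv (fun s => γ s 1) s = 0 := by
    rw [← hγ.deriv_apply hsI, ← hγ.deriv_apply hsI]
    simp [PiLp.inner_apply, Fin.sum_univ_two] at hin
    linarith
  rw [slope_def_field, slope_def_field, hγ.deriv_zero.1, hγ.apply_zero_one]
  have : s ≠ 0 := hs0
  field_simp
  linarith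

/-- If the curve lies on the unit circle, it covers the upper half of it. -/
theorem IsGeneratingCurve.exists_eq_cos_sin (hγ : IsGeneratingCurve A β γ)
    (h1 : ∀ s ∈ Ico 0 β, γ s 0 ^ 2 + γ s 1 ^ 2 = 1) {θ : ℝ} (hθ : θ ∈ Ioo 0 Real.pi) :
    ∃ s ∈ Ioo 0 β, γ s 0 = Real.cos θ ∧ γ s 1 = Real.sin θ := by
  have hsub : Icc 0 β ⊆ Icc (-β) β := Icc_subset_Icc_left (by linarith [hγ.pos])
  have huc : ContinuousOn (fun s => γ s 0) (Icc 0 β) :=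
    (EuclideanSpace.proj (𝕜 := ℝ) (0 : Fin 2)).continuous.comp_continuousOn
      (hγ.continuousOn.mono hsub)
  have hvc : ContinuousOn (fun s => γ s 1) (Icc 0 β) :=
    (EuclideanSpace.proj (𝕜 := ℝ) (1 : Fin 2)).continuous.comp_continuousOn
      (hγ.continuousOn.mono hsub)
  have hend : γ β 0 ^ 2 = 1 := by
    have hc : ContinuousWithinAt (fun s => γ s 0 ^ 2 + γ s 1 ^ 2) (Ico 0 β) β :=
      (((huc.pow 2).add (hvc.pow 2)) β ⟨hγ.pos.le, le_rfl⟩).mono Ico_subset_Icc_self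
    have : (𝓝[Ico 0 β] β).NeBot := by
      rw [nhdsWithin_Ico_eq_nhdsLT hγ.pos]; infer_instance
    have h2 := tendsto_nhds_unique (hc.tendsto) ((tendsto_const_nhds (x := (1 : ℝ))).congr'
      (by filter_upwards [self_mem_nhdsWithin] with s hs using (h1 s hs).symm))
    rw [hγ.end_on_axis] at h2
    linarith
  -- The end point lies on the unit circle and on the axis; the value `1` would close the curve up
  -- at its start, against injectivity.
  have hneg : γ β 0 = -1 := by
    rcases sq_eq_sq_iff_eq_or_eq_neg.1 (hend.trans (one_pow 2).symm) with h | h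
    · exfalso
      have h3 : γ β = γ 0 := plane_ext (by rw [h, hγ.apply_zero_zero])
        (by rw [hγ.end_on_axis, hγ.apply_zero_one])
      have := hγ.eq_of_apply_eq ⟨by linarith [hγ.pos], le_rfl⟩ hγ.zero_mem h3
      exact hγ.pos.ne' this
    · exact h
  have hc1 : Real.cos θ < 1 := by
    rw [← Real.cos_zero]
    exact Real.cos_lt_cos_of_nonneg_of_le_pi le_rfl hθ.2.le hθ.1
  have hc2 : -1 < Real.cos θ := by
    rw [← Real.cos_pi]
    exact Real.cos_lt_cos_of_nonneg_of_le_pi hθ.1.le le_rfl hθ.2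
  obtain ⟨s, hs, hsc⟩ := intermediate_value_Icc' hγ.pos.le huc
    (show Real.cos θ ∈ Icc (γ β 0) (γ 0 0) by
      rw [hneg, hγ.apply_zero_zero]; exact ⟨hc2.le, hc1.le⟩)
  simp only at hsc
  have hs0 : 0 < s := lt_of_le_of_ne hs.1 fun h => by
    rw [← h, hγ.apply_zero_zero] at hsc; linarith
  have hsβ : s < β := lt_of_le_of_ne hs.2 fun h => by
    rw [h, hneg] at hsc; linarith
  refine ⟨s, ⟨hs0, hsβ⟩, hsc, ?_⟩
  have h2 := h1 s ⟨hs0.le, hsβ⟩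
  rw [← sq_eq_sq₀ (hγ.above s ⟨hs0, hsβ⟩).le (Real.sin_pos_of_mem_Ioo hθ).le, Real.sin_sq, ← hsc]
  linarith

/-- The first canonical circle of the generating curve of an isoperimetric set is centered at
abscissa at least `1 / 2`. -/
theorem one_half_le_initialAbscissa (hk : 1 ≤ k) (hp : 0 < p) (hEo : IsOpen E)
    (hiso : IsIsoperimetric p E) (hE : IsSphericallySymmetric E)
    (hγ : IsGeneratingCurve (crossSection E) β γ) {F₀ : ℝ} (hF : IsInitialAbscissa γ F₀) :
    1 / 2 ≤ F₀ := by
  by_contra! hlt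
  have hball : ∀ q ∈ crossSection E, ‖q‖ ≤ 1 := fun q hq =>
    norm_le_one_of_mem_crossSection hp hEo hE hiso.volume_ne_top hγ.rightmost hq
  have hne : E.Nonempty := by
    obtain ⟨q, hq⟩ := closure_nonempty_iff.1 ⟨_, frontier_subset_closure
      (hγ.mem_boundary 0 ⟨hγ.zero_mem.1.le, hγ.pos.le⟩)⟩
    exact ⟨_, hq⟩
  have hfin : weightedPerimeter p E ≠ ⊤ :=
    hiso.weightedPerimeter_ne_top (k := k + 1) hEo hne (by omega) hp
  -- The relation `(F₀ - 1) u''(0) = 1` turns `F₀ < 1/2` into initial curvature less than `2`.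
  have hcurv : -2 < deriv (deriv fun s => γ s 0) 0 := by
    have h := hF.sub_one_mul hγ
    by_contra! hle
    nlinarith
  have hend : Tendsto (fun s => γ s 1) (𝓝[<] β) (𝓝 0) := by
    have h := (EuclideanSpace.proj (𝕜 := ℝ) (1 : Fin 2)).continuous.comp_continuousOn
      hγ.continuousOn β ⟨by linarith [hγ.pos], le_rfl⟩
    have h2 : Tendsto (fun s => γ s 1) (𝓝[Icc (-β) β] β) (𝓝 (γ β 1)) := h
    rw [hγ.end_on_axis] at h2
    refine h2.mono_left ?_
    rw [← nhdsWithin_Ioo_eq_nhdsLT (show -β < β by linarith [hγ.pos])]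
    exact nhdsWithin_mono _ Ioo_subset_Icc_self
  have hcircle := (hγ.isProfile hEo hE hball).normSq_eq_one (by omega) hp
    (hγ.isCritical hp hEo hE hiso hfin hball) hcurv hend
  refine hiso.not_sphere_subset (k := k + 1) hEo hne (by omega) hp
    (fun x hx => norm_le_one_of_mem hE hball hx) ?_
  rintro x ⟨θ, hθ, h0, h1⟩
  obtain ⟨s, hs, hs0, hs1⟩ := hγ.exists_eq_cos_sin (fun s hs => (hcircle s hs).1) hθ
  exact mem_frontier_of_mem_frontier_crossSection hEo hE
    (hγ.mem_boundary s ⟨by linarith [hγ.pos, hs.1], hs.2.le⟩) (hγ.above s hs)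
    (by rw [h0, hs0]) (by rw [h1, hs1])

end Conclusion

end RadialPower

end

/-- Spherical symmetry makes the distance to the origin nonincreasing along the upper half of the
generating curve, so by the Euler–Lagrange equation a curve with `F₀ < 1 / 2` either never returns
to the axis or is the unit semicircle, and balls about the origin are unstable. Hence `1 / 2 ≤ F₀`
(with equality for balls whose boundary contains the origin), and the case described here is ruled
out altogether. -/
theorem mainTheorem5 (n : ℕ) [NeZero n] (hn : 3 ≤ n) (p : ℝ) (hp : 0 < p)
    (E : Set (EuclideanSpace ℝ (Fin n))) (hE_open : IsOpen E)
    (hE : RadialPower.IsIsoperimetric p E) (hsymm : RadialPower.IsSphericallySymmetric E)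
    (β : ℝ) (γ : ℝ → EuclideanSpace ℝ (Fin 2))
    (hγ : RadialPower.IsGeneratingCurve (RadialPower.crossSection E) β γ)
    (F₀ : ℝ) (hF₀ : RadialPower.IsInitialAbscissa γ F₀) (hleft : F₀ < 1 / 2) :
    γ β 0 < 0 ∧
      ∃ v : EuclideanSpace ℝ (Fin 2), Tendsto (deriv γ) (𝓝[<] β) (𝓝 v) ∧
        v 0 ≤ 0 ∧ v 1 ≤ 0 ∧ v ≠ !₂[0, -1] := by
  obtain ⟨k, rfl⟩ := Nat.exists_eq_add_of_le' (show 2 ≤ n by omega)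
  exact absurd hleft (not_lt.2
    (RadialPower.one_half_le_initialAbscissa (by omega) hp hE_open hE hsymm hγ hF₀))
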